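/- Let $N>4$ be real and let $\ell_1,L_0$ be real-valued functions, real-analytic on a neighborhood of $[0,1]$. On $(0,1)$ put $$\mathcal L=-x(1-x)\frac{d^2}{dx^2}-\Big(\tfrac52(1-x)-\tfrac N2x\Big)\frac{d}{dx}+\ell_1(x)\,x(1-x)\frac{d}{dx}+L_0(x),$$ $$M(x)=\exp\Big(-\int_0^x\ell_1(t)\,dt\Big),\qquad a(x)=x^{5/2}(1-x)^{N/2}M(x),\qquad b(x)=x^{3/2}(1-x)^{N/2-1}M(x),$$ so that $\mathcal L=-\frac1b\frac{d}{dx}a\frac{d}{dx}+L_0$. With $\xi=\arcsin(2x-1)\in(-\pi/2,\pi/2)$, i.e. $x=(1+\sin\xi)/2$, let $q$ be the function of $\xi$ given by $$q=L_0+\frac14\,\frac ab\Big[\Big(\frac{a'}a+\frac{b'}b\Big)'-\frac14\Big(\frac{a'}a+\frac{b'}b\Big)^2+\frac{a'}a\Big(\frac{a'}a+\frac{b'}b\Big)\Big]$$ (evaluated at $x=(1+\sin\xi)/2$, primes denoting $d/dx$). Then: (i) $\displaystyle q\sim\frac{2}{(\xi+\pi/2)^2}$ as $\xi\to-\pi/2+0$,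 and $\displaystyle q\sim\frac{(N-1)(N-3)}{4}\,\frac1{(\pi/2-\xi)^2}$ as $\xi\to\pi/2-0$. (ii) The operator $\mathfrak S_0\eta=-\dfrac{d^2\eta}{d\xi^2}+q\,\eta$ with domain $C_0^\infty(-\pi/2,\pi/2)$ in the complex Hilbert space $L^2(-\pi/2,\pi/2)$ is densely defined, symmetric and bounded below, and it has the Friedrichs extension $\mathfrak S$, a self-adjoint operator, whose spectrum consists of simple eigenvalues $\lambda_1<\lambda_2<\cdots<\lambda_n<\cdots\to+\infty$. (iii) The space $L^2\big((0,1);x^{3/2}(1-x)^{N/2-1}dx\big)$ coincides, with an equivalent norm, with the Hilbert space $L^2\big((0,1);b(x)\,dx\big)$. The operator $\mathfrak T_0y=\mathcal Ly$ with domain $C_0^\infty(0,1)$ has, in the latter space (that is, for the inner product $\int_0^1 f\,\overline g\,b\,dx$), a self-adjoint extension $\mathfrak T$ whose spectrum consists of the same numbers $(\lambda_n)_n$, each a simple eigenvalue of $\mathfrak T$. -/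

import Mathlib

open Set Filter Topology MeasureTheory Asymptotics
open scoped ENNReal Distributions

noncomputable section

/-! ### Unbounded operators in a complex Hilbert space -/

section Unbounded

variable {H : Type*} [NormedAddCommGroup H] [InnerProductSpace ℂ H]

/-- `z` is in the resolvent set of the operator `A` when `A - z` is a bijection from the domain
of `A` onto `H` with a bounded inverse `R`. -/
def IsResolventPoint (A : H →ₗ.[ℂ] H) (z : ℂ) : Prop :=
  ∃ R : H →L[ℂ] H,
    (∀ f : H, ∃ u : A.domain, (u : H) = R f ∧ A u - z • (u : H) = f) ∧
      ∀ u : A.domain, R (A u - z • (u : H)) = u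

/-- The spectrum of an unbounded operator. -/
def opSpectrum (A : H →ₗ.[ℂ] H) : Set ℂ := {z | ¬ IsResolventPoint A z}

/-- The eigenspace `{u ∈ D(A) | A u = z u}`. -/
def opEigenspace (A : H →ₗ.[ℂ] H) (z : ℂ) : Submodule ℂ H where
  carrier := {u | (u, z • u) ∈ A.graph}
  zero_mem' := by
    change ((0 : H), z • (0 : H)) ∈ A.graph
    rw [smul_zero]
    exact A.graph.zero_mem
  add_mem' := by
    intro u v hu hv
    change (u + v, z • (u + v)) ∈ A.graph
    rw [smul_add]
    exact A.graph.add_mem hu hv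
  smul_mem' := by
    intro c u hu
    change (c • u, z • (c • u)) ∈ A.graph
    rw [smul_comm z c u]
    exact A.graph.smul_mem c hu

/-- The spectrum of `A` is the set of the real numbers `lam 0, lam 1, …`, and each of them is a
simple eigenvalue of `A`. -/
def HasSimpleSpectrum (A : H →ₗ.[ℂ] H) (lam : ℕ → ℝ) : Prop :=
  opSpectrum A = range (fun n => (lam n : ℂ)) ∧
    ∀ n, Module.finrank ℂ (opEigenspace A (lam n : ℂ)) = 1

/-- The domain of the closure of the quadratic form `u ↦ ⟪u, A₀ u⟫` of a semibounded operator: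
the limits in `H` of sequences from `D(A₀)` that are Cauchy for the form. -/
def InFormDomain (A₀ : H →ₗ.[ℂ] H) (u : H) : Prop :=
  ∃ s : ℕ → A₀.domain, Tendsto (fun n => (s n : H)) atTop (𝓝 u) ∧
    Tendsto (fun p : ℕ × ℕ => inner ℂ ((s p.1 - s p.2 : A₀.domain) : H) (A₀ (s p.1 - s p.2)))
      atTop (𝓝 0)

/-- `A` is the Friedrichs extension of the densely defined symmetric operator `A₀`, which is
bounded below: it is the restriction of the adjoint of `A₀` to the domain of the closed form. -/
structure IsFriedrichsExtension (A₀ A : H →ₗ.[ℂ] H) : Prop where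
  dense_domain : Dense (A₀.domain : Set H)
  symmetric : A₀.IsFormalAdjoint A₀
  bounded_below : ∃ c : ℝ, ∀ u : A₀.domain, c * ‖(u : H)‖ ^ 2 ≤ (inner ℂ (u : H) (A₀ u)).re
  mem_graph_iff : ∀ u f : H, (u, f) ∈ A.graph ↔
    InFormDomain A₀ u ∧ ∀ v : A₀.domain, inner ℂ u (A₀ v) = inner ℂ f (v : H)

end Unbounded

/-! ### Second order differential operators on test functions -/

section DiffOp

/-- The differential expression `p₂ φ'' + p₁ φ' + p₀ φ`. -/
def diffExpr (p₂ p₁ p₀ : ℝ → ℝ) (φ : ℝ → ℂ) (x : ℝ) : ℂ :=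
  p₂ x * deriv (deriv φ) x + p₁ x * deriv φ x + p₀ x * φ x

/-- A measure that is locally finite on `Ω` and for which null sets in `Ω` are Lebesgue null. -/
structure AdmissibleMeasure (Ω : TopologicalSpace.Opens ℝ) (μ : Measure ℝ) : Prop where
  ac : volume.restrict (Ω : Set ℝ) ≪ μ
  finite : ∀ K : Set ℝ, IsCompact K → K ⊆ Ω → μ K < ∞

variable {Ω : TopologicalSpace.Opens ℝ} {μ : Measure ℝ}

lemma AdmissibleMeasure.memLp (hμ : AdmissibleMeasure Ω μ) {f : ℝ → ℂ}
    (hf : ContinuousOn f Ω) {K : Set ℝ} (hK : IsCompact K) (hKΩ : K ⊆ Ω)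
    (hfK : ∀ x, x ∉ K → f x = 0) : MemLp f 2 μ := by
  have h1 : K.indicator f = f := by
    ext x
    by_cases hx : x ∈ K
    · simp [hx]
    · simp [hx, hfK x hx]
  rw [← h1, memLp_indicator_iff_restrict hK.measurableSet]
  have : IsFiniteMeasure (μ.restrict K) :=
    ⟨by simpa using hμ.finite K hK hKΩ⟩
  obtain ⟨C, hC⟩ := hK.exists_bound_of_continuousOn (hf.mono hKΩ)
  refine MemLp.of_bound ((hf.mono hKΩ).aestronglyMeasurable hK.measurableSet) C ?_
  exact (ae_restrict_iff' hK.measurableSet).2 (Eventually.of_forall hC)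

lemma diffExpr_eq_zero (p₂ p₁ p₀ : ℝ → ℝ) (φ : ℝ → ℂ) {x : ℝ} (hx : x ∉ tsupport φ) :
    diffExpr p₂ p₁ p₀ φ x = 0 := by
  have h0 : φ =ᶠ[𝓝 x] fun _ => (0 : ℂ) := notMem_tsupport_iff_eventuallyEq.1 hx
  have h1 : deriv φ =ᶠ[𝓝 x] fun _ => (0 : ℂ) := by
    have := h0.deriv
    simpa using this
  have h2 : deriv (deriv φ) x = 0 := by
    rw [h1.deriv_eq]; simp
  simp [diffExpr, h2, h1.eq_of_nhds, h0.eq_of_nhds]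

lemma testFunction_deriv (φ : 𝓓(Ω, ℂ)) :
    Differentiable ℝ φ ∧ Differentiable ℝ (deriv φ) ∧ Continuous (deriv (deriv φ)) := by
  have h : ContDiff ℝ 2 φ := contDiff_infty.1 φ.contDiff 2
  have h' : ContDiff ℝ 1 (deriv φ) := by
    have : ContDiff ℝ (1 + 1) φ := by simpa [one_add_one_eq_two] using h
    exact (contDiff_succ_iff_deriv.1 this).2.2
  exact ⟨h.differentiable (by simp), h'.differentiable (by simp),
    h'.continuous_deriv le_rfl⟩

lemma memLp_testFunction (hμ : AdmissibleMeasure Ω μ) (φ : 𝓓(Ω, ℂ)) : MemLp φ 2 μ :=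
  hμ.memLp φ.continuous.continuousOn φ.hasCompactSupport φ.tsupport_subset
    fun _ hx => image_eq_zero_of_notMem_tsupport hx

lemma memLp_diffExpr (hμ : AdmissibleMeasure Ω μ) {p₂ p₁ p₀ : ℝ → ℝ}
    (h₂ : ContinuousOn p₂ Ω) (h₁ : ContinuousOn p₁ Ω) (h₀ : ContinuousOn p₀ Ω)
    (φ : 𝓓(Ω, ℂ)) : MemLp (diffExpr p₂ p₁ p₀ φ) 2 μ := by
  obtain ⟨d0, d1, c2⟩ := testFunction_deriv φ
  refine hμ.memLp ?_ φ.hasCompactSupport φ.tsupport_subset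
    fun _ hx => diffExpr_eq_zero _ _ _ _ hx
  have e : ∀ {p : ℝ → ℝ}, ContinuousOn p Ω → ContinuousOn (fun x => (p x : ℂ)) Ω :=
    fun hp => Complex.continuous_ofReal.comp_continuousOn hp
  exact (((e h₂).mul c2.continuousOn).add ((e h₁).mul d1.continuous.continuousOn)).add
    ((e h₀).mul d0.continuous.continuousOn)

/-- A test function as an element of `L²(μ)`. -/
def testToL2 (hμ : AdmissibleMeasure Ω μ) : 𝓓(Ω, ℂ) →ₗ[ℂ] Lp ℂ 2 μ where
  toFun φ := (memLp_testFunction hμ φ).toLp φ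
  map_add' _ _ := rfl
  map_smul' _ _ := rfl

lemma testToL2_injective (hμ : AdmissibleMeasure Ω μ) :
    Function.Injective (testToL2 hμ) := by
  intro φ ψ h
  have h1 : (φ : ℝ → ℂ) =ᵐ[μ] ψ := 
    (MemLp.toLp_eq_toLp_iff (memLp_testFunction hμ φ) (memLp_testFunction hμ ψ)).1 h
  have h2 : (φ : ℝ → ℂ) =ᵐ[volume.restrict (Ω : Set ℝ)] ψ := hμ.ac.ae_le h1
  have h3 : EqOn (φ : ℝ → ℂ) ψ Ω :=
    Measure.eqOn_open_of_ae_eq h2 Ω.isOpen φ.continuous.continuousOn ψ.continuous.continuousOn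
  ext x
  by_cases hx : x ∈ (Ω : Set ℝ)
  · exact h3 hx
  · rw [image_eq_zero_of_notMem_tsupport fun h => hx (φ.tsupport_subset h),
      image_eq_zero_of_notMem_tsupport fun h => hx (ψ.tsupport_subset h)]

/-- `φ ↦ p₂ φ'' + p₁ φ' + p₀ φ` from test functions to `L²(μ)`. -/
def diffToL2 (hμ : AdmissibleMeasure Ω μ) {p₂ p₁ p₀ : ℝ → ℝ}
    (h₂ : ContinuousOn p₂ Ω) (h₁ : ContinuousOn p₁ Ω) (h₀ : ContinuousOn p₀ Ω) :
    𝓓(Ω, ℂ) →ₗ[ℂ] Lp ℂ 2 μ where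
  toFun φ := (memLp_diffExpr hμ h₂ h₁ h₀ φ).toLp (diffExpr p₂ p₁ p₀ φ)
  map_add' φ ψ := by
    rw [← MemLp.toLp_add]
    congr 1
    obtain ⟨d0, d1, -⟩ := testFunction_deriv φ
    obtain ⟨e0, e1, -⟩ := testFunction_deriv ψ
    have h1 : deriv ((φ + ψ : 𝓓(Ω, ℂ)) : ℝ → ℂ) = deriv φ + deriv ψ := by
      ext x
      exact deriv_add (d0 x) (e0 x)
    have h2 : deriv (deriv φ + deriv ψ) = deriv (deriv φ) + deriv (deriv ψ) := by
      ext x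
      exact deriv_add (d1 x) (e1 x)
    ext x
    simp only [diffExpr, h1, h2, Pi.add_apply]
    change _ + _ + _ * (φ x + ψ x) = _
    ring
  map_smul' c φ := by
    rw [RingHom.id_apply, ← MemLp.toLp_const_smul]
    congr 1
    obtain ⟨d0, d1, -⟩ := testFunction_deriv φ
    have h1 : deriv ((c • φ : 𝓓(Ω, ℂ)) : ℝ → ℂ) = c • deriv φ := by
      ext x
      exact deriv_const_smul c (d0 x)
    have h2 : deriv (c • deriv φ) = c • deriv (deriv φ) := by
      ext x
      exact deriv_const_smul c (d1 x)
    ext x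
    simp only [diffExpr, h1, h2, Pi.smul_apply]
    change _ + _ + _ * (c • φ x) = _
    simp only [smul_eq_mul]
    ring

/-- The operator in `L²(μ)` with domain `C₀^∞(Ω)` given by `φ ↦ p₂ φ'' + p₁ φ' + p₀ φ`. -/
def diffOp (hμ : AdmissibleMeasure Ω μ) {p₂ p₁ p₀ : ℝ → ℝ}
    (h₂ : ContinuousOn p₂ Ω) (h₁ : ContinuousOn p₁ Ω) (h₀ : ContinuousOn p₀ Ω) :
    Lp ℂ 2 μ →ₗ.[ℂ] Lp ℂ 2 μ where
  domain := LinearMap.range (testToL2 hμ)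
  toFun := (diffToL2 hμ h₂ h₁ h₀).comp
    (LinearEquiv.ofInjective (testToL2 hμ) (testToL2_injective hμ)).symm.toLinearMap

end DiffOp

/-! ### The operator `𝓛` and its Liouville normal form -/

section Concrete

/-- The coefficient of `d/dx` in `𝓛`; the coefficient of `d²/dx²` is `-x (1 - x)`. -/
def coeffOne (N : ℝ) (ℓ₁ : ℝ → ℝ) (x : ℝ) : ℝ :=
  -(5 / 2 * (1 - x) - N / 2 * x) + ℓ₁ x * x * (1 - x)

/-- `M(x) = exp (- ∫₀ˣ ℓ₁)`. -/
def Mfun (ℓ₁ : ℝ → ℝ) (x : ℝ) : ℝ := Real.exp (-∫ t in (0 : ℝ)..x, ℓ₁ t)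

/-- `a(x) = x^{5/2} (1-x)^{N/2} M(x)`. -/
def afun (N : ℝ) (ℓ₁ : ℝ → ℝ) (x : ℝ) : ℝ :=
  x ^ (5 / 2 : ℝ) * (1 - x) ^ (N / 2) * Mfun ℓ₁ x

/-- `b(x) = x^{3/2} (1-x)^{N/2-1} M(x)`. -/
def bfun (N : ℝ) (ℓ₁ : ℝ → ℝ) (x : ℝ) : ℝ :=
  x ^ (3 / 2 : ℝ) * (1 - x) ^ (N / 2 - 1) * Mfun ℓ₁ x

/-- The logarithmic derivative `a'/a`. -/
def logDa (N : ℝ) (ℓ₁ : ℝ → ℝ) (x : ℝ) : ℝ := deriv (afun N ℓ₁) x / afun N ℓ₁ x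

/-- The logarithmic derivative `b'/b`. -/
def logDb (N : ℝ) (ℓ₁ : ℝ → ℝ) (x : ℝ) : ℝ := deriv (bfun N ℓ₁) x / bfun N ℓ₁ x

/-- The potential as a function of the original variable `x ∈ (0,1)`. -/
def potX (N : ℝ) (ℓ₁ L₀ : ℝ → ℝ) (x : ℝ) : ℝ :=
  L₀ x + 1 / 4 * (afun N ℓ₁ x / bfun N ℓ₁ x) *
    (deriv (fun t => logDa N ℓ₁ t + logDb N ℓ₁ t) x
      - 1 / 4 * (logDa N ℓ₁ x + logDb N ℓ₁ x) ^ 2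
      + logDa N ℓ₁ x * (logDa N ℓ₁ x + logDb N ℓ₁ x))

/-- The potential `q` as a function of `ξ = arcsin (2 x - 1)`, that is `x = (1 + sin ξ) / 2`. -/
def potential (N : ℝ) (ℓ₁ L₀ : ℝ → ℝ) (ξ : ℝ) : ℝ := potX N ℓ₁ L₀ ((1 + Real.sin ξ) / 2)

/-- The interval `(0, 1)`. -/
def unitInt : TopologicalSpace.Opens ℝ := ⟨Ioo 0 1, isOpen_Ioo⟩

/-- The interval `(-π/2, π/2)`. -/
def angleInt : TopologicalSpace.Opens ℝ := ⟨Ioo (-(Real.pi / 2)) (Real.pi / 2), isOpen_Ioo⟩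

/-- The measure `x^{3/2} (1-x)^{N/2-1} dx` on `(0,1)`. -/
def plainMeasure (N : ℝ) : Measure ℝ :=
  (volume.restrict (Ioo 0 1)).withDensity
    fun x => ENNReal.ofReal (x ^ (3 / 2 : ℝ) * (1 - x) ^ (N / 2 - 1))

/-- The measure `b(x) dx = x^{3/2} (1-x)^{N/2-1} M(x) dx` on `(0,1)`. -/
def weightMeasure (N : ℝ) (ℓ₁ : ℝ → ℝ) : Measure ℝ :=
  (volume.restrict (Ioo 0 1)).withDensity fun x => ENNReal.ofReal (bfun N ℓ₁ x)

/-- Lebesgue measure on `(-π/2, π/2)`. -/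
def angleMeasure : Measure ℝ := volume.restrict (Ioo (-(Real.pi / 2)) (Real.pi / 2))

variable {N : ℝ} {ℓ₁ L₀ : ℝ → ℝ}

lemma contDiffOn_Mfun (h : AnalyticOnNhd ℝ ℓ₁ (Icc 0 1)) :
    ContDiffOn ℝ (⊤ : ℕ∞) (Mfun ℓ₁) (Ioo 0 1) := by
  have hc : ContinuousOn ℓ₁ (Icc 0 1) := h.continuousOn
  have hd : ∀ x ∈ Ioo (0 : ℝ) 1, HasDerivAt (fun u => ∫ t in (0 : ℝ)..u, ℓ₁ t) (ℓ₁ x) x := by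
    intro x hx
    have hi : IntervalIntegrable ℓ₁ volume 0 x := by
      refine (hc.mono ?_).intervalIntegrable
      rw [uIcc_of_le hx.1.le]
      exact Icc_subset_Icc_right hx.2.le
    refine intervalIntegral.integral_hasDerivAt_right hi ?_ ?_
    · exact (hc.mono Ioo_subset_Icc_self).stronglyMeasurableAtFilter isOpen_Ioo x hx
    · exact (h x (Ioo_subset_Icc_self hx)).continuousAt
  have hI : ContDiffOn ℝ (⊤ : ℕ∞) (fun u => ∫ t in (0 : ℝ)..u, ℓ₁ t) (Ioo 0 1) := by
    rw [contDiffOn_infty_iff_deriv_of_isOpen isOpen_Ioo]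
    refine ⟨fun x hx => (hd x hx).differentiableAt.differentiableWithinAt, ?_⟩
    refine ContDiffOn.congr (f := ℓ₁) ?_ fun x hx => (hd x hx).deriv
    exact fun x hx => (h x (Ioo_subset_Icc_self hx)).contDiffAt.contDiffWithinAt
  exact hI.neg.exp

lemma contDiffOn_rpow (r s : ℝ) (h : AnalyticOnNhd ℝ ℓ₁ (Icc 0 1)) :
    ContDiffOn ℝ (⊤ : ℕ∞) (fun x => x ^ r * (1 - x) ^ s * Mfun ℓ₁ x) (Ioo 0 1) := by
  refine ContDiffOn.mul (ContDiffOn.mul ?_ ?_) (contDiffOn_Mfun h)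
  · exact contDiffOn_id.rpow_const_of_ne fun x hx => hx.1.ne'
  · exact (contDiffOn_const.sub contDiffOn_id).rpow_const_of_ne
      fun x hx => (sub_pos.2 hx.2).ne'

lemma prod_pos (r s : ℝ) {x : ℝ} (hx : x ∈ Ioo (0 : ℝ) 1) :
    0 < x ^ r * (1 - x) ^ s * Mfun ℓ₁ x :=
  mul_pos (mul_pos (Real.rpow_pos_of_pos hx.1 _) (Real.rpow_pos_of_pos (sub_pos.2 hx.2) _))
    (Real.exp_pos _)

lemma contDiffOn_logDeriv {f : ℝ → ℝ} (hf : ContDiffOn ℝ (⊤ : ℕ∞) f (Ioo 0 1))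
    (h0 : ∀ x ∈ Ioo (0 : ℝ) 1, 0 < f x) :
    ContDiffOn ℝ (⊤ : ℕ∞) (fun x => deriv f x / f x) (Ioo 0 1) :=
  ((contDiffOn_infty_iff_deriv_of_isOpen isOpen_Ioo).1 hf).2.div hf fun x hx => (h0 x hx).ne'

lemma continuousOn_potX (N : ℝ) (h : AnalyticOnNhd ℝ ℓ₁ (Icc 0 1))
    (h0 : AnalyticOnNhd ℝ L₀ (Icc 0 1)) : ContinuousOn (potX N ℓ₁ L₀) (Ioo 0 1) := by
  have ha : ContDiffOn ℝ (⊤ : ℕ∞) (afun N ℓ₁) (Ioo 0 1) := contDiffOn_rpow _ _ h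
  have hb : ContDiffOn ℝ (⊤ : ℕ∞) (bfun N ℓ₁) (Ioo 0 1) := contDiffOn_rpow _ _ h
  have hA : ContDiffOn ℝ (⊤ : ℕ∞) (logDa N ℓ₁) (Ioo 0 1) :=
    contDiffOn_logDeriv ha fun x hx => prod_pos _ _ hx
  have hB : ContDiffOn ℝ (⊤ : ℕ∞) (logDb N ℓ₁) (Ioo 0 1) :=
    contDiffOn_logDeriv hb fun x hx => prod_pos _ _ hx
  have hS := ((contDiffOn_infty_iff_deriv_of_isOpen isOpen_Ioo).1 (hA.add hB)).2.continuousOn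
  have hab := ha.continuousOn.div hb.continuousOn fun x hx =>
    (prod_pos (ℓ₁ := ℓ₁) (3 / 2) (N / 2 - 1) hx).ne'
  have hAB := hA.continuousOn.add hB.continuousOn
  exact (h0.continuousOn.mono Ioo_subset_Icc_self).add ((continuousOn_const.mul hab).mul
    ((hS.sub (continuousOn_const.mul (hAB.pow 2))).add (hA.continuousOn.mul hAB)))

lemma continuousOn_potential (N : ℝ) (h : AnalyticOnNhd ℝ ℓ₁ (Icc 0 1))
    (h0 : AnalyticOnNhd ℝ L₀ (Icc 0 1)) :
    ContinuousOn (potential N ℓ₁ L₀) angleInt := by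
  refine (continuousOn_potX N h h0).comp (by fun_prop) ?_
  intro ξ hξ
  have hξ' : ξ ∈ Ioo (-(Real.pi / 2)) (Real.pi / 2) := hξ
  have h1 : -1 < Real.sin ξ := by
    rw [← Real.sin_pi_div_two, ← Real.sin_neg]
    exact Real.sin_lt_sin_of_lt_of_le_pi_div_two (by linarith) hξ'.2.le (by linarith [hξ'.1])
  have h2 : Real.sin ξ < 1 := by
    rw [← Real.sin_pi_div_two]
    exact Real.sin_lt_sin_of_lt_of_le_pi_div_two hξ'.1.le le_rfl hξ'.2
  constructor <;> linarith

lemma continuousOn_coeffOne (N : ℝ) (h : AnalyticOnNhd ℝ ℓ₁ (Icc 0 1)) :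
    ContinuousOn (coeffOne N ℓ₁) unitInt := by
  have h1 : ContinuousOn ℓ₁ (Ioo 0 1) := h.continuousOn.mono Ioo_subset_Icc_self
  have h2 : ContinuousOn (fun x => ℓ₁ x * x * (1 - x)) (Ioo 0 1) :=
    (h1.mul continuousOn_id).mul (by fun_prop)
  exact ContinuousOn.add (by fun_prop) h2

lemma admissible_angle : AdmissibleMeasure angleInt angleMeasure where
  ac := Measure.AbsolutelyContinuous.rfl
  finite _ hK _ := (Measure.restrict_apply_le _ _).trans_lt hK.measure_lt_top

lemma admissible_weight (N : ℝ) (h : AnalyticOnNhd ℝ ℓ₁ (Icc 0 1)) :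
    AdmissibleMeasure unitInt (weightMeasure N ℓ₁) where
  ac := by
    have hb : ContinuousOn (bfun N ℓ₁) (Ioo 0 1) := (contDiffOn_rpow _ _ h).continuousOn
    refine withDensity_absolutelyContinuous' ?_ ?_
    · exact ENNReal.measurable_ofReal.comp_aemeasurable (hb.aemeasurable measurableSet_Ioo)
    · refine (ae_restrict_iff' measurableSet_Ioo).2 (Eventually.of_forall fun x hx => ?_)
      exact (ENNReal.ofReal_pos.2 (prod_pos _ _ hx)).ne'
  finite K hK hKΩ := by
    have hb : ContinuousOn (bfun N ℓ₁) (Ioo 0 1) := (contDiffOn_rpow _ _ h).continuousOn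
    obtain ⟨C, hC⟩ := hK.exists_bound_of_continuousOn (hb.mono hKΩ)
    rw [weightMeasure, withDensity_apply _ hK.measurableSet,
      Measure.restrict_restrict hK.measurableSet]
    calc ∫⁻ x in K ∩ Ioo 0 1, ENNReal.ofReal (bfun N ℓ₁ x)
        ≤ ∫⁻ _ in K ∩ Ioo 0 1, ENNReal.ofReal C := by
          refine setLIntegral_mono' (hK.measurableSet.inter measurableSet_Ioo) fun x hx => ?_
          exact ENNReal.ofReal_le_ofReal ((le_abs_self _).trans (hC x hx.1))
      _ = ENNReal.ofReal C * volume (K ∩ Ioo 0 1) := by rw [setLIntegral_const]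
      _ < ∞ := ENNReal.mul_lt_top ENNReal.ofReal_lt_top
          ((measure_mono inter_subset_left).trans_lt hK.measure_lt_top)

/-- The operator `-d²/dξ² + q` on `C₀^∞(-π/2, π/2)` in `L²(-π/2, π/2)`. -/
def schrodingerOp (N : ℝ) (hℓ : AnalyticOnNhd ℝ ℓ₁ (Icc 0 1))
    (hL : AnalyticOnNhd ℝ L₀ (Icc 0 1)) : Lp ℂ 2 angleMeasure →ₗ.[ℂ] Lp ℂ 2 angleMeasure :=
  diffOp (Ω := angleInt) (p₂ := fun _ => -1) (p₁ := fun _ => 0) (p₀ := potential N ℓ₁ L₀)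
    admissible_angle continuousOn_const continuousOn_const (continuousOn_potential N hℓ hL)

/-- The operator `𝓛 = -x(1-x) d²/dx² - (5/2 (1-x) - N/2 x) d/dx + ℓ₁(x) x(1-x) d/dx + L₀(x)` on
`C₀^∞(0, 1)` in `L²(b dx)`. -/
def ellOp (N : ℝ) (hℓ : AnalyticOnNhd ℝ ℓ₁ (Icc 0 1))
    (hL : AnalyticOnNhd ℝ L₀ (Icc 0 1)) :
    Lp ℂ 2 (weightMeasure N ℓ₁) →ₗ.[ℂ] Lp ℂ 2 (weightMeasure N ℓ₁) :=
  diffOp (Ω := unitInt) (p₂ := fun x => -(x * (1 - x))) (p₁ := coeffOne N ℓ₁) (p₀ := L₀)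
    (admissible_weight N hℓ) (by fun_prop) (continuousOn_coeffOne N hℓ)
    (hL.continuousOn.mono Ioo_subset_Icc_self)

end Concrete

end

/-! Near each end of the interval `q` behaves like a positive constant over the squared distance, so
`q` is bounded below and some `c` makes `q + c = r²` with `r` real. The shifted form of the
Schrödinger operator on test functions is then `‖φ'‖² + ‖r φ‖²`, the squared norm of `B φ = (φ', r
φ)` in `L² × L²`. The closure `V` of the range of `B` is the form domain, and it embeds into `L²` by
`J (v, w) = ∫ v`, which undoes `B`. With `J` restricted to `V`, the operator `K = J J*` is
symmetric, nonnegative and injective, and `K⁻¹ - c` is the Friedrichs extension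
(`isFriedrichsExtension_formResolvent`). Integration from `-π/2` is compact by Arzelà–Ascoli, so `K`
is compact. The spectral theorem for `K` then gives real eigenvalues tending to infinity and no
other spectrum (`exists_simpleSpectrum`).

Simplicity is a Wronskian argument at the left end. An eigenfunction `u` is a primitive of some `v`
in `L²`; it solves `u'' = (q - λ) u` classically, and `|u|² ≤ C (ξ + π/2)`. If two eigenfunctions
for the same `λ` had nonzero (hence constant) Wronskian, `1 / (ξ + π/2)` would be dominated by the
sum of the squares of their derivatives, which is integrable (`wronskian_eq_zero`).

The Liouville transformation `y ↦ ((a b)^{1/4} y)(x(ξ))` maps test functions onto test functions, is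
isometric because `√(a b) = b dx/dξ`, and intertwines the two differential expressions
(`diffExpr_liouvilleTest`). Its unitary extension `U` therefore carries the Schrödinger extension
back to a self-adjoint extension `U⁻¹ (K⁻¹ - c) U` of `𝓛` with the same simple spectrum. -/

/-! ### Operators of the form `K⁻¹ - c` with `K` bounded and injective -/

section AbstractOperators

variable {H : Type*} [NormedAddCommGroup H] [InnerProductSpace ℂ H]

/-- The graph `{(u, f) | u = K (f + c u)}` of `K⁻¹ - c`. -/
def shiftedInverseGraph (K : H →L[ℂ] H) (c : ℝ) : Submodule ℂ (H × H) :=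
  LinearMap.ker (LinearMap.fst ℂ H H -
    (K : H →ₗ[ℂ] H) ∘ₗ (LinearMap.snd ℂ H H + (c : ℂ) • LinearMap.fst ℂ H H))

/-- The operator `K⁻¹ - c`. -/
noncomputable def shiftedInverse (K : H →L[ℂ] H) (c : ℝ) : H →ₗ.[ℂ] H :=
  (shiftedInverseGraph K c).toLinearPMap

lemma mem_shiftedInverseGraph {K : H →L[ℂ] H} {c : ℝ} {u f : H} :
    (u, f) ∈ shiftedInverseGraph K c ↔ u = K (f + (c : ℂ) • u) := by
  simp [shiftedInverseGraph, sub_eq_zero]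

/-- Injectivity of `K` makes the relation single-valued: a pair `(0, f)` in it satisfies `K f = 0`.
-/
lemma mem_graph_shiftedInverse {K : H →L[ℂ] H} (hK : Function.Injective K) {c : ℝ} {u f : H} :
    (u, f) ∈ (shiftedInverse K c).graph ↔ u = K (f + (c : ℂ) • u) := by
  rw [shiftedInverse, Submodule.toLinearPMap_graph_eq, mem_shiftedInverseGraph]
  rintro ⟨u, f⟩ h (rfl : u = 0)
  rw [mem_shiftedInverseGraph] at h
  apply hK
  simpa using h.symm

lemma mem_opEigenspace {A : H →ₗ.[ℂ] H} {z : ℂ} {u : H} :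
    u ∈ opEigenspace A z ↔ (u, z • u) ∈ A.graph := Iff.rfl

lemma mem_opEigenspace_shiftedInverse {K : H →L[ℂ] H} (hK : Function.Injective K) {c : ℝ}
    {z : ℂ} {u : H} : u ∈ opEigenspace (shiftedInverse K c) z ↔ u = (z + c) • K u := by
  rw [mem_opEigenspace, mem_graph_shiftedInverse hK, ← add_smul, map_smul]

/-- If `x` is orthogonal to the range of `K`, then `‖K x‖² = ⟪K (K x), x⟫ = 0`. -/
lemma dense_range_of_symmetric [CompleteSpace H] {K : H →L[ℂ] H} (hK : Function.Injective K)
    (hs : K.IsSymmetric) : DenseRange K := by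
  have h : (LinearMap.range (K : H →ₗ[ℂ] H)).topologicalClosure = ⊤ := by
    rw [Submodule.topologicalClosure_eq_top_iff, Submodule.eq_bot_iff]
    intro x hx
    rw [Submodule.mem_orthogonal] at hx
    have h0 : K x = 0 := by
      rw [← inner_self_eq_zero (𝕜 := ℂ)]
      have := hx (K (K x)) ⟨_, rfl⟩
      rw [← this]
      exact (hs (K x) x).symm
    exact hK (by simpa using h0)
  have := (Submodule.dense_iff_topologicalClosure_eq_top).2 h
  exact this

lemma dense_domain_shiftedInverse [CompleteSpace H] {K : H →L[ℂ] H}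
    (hK : Function.Injective K) (hs : K.IsSymmetric) (c : ℝ) :
    Dense ((shiftedInverse K c).domain : Set H) := by
  refine (dense_range_of_symmetric hK hs).mono ?_
  rintro _ ⟨g, rfl⟩
  refine (LinearPMap.mem_domain_iff).2 ⟨g - (c : ℂ) • K g, ?_⟩
  rw [mem_graph_shiftedInverse hK, sub_add_cancel]

theorem isSelfAdjoint_shiftedInverse [CompleteSpace H] {K : H →L[ℂ] H}
    (hK : Function.Injective K) (hs : K.IsSymmetric) (c : ℝ) :
    IsSelfAdjoint (shiftedInverse K c) := by
  have hd := dense_domain_shiftedInverse hK hs c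
  rw [LinearPMap.isSelfAdjoint_def]
  apply LinearPMap.eq_of_eq_graph
  rw [LinearPMap.adjoint_graph_eq_graph_adjoint hd]
  ext ⟨u, f⟩
  rw [Submodule.mem_adjoint_iff, mem_graph_shiftedInverse hK]
  have hsym : ∀ x y : H, inner ℂ (K x) y = inner ℂ x (K y) := fun x y => hs x y
  constructor
  · intro h
    refine ext_inner_left ℂ fun g => ?_
    -- The pairs `(K g, g - c K g)` lie in the graph; testing the adjoint condition on them alone
    -- already yields `u = K (f + c u)`.
    have := h (K g) (g - (c : ℂ) • K g) ((mem_graph_shiftedInverse hK).2 (by simp))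
    rw [inner_sub_left, inner_smul_left, Complex.conj_ofReal, sub_sub, sub_eq_zero] at this
    rw [this, ← hsym, inner_add_right, inner_smul_right, add_comm]
  · intro h a b hab
    rw [mem_graph_shiftedInverse hK] at hab
    have e1 : inner ℂ (b + (c : ℂ) • a) u = inner ℂ a (f + (c : ℂ) • u) := by
      conv_lhs => rw [h]
      conv_rhs => rw [hab]
      rw [hsym]
    rw [inner_add_left, inner_add_right, inner_smul_left, inner_smul_right,
      Complex.conj_ofReal] at e1
    simpa [sub_eq_zero] using e1

/-- Expressed through the graph alone, the resolvent condition avoids subtypes of the domain and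
transports directly along a unitary map. -/
lemma notMem_opSpectrum_iff {A : H →ₗ.[ℂ] H} {z : ℂ} :
    z ∉ opSpectrum A ↔ ∃ R : H →L[ℂ] H, (∀ f, (R f, f + z • R f) ∈ A.graph) ∧
      ∀ u f, (u, f) ∈ A.graph → R (f - z • u) = u := by
  simp only [opSpectrum, mem_ofPred_eq, not_not, IsResolventPoint]
  refine exists_congr fun R => and_congr (forall_congr' fun f => ?_) ?_
  · simp only [LinearPMap.mem_graph_iff]
    refine exists_congr fun u => and_congr_right fun hu => ?_
    rw [sub_eq_iff_eq_add, hu]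
  · constructor
    · rintro h u f huf
      obtain ⟨x, rfl, rfl⟩ := LinearPMap.mem_graph_iff _ |>.1 huf
      exact h x
    · intro h u
      exact h _ _ (LinearPMap.mem_graph _ u)

/-- Formally `K⁻¹ - c - z = K⁻¹ (1 - w K)` with `w = z + c`. By the Fredholm alternative `1 - w K`
is invertible as soon as it is injective, and the resolvent is then `K (1 - w K)⁻¹`. -/
theorem mem_opSpectrum_shiftedInverse_iff [CompleteSpace H] {K : H →L[ℂ] H}
    (hK : Function.Injective K) (hc : IsCompactOperator K) {c : ℝ} {z : ℂ} :
    z ∈ opSpectrum (shiftedInverse K c) ↔ opEigenspace (shiftedInverse K c) z ≠ ⊥ := by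
  constructor
  · contrapose!
    intro h
    have hinj : ∀ u, u = (z + c) • K u → u = 0 := fun u hu => by
      have : u ∈ opEigenspace (shiftedInverse K c) z := (mem_opEigenspace_shiftedInverse hK).2 hu
      simpa [h] using this
    set w := z + c with hw
    have hunit : IsUnit (1 - w • K) := by
      by_cases h0 : w = 0
      · simp [h0]
      · have h1 := (hc.hasEigenvalue_or_mem_resolventSet (inv_ne_zero h0)).resolve_left (by
          intro hev
          obtain ⟨x, hx⟩ := hev.exists_hasEigenvector
          have e := hx.apply_eq_smul
          apply hx.2
          apply hinj
          change K x = _ at e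
          rw [e, smul_inv_smul₀ h0])
        rw [spectrum.mem_resolventSet_iff] at h1
        have h2 : (1 : H →L[ℂ] H) - w • K = w • (algebraMap ℂ (H →L[ℂ] H) w⁻¹ - K) := by
          rw [smul_sub, Algebra.algebraMap_eq_smul_one, smul_inv_smul₀ h0]
        rw [h2]
        exact h1.smul (Units.mk0 w h0)
    obtain ⟨Q, hQ⟩ := hunit
    have hQ1 : ∀ f, (1 - w • K) ((Q⁻¹ : (H →L[ℂ] H)ˣ).1 f) = f := fun f => by
      rw [← hQ]; exact DFunLike.congr_fun Q.mul_inv f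
    have hQ2 : ∀ f, (Q⁻¹ : (H →L[ℂ] H)ˣ).1 ((1 - w • K) f) = f := fun f => by
      rw [← hQ]; exact DFunLike.congr_fun Q.inv_mul f
    rw [notMem_opSpectrum_iff]
    refine ⟨K * (Q⁻¹ : (H →L[ℂ] H)ˣ).1, fun f => ?_, fun u f huf => ?_⟩
    · rw [mem_graph_shiftedInverse hK]
      have := hQ1 f
      simp only [sub_apply, one_apply_eq_self,
        smul_apply] at this
      simp only [mul_apply_eq_comp]
      congr 1
      rw [add_assoc, ← add_smul, ← hw]
      exact sub_eq_iff_eq_add.1 this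
    · rw [mem_graph_shiftedInverse hK] at huf
      simp only [mul_apply_eq_comp]
      conv_rhs => rw [huf]
      congr 1
      rw [← hQ2 (f + (c : ℂ) • u)]
      congr 1
      simp only [sub_apply, one_apply_eq_self,
        smul_apply]
      rw [← huf, hw, add_smul]
      abel
  · contrapose!
    intro h
    obtain ⟨R, -, hR⟩ := notMem_opSpectrum_iff.1 h
    rw [Submodule.eq_bot_iff]
    intro u hu
    have := hR _ _ (mem_opEigenspace.1 hu)
    simpa using this.symm

/-- Enumeration of a set of reals that is discrete and bounded below. -/
lemma exists_strictMono_enumeration {Λ : Set ℝ} (hi : Λ.Infinite)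
    (hf : ∀ R, (Λ ∩ Iic R).Finite) :
    ∃ lam : ℕ → ℝ, StrictMono lam ∧ Tendsto lam atTop atTop ∧ range lam = Λ := by
  obtain ⟨x0, hx0⟩ := hi.nonempty
  obtain ⟨m, ⟨hmΛ, hm1⟩, hm2⟩ := (hf x0).exists_minimal ⟨x0, hx0, le_refl x0⟩
  have hmin : ∀ x ∈ Λ, m ≤ x := fun x hx => by
    by_contra h
    push Not at h
    exact absurd (hm2 ⟨hx, h.le.trans hm1⟩ h.le) (not_le.2 h)
  have hunb : ∀ R, ∃ x ∈ Λ, R < x := fun R => by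
    by_contra! h
    exact hi ((hf R).subset fun x hx => ⟨hx, h x hx⟩)
  -- A locally finite linear order with a least element and no greatest one is isomorphic to `ℕ`;
  -- the instances below supply these properties.
  let : LocallyFiniteOrder Λ := LocallyFiniteOrder.ofFiniteIcc fun a b =>
    Finite.of_finite_image (f := Subtype.val) ((hf b).subset (by
      rintro _ ⟨x, hx, rfl⟩
      exact ⟨x.2, hx.2⟩)) Subtype.val_injective.injOn
  let : OrderBot Λ := { bot := ⟨m, hmΛ⟩, bot_le := fun x => hmin x x.2 }
  have : NoMaxOrder Λ := ⟨fun a => by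
    obtain ⟨x, hx, h⟩ := hunb a
    exact ⟨⟨x, hx⟩, h⟩⟩
  let : SuccOrder Λ := LinearLocallyFiniteOrder.succOrder Λ
  let : PredOrder Λ := LinearLocallyFiniteOrder.predOrder Λ
  let e : Λ ≃o ℕ := orderIsoNatOfLinearSuccPredArch
  have hs : StrictMono fun n => (e.symm n : ℝ) := fun a b h => e.symm.strictMono h
  refine ⟨fun n => (e.symm n : ℝ), hs, ?_, ?_⟩
  · refine tendsto_atTop_atTop_of_monotone hs.monotone fun R => ?_
    obtain ⟨x, hx, h⟩ := hunb R
    exact ⟨e ⟨x, hx⟩, by simpa using h.le⟩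
  · ext x
    constructor
    · rintro ⟨n, rfl⟩
      exact (e.symm n).2
    · intro hx
      exact ⟨e ⟨x, hx⟩, by simp⟩

/-! ### Discrete spectrum of `K⁻¹ - c` for compact, symmetric, nonnegative `K` -/

section SpectralTheorem

variable {K : H →L[ℂ] H} (hK : Function.Injective K)
  (hc : IsCompactOperator K) (hs : K.IsSymmetric)
  (hp : ∀ f, 0 ≤ (inner ℂ f (K f)).re) {c : ℝ}

include hK hp in
-- Pairing `u = (x + c) K u` with `u` gives `‖u‖² = (x + c) ⟪u, K u⟫`, where the last factor is
-- nonnegative.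
lemma add_pos_of_mem_opEigenspace {x : ℝ} {u : H}
    (hu : u ∈ opEigenspace (shiftedInverse K c) x) (h0 : u ≠ 0) : 0 < x + c := by
  rw [mem_opEigenspace_shiftedInverse hK] at hu
  have h1 : inner ℂ u u = ((x + c : ℝ) : ℂ) * inner ℂ u (K u) := by
    nth_rewrite 2 [hu]
    rw [inner_smul_right]; push_cast; rfl
  have h2 : ‖u‖ ^ 2 = (x + c) * (inner ℂ u (K u)).re := by
    have := congrArg Complex.re h1
    rw [Complex.re_ofReal_mul] at this
    rw [← this, inner_self_eq_norm_sq_to_K]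
    norm_cast
  have h3 : 0 < ‖u‖ ^ 2 := by positivity
  rw [h2] at h3
  exact pos_of_mul_pos_left h3 (hp u)

include hK hs in
lemma eigenvalue_real {z : ℂ} (h : opEigenspace (shiftedInverse K c) z ≠ ⊥) : ∃ x : ℝ, z = x := by
  obtain ⟨u, hu, h0⟩ := Submodule.exists_mem_ne_zero_of_ne_bot h
  rw [mem_opEigenspace_shiftedInverse hK] at hu
  have hsym : ∀ x y : H, inner ℂ (K x) y = inner ℂ x (K y) := fun x y => hs x y
  have hw : z + c ≠ 0 := by
    rintro hw
    rw [hw, zero_smul] at hu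
    exact h0 hu
  have e : K u = (z + c)⁻¹ • u := by
    nth_rewrite 2 [hu]
    rw [inv_smul_smul₀ hw]
  have h1 := hsym u u
  rw [e, inner_smul_left, inner_smul_right] at h1
  have h2 := mul_right_cancel₀ (inner_self_ne_zero.2 h0) h1
  rw [map_inv₀, inv_inj, Complex.conj_eq_iff_real] at h2
  obtain ⟨r, hr⟩ := h2
  exact ⟨r - c, by push_cast; rw [← hr]; ring⟩

include hK hc hs hp in
-- Infinitely many eigenvalues `x n ≤ R` would give orthonormal eigenvectors `e n` with orthogonal
-- images of norm `(x n + c)⁻¹ ≥ (R + c)⁻¹`. These images stay uniformly apart, so no subsequence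
-- converges, contrary to compactness.
lemma finite_eigenvalues_le (R : ℝ) :
    ({x : ℝ | opEigenspace (shiftedInverse K c) (x : ℂ) ≠ ⊥} ∩ Iic R).Finite := by
  by_contra hinf
  have hinf : Set.Infinite _ := hinf
  let x : ℕ → ℝ := fun n => hinf.natEmbedding _ n
  have hx : Function.Injective x :=
    Subtype.val_injective.comp (hinf.natEmbedding _).injective
  have hxm : ∀ n, opEigenspace (shiftedInverse K c) (x n : ℂ) ≠ ⊥ ∧ x n ≤ R := fun n =>
    (hinf.natEmbedding _ n).2
  have hev : ∀ n, ∃ u : H, u ∈ opEigenspace (shiftedInverse K c) (x n : ℂ) ∧ ‖u‖ = 1 := by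
    intro n
    obtain ⟨u, hu, h0⟩ := Submodule.exists_mem_ne_zero_of_ne_bot (hxm n).1
    refine ⟨((‖u‖⁻¹ : ℝ) : ℂ) • u, Submodule.smul_mem _ _ hu, ?_⟩
    rw [norm_smul]
    simp [h0]
  choose e he he1 using hev
  have he0 : ∀ n, e n ≠ 0 := fun n h => by simpa [h] using he1 n
  have hpos : ∀ n, 0 < x n + c := fun n => add_pos_of_mem_opEigenspace hK hp (he n) (he0 n)
  have hRc : 0 < R + c := (hpos 0).trans_le (by linarith [(hxm 0).2])
  have hKe : ∀ n, K (e n) = (((x n + c)⁻¹ : ℝ) : ℂ) • e n := by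
    intro n
    have h1 := (mem_opEigenspace_shiftedInverse hK).1 (he n)
    have h2 : ((x n : ℂ) + c) ≠ 0 := by exact_mod_cast (hpos n).ne'
    nth_rewrite 2 [h1]
    push_cast
    rw [inv_smul_smul₀ h2]
  have hsym : ∀ x y : H, inner ℂ (K x) y = inner ℂ x (K y) := fun x y => hs x y
  have horth : ∀ n m, n ≠ m → inner ℂ (e n) (e m) = 0 := by
    intro n m hnm
    have h1 := hsym (e n) (e m)
    rw [hKe, hKe, inner_smul_left, inner_smul_right, Complex.conj_ofReal] at h1
    by_contra h
    have h2 := mul_right_cancel₀ h h1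
    have h3 : (x n + c)⁻¹ = (x m + c)⁻¹ := by exact_mod_cast h2
    rw [inv_inj] at h3
    exact hnm (hx (by linarith))
  have hsep : ∀ n m, n ≠ m → (R + c)⁻¹ ≤ ‖K (e n) - K (e m)‖ := by
    intro n m hnm
    have h1 : inner ℂ (K (e n)) (K (e m)) = 0 := by
      rw [hKe, hKe, inner_smul_left, inner_smul_right, horth n m hnm]; simp
    have h2 : ‖K (e n) - K (e m)‖ * ‖K (e n) - K (e m)‖
        = ‖K (e n)‖ * ‖K (e n)‖ + ‖K (e m)‖ * ‖K (e m)‖ := by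
      have := norm_add_sq_eq_norm_sq_add_norm_sq_of_inner_eq_zero (𝕜 := ℂ) (K (e n)) (-K (e m))
        (by rw [inner_neg_right, h1, neg_zero])
      rwa [← sub_eq_add_neg, norm_neg] at this
    have h3 : (R + c)⁻¹ ≤ ‖K (e n)‖ := by
      rw [hKe, norm_smul, he1, mul_one, Complex.norm_real, Real.norm_eq_abs,
        abs_of_pos (inv_pos.2 (hpos n))]
      exact inv_anti₀ (hpos n) (by linarith [(hxm n).2])
    nlinarith [norm_nonneg (K (e n)), norm_nonneg (K (e m)), norm_nonneg (K (e n) - K (e m)),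
      inv_pos.2 hRc]
  obtain ⟨C, hC, hC'⟩ := hc.image_closedBall_subset_compact (f := (K : H →ₗ[ℂ] H)) 1
  obtain ⟨y, -, ψ, hψ, hψy⟩ := hC.tendsto_subseq (x := fun n => K (e n))
    (fun n => hC' ⟨e n, by simp [he1], rfl⟩)
  obtain ⟨n0, hn0⟩ := Metric.cauchySeq_iff'.1 hψy.cauchySeq (R + c)⁻¹ (inv_pos.2 hRc)
  have h1 := hn0 (n0 + 1) (by simp)
  rw [dist_eq_norm_sub] at h1
  exact absurd h1 (not_lt.2 (hsep _ _ (by simp [hψ.injective.eq_iff])))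

include hK hc hs in
-- The eigenspaces of a compact symmetric `K` have a dense sum, and those for nonzero eigenvalues
-- are finite-dimensional. Finitely many of them would span a finite-dimensional, hence closed and
-- dense, subspace, so `H` itself would be finite-dimensional.
lemma infinite_eigenvalues [CompleteSpace H] (hinf : ¬ FiniteDimensional ℂ H) :
    {x : ℝ | opEigenspace (shiftedInverse K c) (x : ℂ) ≠ ⊥}.Infinite := by
  intro hfin
  apply hinf
  set Λ := {x : ℝ | opEigenspace (shiftedInverse K c) (x : ℂ) ≠ ⊥} with hΛ
  -- Every nonzero eigenspace of `K` is among the finitely many listed: an eigenvalue `μ` of `K` is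
  -- nonzero by injectivity and corresponds to `x = μ⁻¹ - c`.
  have hle : (⨆ μ, Module.End.eigenspace (K : H →ₗ[ℂ] H) μ) ≤
      ⨆ x ∈ hfin.toFinset, Module.End.eigenspace (K : H →ₗ[ℂ] H) (((x : ℂ) + c)⁻¹) := by
    refine iSup_le fun μ => ?_
    by_cases hμ : Module.End.eigenspace (K : H →ₗ[ℂ] H) μ = ⊥
    · rw [hμ]; exact bot_le
    obtain ⟨u, hu, hu0⟩ := Submodule.exists_mem_ne_zero_of_ne_bot hμ
    have hu : K u = μ • u := Module.End.mem_eigenspace_iff.1 hu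
    have hμ0 : μ ≠ 0 := by
      rintro rfl
      exact hu0 (hK (by simpa using hu))
    have hmem : u ∈ opEigenspace (shiftedInverse K c) (μ⁻¹ - c) := by
      rw [mem_opEigenspace_shiftedInverse hK, sub_add_cancel, hu, inv_smul_smul₀ hμ0]
    have hne : opEigenspace (shiftedInverse K c) (μ⁻¹ - c) ≠ ⊥ := fun h => by
      rw [h] at hmem; exact hu0 (by simpa using hmem)
    obtain ⟨x, hx⟩ := eigenvalue_real hK hs hne
    have hxΛ : x ∈ hfin.toFinset := by
      simp only [Finite.mem_toFinset, hΛ, mem_ofPred_eq]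
      rwa [← hx]
    refine le_trans (le_of_eq ?_) (le_iSup₂ (f := fun (x : ℝ) (_ : x ∈ hfin.toFinset) =>
      Module.End.eigenspace (K : H →ₗ[ℂ] H) (((x : ℂ) + c)⁻¹)) x hxΛ)
    rw [← hx, sub_add_cancel, inv_inv]
  have hfd : ∀ x ∈ hfin.toFinset,
      FiniteDimensional ℂ (Module.End.eigenspace (K : H →ₗ[ℂ] H) (((x : ℂ) + c)⁻¹)) := by
    intro x hx
    refine ContinuousLinearMap.finite_dimensional_eigenspace hc _ ?_
    intro h0
    simp only [Finite.mem_toFinset, hΛ, mem_ofPred_eq] at hx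
    obtain ⟨u, hu, h1⟩ := Submodule.exists_mem_ne_zero_of_ne_bot hx
    rw [mem_opEigenspace_shiftedInverse hK, inv_eq_zero.1 h0, zero_smul] at hu
    exact h1 hu
  set F := ⨆ x ∈ hfin.toFinset, Module.End.eigenspace (K : H →ₗ[ℂ] H) (((x : ℂ) + c)⁻¹) with hF
  have hFfd : FiniteDimensional ℂ F := by
    rw [hF, iSup_subtype']
    have := fun x : {x // x ∈ hfin.toFinset} => hfd x x.2
    exact Submodule.finiteDimensional_iSup _
  have hperp : Fᗮ = ⊥ := by
    rw [eq_bot_iff, ← ContinuousLinearMap.orthogonalComplement_iSup_eigenspaces_eq_bot hc hs]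
    exact Submodule.orthogonal_le hle
  have htop : F = ⊤ := (Submodule.orthogonal_eq_bot_iff).1 hperp
  rw [htop] at hFfd
  exact Module.Finite.equiv (Submodule.topEquiv (R := ℂ) (M := H))

include hK hc hs hp in
theorem exists_simpleSpectrum [CompleteSpace H] (hinf : ¬ FiniteDimensional ℂ H)
    (hsimple : ∀ (x : ℝ) (u v : H), u ∈ opEigenspace (shiftedInverse K c) (x : ℂ) →
      v ∈ opEigenspace (shiftedInverse K c) (x : ℂ) → u ≠ 0 → ∃ k : ℂ, k • u = v) :
    ∃ lam : ℕ → ℝ, StrictMono lam ∧ Tendsto lam atTop atTop ∧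
      HasSimpleSpectrum (shiftedInverse K c) lam := by
  obtain ⟨lam, h1, h2, h3⟩ := exists_strictMono_enumeration (infinite_eigenvalues (c := c) hK hc hs hinf)
    (finite_eigenvalues_le hK hc hs hp)
  refine ⟨lam, h1, h2, ?_, fun n => ?_⟩
  · ext z
    rw [mem_opSpectrum_shiftedInverse_iff hK hc]
    constructor
    · intro h
      obtain ⟨x, rfl⟩ := eigenvalue_real hK hs h
      have : x ∈ range lam := h3 ▸ h
      obtain ⟨n, rfl⟩ := this
      exact ⟨n, rfl⟩
    · rintro ⟨n, rfl⟩
      have : lam n ∈ {x : ℝ | opEigenspace (shiftedInverse K c) (x : ℂ) ≠ ⊥} := h3 ▸ ⟨n, rfl⟩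
      exact this
  · have : lam n ∈ {x : ℝ | opEigenspace (shiftedInverse K c) (x : ℂ) ≠ ⊥} := h3 ▸ ⟨n, rfl⟩
    obtain ⟨u, hu, h0⟩ := Submodule.exists_mem_ne_zero_of_ne_bot this
    refine finrank_eq_one ⟨u, hu⟩ (by simpa using h0) fun w => ?_
    obtain ⟨k, hk⟩ := hsimple _ u w hu w.2 h0
    exact ⟨k, Subtype.ext hk⟩

end SpectralTheorem

end AbstractOperators

/-! ### The Friedrichs extension from a factorization of the form -/

section Friedrichs

variable {H G : Type*} [NormedAddCommGroup H] [InnerProductSpace ℂ H] [CompleteSpace H]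
  [NormedAddCommGroup G] [InnerProductSpace ℂ G] [CompleteSpace G]

/-- The closure of the range of `B`, as a Hilbert space: the domain of the closed form. -/
abbrev formSpace {D : Submodule ℂ H} (B : D →ₗ[ℂ] G) : Submodule ℂ G :=
  (LinearMap.range B).topologicalClosure

instance {D : Submodule ℂ H} (B : D →ₗ[ℂ] G) : CompleteSpace (formSpace B) :=
  (LinearMap.range B).isClosed_topologicalClosure.completeSpace_coe

/-- The restriction of `J` to the form space. -/
def formEmbedding {D : Submodule ℂ H} (B : D →ₗ[ℂ] G) (J : G →L[ℂ] H) : formSpace B →L[ℂ] H :=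
  J.comp (formSpace B).subtypeL

/-- The operator `J J*` with `J` restricted to the form space. -/
noncomputable def formResolvent {D : Submodule ℂ H} (B : D →ₗ[ℂ] G) (J : G →L[ℂ] H) : H →L[ℂ] H :=
  (formEmbedding B J).comp (ContinuousLinearMap.adjoint (formEmbedding B J))

variable {A₀ : H →ₗ.[ℂ] H} {B : A₀.domain →ₗ[ℂ] G} {J : G →L[ℂ] H}

lemma isCompactOperator_formResolvent (hJ : IsCompactOperator J) :
    IsCompactOperator (formResolvent B J) :=
  (hJ.comp_clm (formSpace B).subtypeL).comp_clm (ContinuousLinearMap.adjoint (formEmbedding B J))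

lemma isSymmetric_formResolvent : (formResolvent B J).IsSymmetric := by
  intro x y
  change inner ℂ (formEmbedding B J _) y = inner ℂ x (formEmbedding B J _)
  exact (ContinuousLinearMap.adjoint_inner_right _ _ _).symm.trans
    (ContinuousLinearMap.adjoint_inner_left _ _ _)

lemma formResolvent_nonneg (f : H) : 0 ≤ (inner ℂ f (formResolvent B J f)).re := by
  change 0 ≤ (inner ℂ f (formEmbedding B J _)).re
  rw [← ContinuousLinearMap.adjoint_inner_left]
  exact inner_self_nonneg (𝕜 := ℂ)

omit [CompleteSpace H] [CompleteSpace G] in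
-- A closed condition on the form space need only be checked on the range of `B`, which is dense in
-- it.
lemma formSpace_induction {p : formSpace B → Prop}
    (hp : IsClosed {v | p v}) (h : ∀ φ, p ⟨B φ, Submodule.le_topologicalClosure _ ⟨φ, rfl⟩⟩) :
    ∀ v, p v := by
  rintro ⟨v, hv⟩
  obtain ⟨s, hs, hsv⟩ := mem_closure_iff_seq_limit.1
    (show v ∈ closure (LinearMap.range B : Set G) from hv)
  choose φ hφ using hs
  have hφ : ∀ n, B (φ n) = s n := hφ
  have ht : Tendsto (fun n => (⟨B (φ n), Submodule.le_topologicalClosure _ ⟨φ n, rfl⟩⟩ : formSpace B))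
      atTop (𝓝 ⟨v, hv⟩) := by
    rw [tendsto_subtype_rng]
    simpa only [hφ] using hsv
  exact hp.mem_of_tendsto ht (Eventually.of_forall fun n => h (φ n))

variable (hd : Dense (A₀.domain : Set H)) (hJB : ∀ φ : A₀.domain, J (B φ) = φ) {c : ℝ}
  (hB : ∀ φ ψ : A₀.domain, inner ℂ (B φ) (B ψ) = inner ℂ (φ : H) (A₀ ψ + (c : ℂ) • (ψ : H)))

omit [CompleteSpace H] [CompleteSpace G] in
include hJB hB in
-- The hypothesis `hB`, extended by continuity in its first argument from the range of `B` to its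
-- closure. It is what turns weak equations on the form space into equations for the adjoint of
-- `A₀`.
lemma inner_formEmbedding (v : formSpace B) (ψ : A₀.domain) :
    inner ℂ (formEmbedding B J v) (A₀ ψ + (c : ℂ) • (ψ : H)) = inner ℂ (v : G) (B ψ) := by
  revert v
  apply formSpace_induction
  · exact isClosed_eq (by fun_prop) (by fun_prop)
  · intro φ
    change inner ℂ (J (B φ)) _ = _
    rw [hJB, hB]

omit [CompleteSpace H] [CompleteSpace G] in
lemma formSpace_eq_zero {v : formSpace B} (h : ∀ ψ, inner ℂ (v : G) (B ψ) = 0) : v = 0 := by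
  have : ∀ w : formSpace B, inner ℂ (v : G) (w : G) = 0 := by
    apply formSpace_induction
    · exact isClosed_eq (by fun_prop) (by fun_prop)
    · exact h
  have := this v
  exact Subtype.ext (inner_self_eq_zero.1 this)

omit [CompleteSpace H] [CompleteSpace G] in
include hJB hB in
-- This is closability of the form: a `v` sent to zero is orthogonal to every `B ψ` by
-- `inner_formEmbedding`, hence to the form space itself.
lemma formEmbedding_injective : Function.Injective (formEmbedding B J) := by
  rw [injective_iff_map_eq_zero]
  intro v hv
  apply formSpace_eq_zero
  intro ψ
  rw [← inner_formEmbedding hJB hB, hv, inner_zero_left]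

include hd hJB in
-- The range of the embedding contains the dense domain of `A₀`, and a vector killed by the adjoint
-- is orthogonal to that range.
lemma formEmbedding_adjoint_injective :
    Function.Injective (ContinuousLinearMap.adjoint (formEmbedding B J)) := by
  rw [injective_iff_map_eq_zero]
  intro f hf
  refine hd.eq_zero_of_inner_left (𝕜 := ℂ) fun φ hφ => ?_
  have h1 : formEmbedding B J ⟨B ⟨φ, hφ⟩, Submodule.le_topologicalClosure _ ⟨_, rfl⟩⟩ = φ :=
    hJB ⟨φ, hφ⟩
  rw [← h1, ← ContinuousLinearMap.adjoint_inner_left, hf, inner_zero_left]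

include hd hJB hB in
lemma formResolvent_injective : Function.Injective (formResolvent B J) :=
  (formEmbedding_injective hJB hB).comp (formEmbedding_adjoint_injective hd hJB)

include hJB in
-- The adjoint solves the weak problem: it sends `f` to the Riesz representative of `w ↦ ⟪f, J w⟫`
-- on the form space, and vectors `B ψ` suffice for testing.
lemma adjoint_formEmbedding_eq_iff {v : formSpace B} {f : H} :
    v = ContinuousLinearMap.adjoint (formEmbedding B J) f ↔
      ∀ ψ : A₀.domain, inner ℂ (v : G) (B ψ) = inner ℂ f (ψ : H) := by
  have h1 : ∀ ψ : A₀.domain, inner ℂ ((ContinuousLinearMap.adjoint (formEmbedding B J) f :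
      formSpace B) : G) (B ψ) = inner ℂ f (ψ : H) := fun ψ => by
    have := ContinuousLinearMap.adjoint_inner_left (formEmbedding B J)
      ⟨B ψ, Submodule.le_topologicalClosure _ ⟨ψ, rfl⟩⟩ f
    refine this.trans ?_
    change inner ℂ f (J (B ψ)) = _
    rw [hJB]
  constructor
  · rintro rfl
    exact h1
  · intro h
    rw [← sub_eq_zero]
    apply formSpace_eq_zero
    intro ψ
    rw [Submodule.coe_sub, inner_sub_left, h, h1, sub_self]

include hd hJB hB in
lemma mem_graph_formResolvent_iff {u f : H} :
    (u, f) ∈ (shiftedInverse (formResolvent B J) c).graph ↔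
      ∃ v : formSpace B, formEmbedding B J v = u ∧
        ∀ ψ : A₀.domain, inner ℂ (v : G) (B ψ) = inner ℂ (f + (c : ℂ) • u) (ψ : H) := by
  rw [mem_graph_shiftedInverse (formResolvent_injective hd hJB hB)]
  constructor
  · intro h
    exact ⟨_, h.symm, (adjoint_formEmbedding_eq_iff hJB).1 rfl⟩
  · rintro ⟨v, rfl, h⟩
    rw [← adjoint_formEmbedding_eq_iff hJB] at h
    nth_rewrite 1 [h]
    rfl

omit [CompleteSpace H] [CompleteSpace G] in
include hB in
lemma inner_sub_form (x : A₀.domain) :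
    inner ℂ (x : H) (A₀ x) = ((‖B x‖ ^ 2 - c * ‖(x : H)‖ ^ 2 : ℝ) : ℂ) := by
  have := hB x x
  rw [inner_add_right, inner_smul_right, inner_self_eq_norm_sq_to_K, inner_self_eq_norm_sq_to_K]
    at this
  push_cast
  exact eq_sub_of_add_eq this.symm

lemma tendsto_norm_sub_prod {E : Type*} [NormedAddCommGroup E] {t : ℕ → E} {x : E}
    (ht : Tendsto t atTop (𝓝 x)) :
    Tendsto (fun p : ℕ × ℕ => ‖t p.1 - t p.2‖) atTop (𝓝 0) := by
  rw [← prod_atTop_atTop_eq]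
  have := ((ht.comp tendsto_fst).sub (ht.comp tendsto_snd) :
    Tendsto (fun p : ℕ × ℕ => t p.1 - t p.2) (atTop ×ˢ atTop) (𝓝 (x - x))).norm
  simpa using this

omit [CompleteSpace H] in
include hJB hB in
-- Since `‖B x‖² = ⟪x, A₀ x⟫ + c ‖x‖²`, a sequence convergent in `H` is Cauchy for the form exactly
-- when its image under `B` is Cauchy. The limit of the images in the complete space `G` is the
-- required `v`.
lemma inFormDomain_iff {u : H} :
    InFormDomain A₀ u ↔ ∃ v : formSpace B, formEmbedding B J v = u := by
  constructor
  · rintro ⟨s, hs, hs2⟩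
    have h0 : Tendsto (fun p : ℕ × ℕ => ‖((s p.1 - s p.2 : A₀.domain) : H)‖) atTop (𝓝 0) :=
      tendsto_norm_sub_prod hs
    have h1 : Tendsto (fun p : ℕ × ℕ => ‖B (s p.1 - s p.2)‖ ^ 2) atTop (𝓝 0) := by
      have h2 := (Complex.continuous_re.tendsto _).comp hs2
      have h3 := h2.add ((h0.pow 2).const_mul c)
      simp only [Complex.zero_re, ne_eq, OfNat.ofNat_ne_zero, not_false_eq_true, zero_pow,
        mul_zero, add_zero] at h3
      refine h3.congr fun p => ?_
      simp only [Function.comp_apply]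
      rw [inner_sub_form hB, Complex.ofReal_re]
      ring
    have h2 : CauchySeq fun n => B (s n) := by
      rw [cauchySeq_iff_tendsto, uniformity_eq_comap_nhds_zero, tendsto_comap_iff,
        tendsto_zero_iff_norm_tendsto_zero]
      have h3 := (Real.continuous_sqrt.tendsto _).comp h1
      simp only [Real.sqrt_zero] at h3
      refine h3.congr fun p => ?_
      simp only [Function.comp_apply]
      rw [Real.sqrt_sq (norm_nonneg _), map_sub, norm_sub_rev]
      rfl
    obtain ⟨g, hg⟩ := cauchySeq_tendsto_of_complete h2
    have hgm : g ∈ formSpace B :=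
      mem_closure_of_tendsto hg (Eventually.of_forall fun n => ⟨s n, rfl⟩)
    refine ⟨⟨g, hgm⟩, ?_⟩
    have h4 := (J.continuous.tendsto g).comp hg
    refine tendsto_nhds_unique h4 (hs.congr fun n => ?_)
    exact (hJB _).symm
  · rintro ⟨⟨v, hv⟩, rfl⟩
    obtain ⟨s, hs, hsv⟩ := mem_closure_iff_seq_limit.1
      (show v ∈ closure (LinearMap.range B : Set G) from hv)
    choose φ hφ using hs
    have hφ : ∀ n, B (φ n) = s n := hφ
    have hu : Tendsto (fun n => (φ n : H)) atTop (𝓝 (J v)) := by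
      refine ((J.continuous.tendsto v).comp hsv).congr fun n => ?_
      rw [Function.comp_apply, ← hφ, hJB]
    refine ⟨φ, hu, ?_⟩
    simp_rw [inner_sub_form hB, Submodule.coe_sub, map_sub, hφ]
    have h3 := ((tendsto_norm_sub_prod hsv).pow 2).sub
      (((tendsto_norm_sub_prod hu).pow 2).const_mul c)
    have h4 := (Complex.continuous_ofReal.tendsto _).comp h3
    simpa [Function.comp_def] using h4

include hd hJB hB in
-- By `inner_formEmbedding` the weak equation `⟪v, B ψ⟫ = ⟪f + c u, ψ⟫` reads `⟪u, A₀ ψ + c ψ⟫ = ⟪f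
-- + c u, ψ⟫`. Cancelling the real shift `c` leaves the adjoint condition, while `u = J v` is
-- membership in the form domain.
theorem isFriedrichsExtension_formResolvent :
    IsFriedrichsExtension A₀ (shiftedInverse (formResolvent B J) c) where
  dense_domain := hd
  symmetric := by
    intro x y
    have h1 := hB x y
    have h2 := hB y x
    rw [← inner_conj_symm, h2, inner_conj_symm, inner_add_left, inner_add_right, inner_smul_left,
      inner_smul_right, Complex.conj_ofReal] at h1
    exact add_right_cancel h1
  bounded_below := by
    refine ⟨-c, fun u => ?_⟩
    rw [inner_sub_form hB, Complex.ofReal_re]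
    nlinarith [sq_nonneg ‖B u‖]
  mem_graph_iff := by
    intro u f
    rw [mem_graph_formResolvent_iff hd hJB hB, inFormDomain_iff hJB hB]
    constructor
    · rintro ⟨v, rfl, h⟩
      refine ⟨⟨v, rfl⟩, fun ψ => ?_⟩
      have := h ψ
      rw [← inner_formEmbedding hJB hB, inner_add_left, inner_add_right, inner_smul_left,
        inner_smul_right, Complex.conj_ofReal] at this
      exact add_right_cancel this
    · rintro ⟨⟨v, rfl⟩, h⟩
      refine ⟨v, rfl, fun ψ => ?_⟩
      rw [← inner_formEmbedding hJB hB, inner_add_left, inner_add_right, inner_smul_left,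
        inner_smul_right, Complex.conj_ofReal, h]

omit [CompleteSpace H] in
lemma le_of_forall_mem_graph {A A' : H →ₗ.[ℂ] H}
    (h : ∀ x : A.domain, ((x : H), A x) ∈ A'.graph) : A ≤ A' := by
  refine LinearPMap.le_of_le_graph ?_
  rintro ⟨u, f⟩ huf
  obtain ⟨x, rfl, rfl⟩ := LinearPMap.mem_graph_iff _ |>.1 huf
  exact h x

include hd hJB hB in
theorem le_shiftedInverse_formResolvent : A₀ ≤ shiftedInverse (formResolvent B J) c := by
  have hF := isFriedrichsExtension_formResolvent hd hJB hB
  refine le_of_forall_mem_graph fun x => (hF.mem_graph_iff _ _).2 ⟨?_, fun v => ?_⟩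
  · rw [inFormDomain_iff hJB hB]
    exact ⟨⟨B x, Submodule.le_topologicalClosure _ ⟨x, rfl⟩⟩, hJB x⟩
  · exact (hF.symmetric x v).symm

end Friedrichs

/-! ### Transport of the spectrum by a unitary map -/

section UnitaryEquivalence

variable {H H' : Type*} [NormedAddCommGroup H] [InnerProductSpace ℂ H]
  [NormedAddCommGroup H'] [InnerProductSpace ℂ H']

/-- The operator `U⁻¹ K U`. -/
noncomputable def conjOperator (U : H' ≃ₗᵢ[ℂ] H) (K : H →L[ℂ] H) : H' →L[ℂ] H' :=
  (U.symm.toContinuousLinearEquiv : H →L[ℂ] H').comp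
    (K.comp (U.toContinuousLinearEquiv : H' →L[ℂ] H))

lemma conjOperator_apply (U : H' ≃ₗᵢ[ℂ] H) (K : H →L[ℂ] H) (x : H') :
    conjOperator U K x = U.symm (K (U x)) := rfl

lemma conjOperator_injective (U : H' ≃ₗᵢ[ℂ] H) {K : H →L[ℂ] H} (hK : Function.Injective K) :
    Function.Injective (conjOperator U K) :=
  U.symm.injective.comp (hK.comp U.injective)

lemma conjOperator_isSymmetric (U : H' ≃ₗᵢ[ℂ] H) {K : H →L[ℂ] H} (hK : K.IsSymmetric) :
    (conjOperator U K).IsSymmetric := by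
  intro x y
  change inner ℂ (U.symm (K (U x))) y = inner ℂ x (U.symm (K (U y)))
  rw [← U.inner_map_map, ← U.inner_map_map x, U.apply_symm_apply, U.apply_symm_apply]
  exact hK (U x) (U y)

lemma mem_graph_shiftedInverse_conj (U : H' ≃ₗᵢ[ℂ] H) {K : H →L[ℂ] H}
    (hK : Function.Injective K) {c : ℝ} {u f : H'} :
    (u, f) ∈ (shiftedInverse (conjOperator U K) c).graph ↔
      (U u, U f) ∈ (shiftedInverse K c).graph := by
  rw [mem_graph_shiftedInverse hK, mem_graph_shiftedInverse (conjOperator_injective U hK),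
    conjOperator_apply, map_add, map_smul, ← U.injective.eq_iff, U.apply_symm_apply]

/-- Resolvents and eigenspaces are both determined by the graph: resolvents are conjugated by `U`,
and `U` maps eigenspaces isomorphically onto eigenspaces. -/
theorem HasSimpleSpectrum.of_unitary {A : H →ₗ.[ℂ] H} {A' : H' →ₗ.[ℂ] H'} (U : H' ≃ₗᵢ[ℂ] H)
    (h : ∀ u f, (u, f) ∈ A'.graph ↔ (U u, U f) ∈ A.graph) {lam : ℕ → ℝ}
    (hA : HasSimpleSpectrum A lam) : HasSimpleSpectrum A' lam := by
  refine ⟨?_, fun n => ?_⟩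
  · rw [← hA.1]
    ext z
    rw [← not_iff_not, notMem_opSpectrum_iff, notMem_opSpectrum_iff]
    constructor
    · rintro ⟨R, h1, h2⟩
      refine ⟨conjOperator U.symm R, fun f => ?_, fun u f huf => ?_⟩
      · have := (h _ _).1 (h1 (U.symm f))
        rw [map_add, map_smul, U.apply_symm_apply] at this
        exact this
      · have := h2 (U.symm u) (U.symm f) ((h _ _).2 (by simpa using huf))
        rw [conjOperator_apply, map_sub, map_smul, this]
        simp
    · rintro ⟨R, h1, h2⟩
      refine ⟨conjOperator U R, fun f => ?_, fun u f huf => ?_⟩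
      · rw [h, map_add, map_smul, conjOperator_apply, U.apply_symm_apply]
        exact h1 _
      · have := h2 _ _ ((h _ _).1 huf)
        rw [conjOperator_apply, map_sub, map_smul, this]
        simp
  · rw [← hA.2 n]
    refine LinearEquiv.finrank_eq (LinearEquiv.ofSubmodules U.toLinearEquiv _ _ ?_)
    ext u
    constructor
    · rintro ⟨v, hv, rfl⟩
      have := (h _ _).1 (mem_opEigenspace.1 hv)
      rw [map_smul] at this
      exact this
    · intro hu
      refine ⟨U.symm u, ?_, by simp⟩
      refine mem_opEigenspace.2 ((h _ _).2 ?_)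
      rw [map_smul, U.apply_symm_apply]
      exact hu

end UnitaryEquivalence

/-! ### Density of test functions in `L²` -/

section Density

variable {Ω : TopologicalSpace.Opens ℝ} {μ : Measure ℝ}

lemma AdmissibleMeasure.locallyIntegrableOn (hμ : AdmissibleMeasure Ω μ) {f : ℝ → ℂ}
    (hf : MemLp f 2 μ) : LocallyIntegrableOn f Ω μ := by
  rw [locallyIntegrableOn_iff Ω.isOpen.isLocallyClosed]
  intro K hKΩ hK
  have : IsFiniteMeasure (μ.restrict K) := ⟨by simpa using hμ.finite K hK hKΩ⟩
  exact (hf.restrict K).integrable one_le_two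

/-- A real-valued test function as a complex-valued one. -/
noncomputable def realTest (g : ℝ → ℝ) (h1 : ContDiff ℝ (⊤ : ℕ∞) g) (h2 : HasCompactSupport g)
    (h3 : tsupport g ⊆ Ω) : 𝓓(Ω, ℂ) where
  toFun x := (g x : ℂ)
  contDiff' := Complex.ofRealCLM.contDiff.comp h1
  hasCompactSupport' := h2.comp_left (g := fun x : ℝ => (x : ℂ)) Complex.ofReal_zero
  tsupport_subset' := (tsupport_comp_subset (g := fun x : ℝ => (x : ℂ))
    Complex.ofReal_zero g).trans h3

lemma realTest_apply (g : ℝ → ℝ) (h1 : ContDiff ℝ (⊤ : ℕ∞) g) (h2 : HasCompactSupport g)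
    (h3 : tsupport g ⊆ Ω) (x : ℝ) : realTest g h1 h2 h3 x = (g x : ℂ) := rfl

/-- An `f` orthogonal to all real-valued test functions vanishes almost everywhere in `Ω` by the
fundamental lemma of the calculus of variations. The complement of `Ω` is null by `h0`. -/
theorem denseRange_testToL2 (hμ : AdmissibleMeasure Ω μ) (h0 : μ (Ω : Set ℝ)ᶜ = 0) :
    DenseRange (testToL2 hμ) := by
  have h : (LinearMap.range (testToL2 hμ)).topologicalClosure = ⊤ := by
    rw [Submodule.topologicalClosure_eq_top_iff, Submodule.eq_bot_iff]
    intro f hf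
    rw [Submodule.mem_orthogonal] at hf
    have h1 := Ω.isOpen.ae_eq_zero_of_integral_contDiff_smul_eq_zero
      (hμ.locallyIntegrableOn (Lp.memLp f)) (fun g g1 g2 g3 => by
        have := hf _ ⟨realTest g g1 g2 g3, rfl⟩
        rw [L2.inner_def] at this
        rw [← this]
        refine integral_congr_ae ?_
        filter_upwards [(memLp_testFunction hμ (realTest g g1 g2 g3)).coeFn_toLp] with x hx
        change _ = inner ℂ (MemLp.toLp _ (memLp_testFunction hμ (realTest g g1 g2 g3)) x) (f x)
        rw [hx, realTest_apply, RCLike.inner_apply, Complex.conj_ofReal, Complex.real_smul,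
          mul_comm])
    have h2 : ∀ᵐ x ∂μ, x ∈ (Ω : Set ℝ) := by
      rw [ae_iff]; exact h0
    rw [Lp.eq_zero_iff_ae_eq_zero]
    filter_upwards [h1, h2] with x hx hx' using hx hx'
  exact (Submodule.dense_iff_topologicalClosure_eq_top).2 h

lemma diffOp_apply (hμ : AdmissibleMeasure Ω μ) {p₂ p₁ p₀ : ℝ → ℝ}
    (h₂ : ContinuousOn p₂ Ω) (h₁ : ContinuousOn p₁ Ω) (h₀ : ContinuousOn p₀ Ω) (φ : 𝓓(Ω, ℂ)) :
    diffOp hμ h₂ h₁ h₀ ⟨testToL2 hμ φ, ⟨φ, rfl⟩⟩ = diffToL2 hμ h₂ h₁ h₀ φ := by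
  change diffToL2 hμ h₂ h₁ h₀ ((LinearEquiv.ofInjective (testToL2 hμ)
    (testToL2_injective hμ)).symm ⟨testToL2 hμ φ, ⟨φ, rfl⟩⟩) = _
  congr 1
  rw [LinearEquiv.symm_apply_eq]
  rfl

lemma coeFn_testToL2 (hμ : AdmissibleMeasure Ω μ) (φ : 𝓓(Ω, ℂ)) : testToL2 hμ φ =ᵐ[μ] φ :=
  (memLp_testFunction hμ φ).coeFn_toLp

lemma coeFn_diffToL2 (hμ : AdmissibleMeasure Ω μ) {p₂ p₁ p₀ : ℝ → ℝ}
    (h₂ : ContinuousOn p₂ Ω) (h₁ : ContinuousOn p₁ Ω) (h₀ : ContinuousOn p₀ Ω) (φ : 𝓓(Ω, ℂ)) :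
    diffToL2 hμ h₂ h₁ h₀ φ =ᵐ[μ] diffExpr p₂ p₁ p₀ φ :=
  (memLp_diffExpr hμ h₂ h₁ h₀ φ).coeFn_toLp

end Density

/-! ### Integration as a compact operator on `L²(-π/2, π/2)` -/

section Primitive

instance : IsFiniteMeasure angleMeasure := by
  unfold angleMeasure
  infer_instance

lemma angleMeasure_compl : angleMeasure (angleInt : Set ℝ)ᶜ = 0 := by
  rw [angleMeasure, Measure.restrict_apply angleInt.isOpen.measurableSet.compl]
  change volume ((Ioo (-(Real.pi / 2)) (Real.pi / 2))ᶜ ∩ Ioo (-(Real.pi / 2)) (Real.pi / 2)) = 0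
  simp

lemma ae_angleMeasure_mem : ∀ᵐ x ∂angleMeasure, x ∈ Ioo (-(Real.pi / 2)) (Real.pi / 2) :=
  ae_restrict_mem measurableSet_Ioo

lemma integrable_angleMeasure (f : Lp ℂ 2 angleMeasure) : Integrable f angleMeasure :=
  (Lp.memLp f).integrable one_le_two

/-- The primitive of `f` that vanishes at `-π/2`. -/
noncomputable def primitive (f : Lp ℂ 2 angleMeasure) (x : ℝ) : ℂ := ∫ t in Iic x, f t ∂angleMeasure

/-- Cauchy–Schwarz against the indicator of `s`. -/
lemma norm_setIntegral_le (f : Lp ℂ 2 angleMeasure) {s : Set ℝ} (hs : MeasurableSet s) :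
    ‖∫ t in s, f t ∂angleMeasure‖ ≤ √(angleMeasure.real s) * ‖f‖ := by
  rw [← L2.inner_indicatorConstLp_one (𝕜 := ℂ) hs (measure_ne_top _ _)]
  refine (norm_inner_le_norm _ _).trans ?_
  gcongr
  refine norm_indicatorConstLp_le.trans ?_
  rw [norm_one, one_mul, Real.sqrt_eq_rpow]
  norm_num

lemma primitive_sub (f : Lp ℂ 2 angleMeasure) {x y : ℝ} (h : x ≤ y) :
    primitive f y - primitive f x = ∫ t in Ioc x y, f t ∂angleMeasure := by
  have hi := integrable_angleMeasure f
  rw [primitive, primitive, ← Iic_union_Ioc_eq_Iic h,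
    setIntegral_union (Iic_disjoint_Ioc le_rfl) measurableSet_Ioc hi.integrableOn hi.integrableOn,
    add_sub_cancel_left]

lemma angleMeasure_real_Ioc_le {x y : ℝ} (h : x ≤ y) : angleMeasure.real (Ioc x y) ≤ y - x := by
  rw [Measure.real, angleMeasure]
  refine ENNReal.toReal_le_of_le_ofReal (sub_nonneg.2 h) ?_
  refine (Measure.restrict_apply_le _ _).trans ?_
  rw [Real.volume_Ioc]

/-- This Hölder-1/2 bound is uniform for bounded `‖f‖`. It gives the equicontinuity needed for
compactness, and also the square-root decay at `-π/2` used in the Wronskian argument. -/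
lemma norm_primitive_sub_le (f : Lp ℂ 2 angleMeasure) {x y : ℝ} :
    ‖primitive f y - primitive f x‖ ≤ √|y - x| * ‖f‖ := by
  wlog h : x ≤ y generalizing x y
  · rw [norm_sub_rev, abs_sub_comm]
    exact this (not_le.1 h).le
  rw [primitive_sub f h, abs_of_nonneg (sub_nonneg.2 h)]
  refine (norm_setIntegral_le f measurableSet_Ioc).trans ?_
  gcongr
  exact angleMeasure_real_Ioc_le h

lemma primitive_left (f : Lp ℂ 2 angleMeasure) : primitive f (-(Real.pi / 2)) = 0 := by
  have : angleMeasure (Iic (-(Real.pi / 2))) = 0 := by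
    rw [angleMeasure, Measure.restrict_apply measurableSet_Iic]
    convert! measure_empty (μ := (volume : Measure ℝ))
    ext x
    simp only [mem_inter_iff, mem_Iic, mem_Ioo, mem_empty_iff_false, iff_false]
    intro h
    linarith [h.1, h.2.1]
  rw [primitive, Measure.restrict_eq_zero.2 this, integral_zero_measure]

lemma norm_primitive_le (f : Lp ℂ 2 angleMeasure) {x : ℝ} (hx : -(Real.pi / 2) ≤ x) :
    ‖primitive f x‖ ≤ √(x + Real.pi / 2) * ‖f‖ := by
  have := norm_primitive_sub_le f (x := -(Real.pi / 2)) (y := x)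
  rwa [primitive_left, sub_zero, sub_neg_eq_add, abs_of_nonneg (by linarith)] at this

lemma continuous_primitive (f : Lp ℂ 2 angleMeasure) : Continuous (primitive f) := by
  rw [continuous_iff_continuousAt]
  intro x
  rw [ContinuousAt, tendsto_iff_norm_sub_tendsto_zero]
  have h : Tendsto (fun y => √|y - x| * ‖f‖) (𝓝 x) (𝓝 0) := by
    have : Continuous fun y => √|y - x| * ‖f‖ := by fun_prop
    simpa using this.tendsto x
  exact squeeze_zero (fun _ => norm_nonneg _) (fun y => norm_primitive_sub_le f) h

lemma primitive_add (f g : Lp ℂ 2 angleMeasure) (x : ℝ) :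
    primitive (f + g) x = primitive f x + primitive g x := by
  rw [primitive, primitive, primitive, ← integral_add (integrable_angleMeasure f).restrict
    (integrable_angleMeasure g).restrict]
  exact integral_congr_ae (ae_restrict_of_ae (Lp.coeFn_add f g))

lemma primitive_smul (k : ℂ) (f : Lp ℂ 2 angleMeasure) (x : ℝ) :
    primitive (k • f) x = k * primitive f x := by
  rw [primitive, primitive, ← smul_eq_mul, ← integral_smul]
  exact integral_congr_ae (ae_restrict_of_ae (Lp.coeFn_smul k f))

/-- The primitive as a bounded continuous function on the closed interval. -/
noncomputable def primitiveBCF : Lp ℂ 2 angleMeasure →L[ℂ]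
    BoundedContinuousFunction (Icc (-(Real.pi / 2)) (Real.pi / 2)) ℂ :=
  LinearMap.mkContinuous
    { toFun := fun f => BoundedContinuousFunction.mkOfCompact
        ⟨fun x => primitive f x, (continuous_primitive f).comp continuous_subtype_val⟩
      map_add' := fun f g => by ext x; exact primitive_add f g x
      map_smul' := fun k f => by ext x; exact primitive_smul k f x } (√Real.pi) (by
    intro f
    rw [BoundedContinuousFunction.norm_le (by positivity)]
    intro x
    refine (norm_primitive_le f x.2.1).trans ?_
    gcongr
    linarith [x.2.2])

lemma primitiveBCF_apply (f : Lp ℂ 2 angleMeasure) (x : Icc (-(Real.pi / 2)) (Real.pi / 2)) :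
    primitiveBCF f x = primitive f x := rfl

/-- Arzelà–Ascoli: primitives of the unit ball are bounded by `√π` and share the modulus of
continuity `√`. -/
lemma isCompactOperator_primitiveBCF : IsCompactOperator primitiveBCF := by
  refine (isCompactOperator_iff_isCompact_closure_image_closedBall
    primitiveBCF.toLinearMap one_pos).2 ?_
  refine BoundedContinuousFunction.arzela_ascoli (Metric.closedBall 0 √Real.pi)
    (isCompact_closedBall _ _) _ ?_ ?_
  · rintro _ x ⟨f, hf, rfl⟩
    have hf : ‖f‖ ≤ 1 := by simpa using hf
    simp only [ContinuousLinearMap.coe_coe, primitiveBCF_apply, mem_closedBall_zero_iff]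
    refine (norm_primitive_le f x.2.1).trans ?_
    calc √((x : ℝ) + Real.pi / 2) * ‖f‖ ≤ √Real.pi * 1 := by
          gcongr
          linarith [x.2.2]
      _ = _ := mul_one _
  · refine Metric.equicontinuous_of_continuity_modulus (fun s => √s) ?_ _ ?_
    · simpa using Real.continuous_sqrt.tendsto 0
    · rintro x y ⟨_, f, hf, rfl⟩
      have hf : ‖f‖ ≤ 1 := by simpa using hf
      simp only [ContinuousLinearMap.coe_coe, primitiveBCF_apply]
      rw [dist_eq_norm, Subtype.dist_eq, Real.dist_eq]
      refine (norm_primitive_sub_le f).trans ?_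
      exact mul_le_of_le_one_right (Real.sqrt_nonneg _) hf

lemma neg_half_pi_le : -(Real.pi / 2) ≤ Real.pi / 2 := by linarith [Real.pi_pos]

/-- The Volterra operator on `L²(-π/2, π/2)`. -/
noncomputable def volterra : Lp ℂ 2 angleMeasure →L[ℂ] Lp ℂ 2 angleMeasure :=
  ((BoundedContinuousFunction.toLp 2 angleMeasure ℂ).comp
    (BoundedContinuousFunction.compContinuousCLM ℂ ℂ
      (⟨projIcc _ _ neg_half_pi_le, continuous_projIcc⟩ :
        C(ℝ, Icc (-(Real.pi / 2)) (Real.pi / 2))))).comp primitiveBCF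

lemma isCompactOperator_volterra : IsCompactOperator volterra :=
  isCompactOperator_primitiveBCF.continuous_comp (g := (BoundedContinuousFunction.toLp 2
    angleMeasure ℂ).comp (BoundedContinuousFunction.compContinuousCLM ℂ ℂ _))
    (ContinuousLinearMap.continuous _)

lemma coeFn_volterra (f : Lp ℂ 2 angleMeasure) : volterra f =ᵐ[angleMeasure] primitive f := by
  refine (BoundedContinuousFunction.coeFn_toLp 2 angleMeasure ℂ _).trans ?_
  filter_upwards [ae_angleMeasure_mem] with x hx
  change primitive f (projIcc _ _ neg_half_pi_le x) = _
  rw [projIcc_of_mem _ (Ioo_subset_Icc_self hx)]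

lemma primitive_eq_intervalIntegral (f : Lp ℂ 2 angleMeasure) {x y : ℝ}
    (hx : x ∈ Ioo (-(Real.pi / 2)) (Real.pi / 2)) (hy : y ∈ Ioo (-(Real.pi / 2)) (Real.pi / 2)) :
    primitive f y - primitive f x = ∫ t in x..y, f t := by
  wlog h : x ≤ y generalizing x y
  · rw [intervalIntegral.integral_symm, ← this hy hx (not_le.1 h).le, neg_sub]
  have e : angleMeasure.restrict (Ioc x y) = volume.restrict (Ioc x y) := by
    rw [angleMeasure, Measure.restrict_restrict measurableSet_Ioc, inter_eq_left.2]
    exact fun t ht => ⟨hx.1.trans ht.1, ht.2.trans_lt hy.2⟩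
  rw [primitive_sub f h, intervalIntegral.integral_of_le h, e]

end Primitive

/-! ### The quadratic form of the Schrödinger operator -/

section SchrodingerForm

lemma testFunction_eq_zero {Ω : TopologicalSpace.Opens ℝ} (φ : 𝓓(Ω, ℂ)) {x : ℝ}
    (hx : x ∉ (Ω : Set ℝ)) : φ x = 0 :=
  image_eq_zero_of_notMem_tsupport fun h => hx (φ.tsupport_subset h)

lemma testFunction_deriv_eq_zero {Ω : TopologicalSpace.Opens ℝ} (φ : 𝓓(Ω, ℂ)) {x : ℝ}
    (hx : x ∉ (Ω : Set ℝ)) : deriv φ x = 0 := by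
  by_contra h
  exact hx (φ.tsupport_subset (support_deriv_subset h))

lemma integral_angleMeasure_of_eq_zero {f : ℝ → ℂ} (h : ∀ x, x ∉ (angleInt : Set ℝ) → f x = 0) :
    ∫ x, f x ∂angleMeasure = ∫ x, f x :=
  setIntegral_eq_integral_of_forall_compl_eq_zero h

/-- `φ ↦ φ'` from test functions to `L²(-π/2, π/2)`. -/
noncomputable def derivL2 : 𝓓(angleInt, ℂ) →ₗ[ℂ] Lp ℂ 2 angleMeasure :=
  diffToL2 (p₂ := fun _ => 0) (p₁ := fun _ => 1) (p₀ := fun _ => 0) admissible_angle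
    continuousOn_const continuousOn_const continuousOn_const

/-- `φ ↦ r φ` from test functions to `L²(-π/2, π/2)`. -/
noncomputable def mulL2 {r : ℝ → ℝ} (hr : ContinuousOn r angleInt) :
    𝓓(angleInt, ℂ) →ₗ[ℂ] Lp ℂ 2 angleMeasure :=
  diffToL2 (p₂ := fun _ => 0) (p₁ := fun _ => 0) (p₀ := r) admissible_angle
    continuousOn_const continuousOn_const hr

lemma coeFn_derivL2 (φ : 𝓓(angleInt, ℂ)) : derivL2 φ =ᵐ[angleMeasure] deriv φ := by
  refine (coeFn_diffToL2 _ _ _ _ φ).trans (Eventually.of_forall fun x => ?_)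
  simp [diffExpr]

lemma coeFn_mulL2 {r : ℝ → ℝ} (hr : ContinuousOn r angleInt) (φ : 𝓓(angleInt, ℂ)) :
    mulL2 hr φ =ᵐ[angleMeasure] fun x => (r x : ℂ) * φ x := by
  refine (coeFn_diffToL2 _ _ _ _ φ).trans (Eventually.of_forall fun x => ?_)
  simp [diffExpr]

lemma volterra_derivL2 (φ : 𝓓(angleInt, ℂ)) :
    volterra (derivL2 φ) = testToL2 admissible_angle φ := by
  apply Lp.ext
  refine (coeFn_volterra _).trans (EventuallyEq.trans ?_ (coeFn_testToL2 _ φ).symm)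
  refine Eventually.of_forall fun x => ?_
  have h1 : primitive (derivL2 φ) x = ∫ t in Iic x, deriv φ t := by
    rw [primitive, integral_congr_ae (ae_restrict_of_ae (coeFn_derivL2 φ)), angleMeasure,
      Measure.restrict_restrict measurableSet_Iic, inter_comm,
      ← Measure.restrict_restrict measurableSet_Ioo]
    exact setIntegral_eq_integral_of_forall_compl_eq_zero
      fun y hy => testFunction_deriv_eq_zero φ hy
  rw [h1]
  exact HasCompactSupport.integral_Iic_deriv_eq (contDiff_infty.1 φ.contDiff 1)
    φ.hasCompactSupport x

/-- One integration by parts, carried out on the whole line, where compact supports leave no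
boundary terms. -/
lemma inner_derivL2 (φ ψ : 𝓓(angleInt, ℂ)) :
    inner ℂ (derivL2 φ) (derivL2 ψ) =
      ∫ x, (-deriv (deriv ψ) x) * (starRingEnd ℂ) (φ x) ∂angleMeasure := by
  have h1 : inner ℂ (derivL2 φ) (derivL2 ψ) =
      ∫ x, deriv ψ x * (starRingEnd ℂ) (deriv φ x) ∂angleMeasure := by
    rw [L2.inner_def]
    refine integral_congr_ae ?_
    filter_upwards [coeFn_derivL2 φ, coeFn_derivL2 ψ] with x hx hy
    rw [hx, hy, RCLike.inner_apply]
  obtain ⟨d0, d1, -⟩ := testFunction_deriv φ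
  obtain ⟨e0, e1, e2⟩ := testFunction_deriv ψ
  rw [h1, integral_angleMeasure_of_eq_zero fun x hx => by
      rw [testFunction_deriv_eq_zero ψ hx, zero_mul],
    integral_angleMeasure_of_eq_zero fun x hx => by
      rw [testFunction_eq_zero φ hx, map_zero, mul_zero]]
  have hcs : HasCompactSupport fun x => (starRingEnd ℂ) (φ x) :=
    φ.hasCompactSupport.comp_left (g := starRingEnd ℂ) (map_zero _)
  have hcs1 : HasCompactSupport (deriv ψ) := ψ.hasCompactSupport.deriv
  have hd : ∀ x, HasDerivAt (fun x => (starRingEnd ℂ) (φ x)) ((starRingEnd ℂ) (deriv φ x)) x :=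
    fun x => (d0 x).hasDerivAt.star
  have hcont : Continuous fun x => (starRingEnd ℂ) (φ x) := by fun_prop
  have hcont' : Continuous fun x => (starRingEnd ℂ) (deriv φ x) :=
    Complex.continuous_conj.comp d1.continuous
  have := integral_mul_deriv_eq_deriv_mul_of_integrable (u := deriv ψ) (u' := deriv (deriv ψ))
    (v := fun x => (starRingEnd ℂ) (φ x)) (v' := fun x => (starRingEnd ℂ) (deriv φ x))
    (fun x _ => (e1 x).hasDerivAt) (fun x _ => hd x)
    ((e1.continuous.mul hcont').integrable_of_hasCompactSupport hcs1.mul_right)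
    ((e2.mul hcont).integrable_of_hasCompactSupport hcs.mul_left)
    ((e1.continuous.mul hcont).integrable_of_hasCompactSupport hcs.mul_left)
  rw [this, ← integral_neg]
  simp only [neg_mul]

variable {q r : ℝ → ℝ}

/-- The operator `-d²/dξ² + q` on test functions in `(-π/2, π/2)`. -/
noncomputable def schrodinger (hq : ContinuousOn q angleInt) :
    Lp ℂ 2 angleMeasure →ₗ.[ℂ] Lp ℂ 2 angleMeasure :=
  diffOp (Ω := angleInt) (p₂ := fun _ => -1) (p₁ := fun _ => 0) (p₀ := q)
    admissible_angle continuousOn_const continuousOn_const hq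

lemma dense_domain_schrodinger (hq : ContinuousOn q angleInt) :
    Dense ((schrodinger hq).domain : Set (Lp ℂ 2 angleMeasure)) :=
  denseRange_testToL2 admissible_angle angleMeasure_compl

/-- `φ ↦ (φ', r φ)`. -/
noncomputable def formPair (hr : ContinuousOn r angleInt) :
    𝓓(angleInt, ℂ) →ₗ[ℂ] WithLp 2 (Lp ℂ 2 angleMeasure × Lp ℂ 2 angleMeasure) :=
  (WithLp.linearEquiv 2 ℂ (Lp ℂ 2 angleMeasure × Lp ℂ 2 angleMeasure)).symm.toLinearMap ∘ₗ
    (derivL2.prod (mulL2 hr))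

/-- `φ ↦ (φ', r φ)` on the domain of the Schrödinger operator. -/
noncomputable def formMap (hq : ContinuousOn q angleInt) (hr : ContinuousOn r angleInt) :
    (schrodinger hq).domain →ₗ[ℂ] WithLp 2 (Lp ℂ 2 angleMeasure × Lp ℂ 2 angleMeasure) :=
  formPair hr ∘ₗ (LinearEquiv.ofInjective (testToL2 admissible_angle)
    (testToL2_injective admissible_angle)).symm.toLinearMap

/-- A test function as an element of the domain of the Schrödinger operator. -/
noncomputable def domTest (hq : ContinuousOn q angleInt) (φ : 𝓓(angleInt, ℂ)) :
    (schrodinger hq).domain := ⟨testToL2 admissible_angle φ, ⟨φ, rfl⟩⟩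

lemma exists_domTest (hq : ContinuousOn q angleInt) (x : (schrodinger hq).domain) :
    ∃ φ, x = domTest hq φ := by
  obtain ⟨_, φ, rfl⟩ := x
  exact ⟨φ, rfl⟩

lemma formMap_domTest (hq : ContinuousOn q angleInt) (hr : ContinuousOn r angleInt)
    (φ : 𝓓(angleInt, ℂ)) : formMap hq hr (domTest hq φ) = formPair hr φ := by
  change formPair hr ((LinearEquiv.ofInjective (testToL2 admissible_angle)
    (testToL2_injective admissible_angle)).symm (domTest hq φ)) = _
  congr 1
  refine (LinearEquiv.symm_apply_eq _).2 ?_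
  rfl

/-- `(v, w) ↦ ∫ v`. -/
noncomputable def formPrimitive :
    WithLp 2 (Lp ℂ 2 angleMeasure × Lp ℂ 2 angleMeasure) →L[ℂ] Lp ℂ 2 angleMeasure :=
  volterra.comp (WithLp.fstL 2 ℂ _ _)

lemma isCompactOperator_formPrimitive : IsCompactOperator formPrimitive :=
  isCompactOperator_volterra.comp_clm _

lemma formPrimitive_formMap (hq : ContinuousOn q angleInt) (hr : ContinuousOn r angleInt)
    (x : (schrodinger hq).domain) : formPrimitive (formMap hq hr x) = x := by
  obtain ⟨φ, rfl⟩ := exists_domTest hq x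
  rw [formMap_domTest]
  exact volterra_derivL2 φ

lemma inner_testToL2_mulL2 {s : ℝ → ℝ} (hs : ContinuousOn s angleInt)
    (f : Lp ℂ 2 angleMeasure) (ψ : 𝓓(angleInt, ℂ)) :
    inner ℂ f (mulL2 hs ψ) = ∫ x, s x * ψ x * (starRingEnd ℂ) (f x) ∂angleMeasure := by
  rw [L2.inner_def]
  refine integral_congr_ae ?_
  filter_upwards [coeFn_mulL2 hs ψ] with x hx
  rw [hx, RCLike.inner_apply]

variable {c : ℝ}

lemma inner_formPair (hq : ContinuousOn q angleInt) (hr : ContinuousOn r angleInt)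
    (hrq : ∀ x ∈ (angleInt : Set ℝ), r x ^ 2 = q x + c) (φ ψ : 𝓓(angleInt, ℂ)) :
    inner ℂ (formPair hr φ) (formPair hr ψ) = inner ℂ (derivL2 φ) (derivL2 ψ) +
      inner ℂ (testToL2 admissible_angle φ) (mulL2 (hq.add (continuousOn_const (c := c))) ψ) := by
  rw [WithLp.prod_inner_apply]
  change inner ℂ (derivL2 φ) (derivL2 ψ) + inner ℂ (mulL2 hr φ) (mulL2 hr ψ) = _
  congr 1
  rw [inner_testToL2_mulL2, inner_testToL2_mulL2]
  refine integral_congr_ae ?_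
  filter_upwards [coeFn_mulL2 hr φ, coeFn_testToL2 admissible_angle φ, ae_angleMeasure_mem]
    with x hx hx' hx''
  rw [hx, hx', map_mul, Complex.conj_ofReal]
  have : ((r x : ℂ)) ^ 2 = ((q x + c : ℝ) : ℂ) := by rw [← hrq x hx'']; push_cast; rfl
  linear_combination ψ x * (starRingEnd ℂ) (φ x) * this

lemma integrable_testFunction_mul {s : ℝ → ℝ} (hs : ContinuousOn s angleInt)
    (φ : 𝓓(angleInt, ℂ)) (f : Lp ℂ 2 angleMeasure) :
    Integrable (fun x => s x * φ x * (starRingEnd ℂ) (f x)) angleMeasure := by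
  have := L2.integrable_inner (𝕜 := ℂ) f (mulL2 hs φ)
  refine this.congr ?_
  filter_upwards [coeFn_mulL2 hs φ] with x hx
  rw [hx, RCLike.inner_apply]

/-- This is the factorization of the shifted form required by the abstract Friedrichs construction:
integration by parts produces `-ψ''`, and `r² = q + c` produces the rest. -/
lemma inner_formMap (hq : ContinuousOn q angleInt) (hr : ContinuousOn r angleInt)
    (hrq : ∀ x ∈ (angleInt : Set ℝ), r x ^ 2 = q x + c) (x y : (schrodinger hq).domain) :
    inner ℂ (formMap hq hr x) (formMap hq hr y) =
      inner ℂ (x : Lp ℂ 2 angleMeasure) (schrodinger hq y + (c : ℂ) • (y : Lp ℂ 2 angleMeasure)) := by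
  obtain ⟨φ, rfl⟩ := exists_domTest hq x
  obtain ⟨ψ, rfl⟩ := exists_domTest hq y
  rw [formMap_domTest, formMap_domTest, inner_formPair hq hr hrq, inner_derivL2,
    inner_testToL2_mulL2]
  have e1 : schrodinger hq (domTest hq ψ) = diffToL2 (p₂ := fun _ => -1) (p₁ := fun _ => 0)
      (p₀ := q) admissible_angle continuousOn_const continuousOn_const hq ψ := diffOp_apply _ _ _ _ _
  rw [e1, L2.inner_def]
  have hI1 : Integrable (fun x => (-deriv (deriv ψ) x) * (starRingEnd ℂ) (φ x)) angleMeasure := by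
    obtain ⟨e0, e1, e2⟩ := testFunction_deriv ψ
    have hcs : HasCompactSupport fun x => (starRingEnd ℂ) (φ x) :=
      φ.hasCompactSupport.comp_left (g := starRingEnd ℂ) (map_zero _)
    have hcont : Continuous fun x => (starRingEnd ℂ) (φ x) := by fun_prop
    exact ((e2.neg.mul hcont).integrable_of_hasCompactSupport hcs.mul_left).restrict
  have hI2 := integrable_testFunction_mul (hq.add (continuousOn_const (c := c))) ψ
    (testToL2 admissible_angle φ)
  rw [← integral_add hI1 hI2]
  refine integral_congr_ae ?_
  filter_upwards [coeFn_testToL2 admissible_angle φ, coeFn_testToL2 admissible_angle ψ,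
    coeFn_diffToL2 (p₂ := fun _ => -1) (p₁ := fun _ => 0) (p₀ := q) admissible_angle
      continuousOn_const continuousOn_const hq ψ,
    Lp.coeFn_add (diffToL2 (p₂ := fun _ => -1) (p₁ := fun _ => 0) (p₀ := q) admissible_angle
      continuousOn_const continuousOn_const hq ψ) ((c : ℂ) • (testToL2 admissible_angle ψ)),
    Lp.coeFn_smul (c : ℂ) (testToL2 admissible_angle ψ)] with x h1 h2 h3 h4 h5
  change _ = inner ℂ (testToL2 admissible_angle φ x) ((diffToL2 (p₂ := fun _ => -1)
    (p₁ := fun _ => 0) (p₀ := q) admissible_angle continuousOn_const continuousOn_const hq ψ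
      + (c : ℂ) • (testToL2 admissible_angle ψ)) x)
  rw [h4]
  simp only [Pi.add_apply]
  rw [h5, Pi.smul_apply, h1, h2, h3, RCLike.inner_apply, diffExpr]
  push_cast
  simp only [smul_eq_mul]
  ring

/-- The resolvent `(S + c)⁻¹` of the Friedrichs extension. -/
noncomputable def schrodingerResolvent (hq : ContinuousOn q angleInt)
    (hr : ContinuousOn r angleInt) : Lp ℂ 2 angleMeasure →L[ℂ] Lp ℂ 2 angleMeasure :=
  formResolvent (formMap hq hr) formPrimitive

/-- Elements of an eigenspace of the Friedrichs extension satisfy the weak eigenvalue equation. -/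
lemma exists_weak_eigenfunction (hq : ContinuousOn q angleInt) (hr : ContinuousOn r angleInt)
    (hrq : ∀ x ∈ (angleInt : Set ℝ), r x ^ 2 = q x + c) {l : ℝ} {u : Lp ℂ 2 angleMeasure}
    (hu : u ∈ opEigenspace (shiftedInverse (schrodingerResolvent hq hr) c) (l : ℂ)) :
    ∃ v : Lp ℂ 2 angleMeasure, u = volterra v ∧ ∀ ψ : 𝓓(angleInt, ℂ),
      inner ℂ v (derivL2 ψ) + inner ℂ u (mulL2 (hq.add (continuousOn_const (c := c))) ψ) =
        inner ℂ (((l + c : ℝ) : ℂ) • u) (testToL2 admissible_angle ψ) := by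
  have hJB := formPrimitive_formMap hq hr
  have hB := inner_formMap hq hr hrq
  obtain ⟨v, rfl, hv⟩ := (mem_graph_formResolvent_iff (dense_domain_schrodinger hq) hJB hB).1 hu
  refine ⟨WithLp.fstL 2 ℂ _ _ (v : WithLp 2 (Lp ℂ 2 angleMeasure × Lp ℂ 2 angleMeasure)), rfl,
    fun ψ => ?_⟩
  have h := hv (domTest hq ψ)
  rw [formMap_domTest] at h
  push_cast
  rw [add_smul]
  refine Eq.trans ?_ h
  -- The remaining identity holds for every `v` in the form space. Both sides are continuous in `v`,
  -- and on the range of `B` it is `inner_formPair`, so the second component of `v` never has to be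
  -- identified with `r u`.
  clear hv h hu
  revert v
  apply formSpace_induction
  · exact isClosed_eq (by fun_prop) (by fun_prop)
  · intro x
    obtain ⟨φ, rfl⟩ := exists_domTest hq x
    have h1 : formEmbedding (formMap hq hr) formPrimitive
      ⟨formMap hq hr (domTest hq φ), Submodule.le_topologicalClosure _ ⟨_, rfl⟩⟩ =
        testToL2 admissible_angle φ := hJB _
    rw [h1]
    simp only [formMap_domTest]
    rw [inner_formPair hq hr hrq]
    rfl

end SchrodingerForm

/-! ### Functions with vanishing weak derivative -/

section WeakDerivative

lemma exists_Icc_of_isCompact_subset_Ioo {a b : ℝ} {K : Set ℝ} (hab : a < b) (hK : IsCompact K)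
    (h : K ⊆ Ioo a b) : ∃ c d, a < c ∧ c ≤ d ∧ d < b ∧ K ⊆ Icc c d := by
  rcases K.eq_empty_or_nonempty with rfl | hne
  · exact ⟨(a + b) / 2, (a + b) / 2, by linarith, le_rfl, by linarith, empty_subset _⟩
  · have h1 := hK.isLeast_sInf hne
    have h2 := hK.isGreatest_sSup hne
    exact ⟨sInf K, sSup K, (h h1.1).1, h1.2 h2.1, (h h2.1).2, fun x hx => ⟨h1.2 hx, h2.2 hx⟩⟩

/-- A smooth function with zero mean and compact support in an interval has a primitive of the same
kind. -/
lemma exists_primitive_of_integral_eq_zero {a b : ℝ} (hab : a < b) {g : ℝ → ℝ}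
    (hg : ContDiff ℝ (⊤ : ℕ∞) g) (hc : HasCompactSupport g) (hs : tsupport g ⊆ Ioo a b)
    (h0 : ∫ x, g x = 0) : ∃ p : ℝ → ℝ, ContDiff ℝ (⊤ : ℕ∞) p ∧ HasCompactSupport p ∧
      tsupport p ⊆ Ioo a b ∧ deriv p = g := by
  obtain ⟨c, d, hac, hcd, hdb, hK⟩ := exists_Icc_of_isCompact_subset_Ioo hab hc hs
  have hz : ∀ x, x ∉ Icc c d → g x = 0 := fun x hx =>
    image_eq_zero_of_notMem_tsupport fun h => hx (hK h)
  have hd : ∀ x, HasDerivAt (fun x => ∫ t in c..x, g t) (g x) x := fun x =>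
    (hg.continuous.integral_hasStrictDerivAt c x).hasDerivAt
  have hderiv : deriv (fun x => ∫ t in c..x, g t) = g := funext fun x => (hd x).deriv
  -- To the left `g` vanishes on the range of integration; to the right the integral is the full
  -- mean of `g`, which is zero.
  have hzero : ∀ x, x ∉ Icc c d → ∫ t in c..x, g t = 0 := by
    intro x hx
    rcases lt_or_ge x c with h | h
    · rw [intervalIntegral.integral_symm, neg_eq_zero, intervalIntegral.integral_of_le h.le]
      refine setIntegral_eq_zero_of_forall_eq_zero fun t ht => ?_
      rcases eq_or_lt_of_le ht.2 with rfl | h'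
      · have hcl : (closure (Iio t)) ⊆ {y | g y = 0} :=
          closure_minimal (fun y hy => hz y fun h => absurd h.1 (not_le.2 hy))
            (isClosed_eq hg.continuous continuous_const)
        exact hcl (by simp)
      · exact hz t fun h => absurd h.1 (not_le.2 h')
    · have hdx : d < x := by
        by_contra h'
        exact hx ⟨h, not_lt.1 h'⟩
      rw [intervalIntegral.integral_of_le h, ← h0, ← integral_Icc_eq_integral_Ioc]
      refine setIntegral_eq_integral_of_forall_compl_eq_zero fun t ht => hz t fun h' => ht ?_
      exact ⟨h'.1, h'.2.trans hdx.le⟩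
  have hts : tsupport (fun x => ∫ t in c..x, g t) ⊆ Icc c d :=
    closure_minimal (fun x hx => by
      by_contra h
      exact hx (hzero x h)) isClosed_Icc
  refine ⟨fun x => ∫ t in c..x, g t, ?_, isCompact_Icc.of_isClosed_subset isClosed_closure hts, ?_, hderiv⟩
  · rw [contDiff_infty_iff_deriv, hderiv]
    exact ⟨fun x => (hd x).differentiableAt, hg⟩
  · exact hts.trans fun x hx => ⟨hac.trans_le hx.1, hx.2.trans_lt hdb⟩

lemma integrable_smul_of_tsupport_subset {a b : ℝ} {f : ℝ → ℂ}
    (hf : LocallyIntegrableOn f (Ioo a b)) {g : ℝ → ℝ} (hg : Continuous g)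
    (hc : HasCompactSupport g) (hs : tsupport g ⊆ Ioo a b) : Integrable fun x => g x • f x := by
  have h1 : IntegrableOn f (tsupport g) := hf.integrableOn_compact_subset hs hc
  have h2 := h1.continuousOn_smul hg.continuousOn hc
  refine (integrableOn_iff_integrable_of_support_subset ?_).1 h2
  intro x hx
  by_contra h
  exact hx (by simp [image_eq_zero_of_notMem_tsupport h])

/-- The lemma of du Bois-Reymond. -/
theorem ae_eq_const_of_integral_deriv_smul_eq_zero {a b : ℝ} (hab : a < b) {f : ℝ → ℂ}
    (hf : LocallyIntegrableOn f (Ioo a b))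
    (h : ∀ g : ℝ → ℝ, ContDiff ℝ (⊤ : ℕ∞) g → HasCompactSupport g → tsupport g ⊆ Ioo a b →
      ∫ x, deriv g x • f x = 0) : ∃ k : ℂ, ∀ᵐ x, x ∈ Ioo a b → f x = k := by
  -- The bump has integral one, and its radii keep its support inside `(a, b)`. Subtracting `(∫ g)
  -- χ` from a test function `g` leaves zero mean, hence the derivative of a test function, which
  -- gives `∫ g f = (∫ g) k` with `k = ∫ χ f`.
  let B : ContDiffBump ((a + b) / 2) := ⟨(b - a) / 8, (b - a) / 4, by linarith, by linarith⟩
  set χ : ℝ → ℝ := B.normed volume with hχdef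
  have hχd : ContDiff ℝ (⊤ : ℕ∞) χ := B.contDiff_normed
  have hχc : HasCompactSupport χ := B.hasCompactSupport_normed
  have hχs : tsupport χ ⊆ Ioo a b := by
    rw [hχdef, B.tsupport_normed_eq, Real.closedBall_eq_Icc]
    change Icc ((a + b) / 2 - (b - a) / 4) ((a + b) / 2 + (b - a) / 4) ⊆ _
    exact fun x hx => ⟨by linarith [hx.1], by linarith [hx.2]⟩
  have hχ1 : ∫ x, χ x = 1 := B.integral_normed
  refine ⟨∫ x, χ x • f x, ?_⟩
  set k := ∫ x, χ x • f x with hk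
  have key := isOpen_Ioo.ae_eq_zero_of_integral_contDiff_smul_eq_zero (μ := volume)
    (f := fun x => f x - k) (hf.sub (continuousOn_const.locallyIntegrableOn measurableSet_Ioo))
    (fun g hg hgc hgs => by
      have hgi : Integrable g := hg.continuous.integrable_of_hasCompactSupport hgc
      have hχi : Integrable χ := hχd.continuous.integrable_of_hasCompactSupport hχc
      set m := ∫ x, g x with hm
      have hss : tsupport (fun x => g x - m * χ x) ⊆ tsupport g ∪ tsupport χ := by
        refine closure_minimal (fun x hx => ?_) ((isClosed_tsupport _).union (isClosed_tsupport _))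
        by_contra hx'
        rw [mem_union, not_or] at hx'
        exact hx (by simp [image_eq_zero_of_notMem_tsupport hx'.1,
          image_eq_zero_of_notMem_tsupport hx'.2])
      obtain ⟨p, hp1, hp2, hp3, hp4⟩ := exists_primitive_of_integral_eq_zero hab
        (g := fun x => g x - m * χ x) (hg.sub (contDiff_const.mul hχd))
        ((hgc.union hχc).of_isClosed_subset isClosed_closure hss)
        (hss.trans (union_subset hgs hχs))
        (by rw [integral_sub hgi (hχi.const_mul m), integral_const_mul, hχ1, mul_one, sub_self])
      have h1 := h p hp1 hp2 hp3
      rw [hp4] at h1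
      have hgf := integrable_smul_of_tsupport_subset hf hg.continuous hgc hgs
      have hχf := integrable_smul_of_tsupport_subset hf hχd.continuous hχc hχs
      have h2 : ∫ x, g x • f x = m • k := by
        rw [← sub_eq_zero, ← h1, hk, ← integral_smul, ← integral_sub hgf (hχf.smul m : Integrable fun x => m • χ x • f x)]
        refine integral_congr_ae (Eventually.of_forall fun x => ?_)
        simp only [sub_smul, mul_smul]
      simp only [smul_sub]
      rw [integral_sub hgf (hgi.smul_const k), h2, integral_smul_const, sub_self])
  filter_upwards [key] with x hx hx'
  exact sub_eq_zero.1 (hx hx')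

end WeakDerivative

/-! ### Regularity of eigenfunctions -/

section Eigenfunctions

variable {q r : ℝ → ℝ} {c : ℝ}

lemma zero_mem_angle : (0 : ℝ) ∈ Ioo (-(Real.pi / 2)) (Real.pi / 2) := by
  constructor <;> linarith [Real.pi_pos]

/-- The shift `c` cancels from the weak eigenvalue equation. Inner products conjugate `v`, so the
identity is first obtained for complex conjugates; the test function is real, hence unaffected. -/
lemma integral_deriv_smul_weak (hq : ContinuousOn q angleInt) {l : ℝ}
    {v : Lp ℂ 2 angleMeasure}
    (hv : ∀ ψ : 𝓓(angleInt, ℂ),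
      inner ℂ v (derivL2 ψ) +
        inner ℂ (volterra v) (mulL2 (hq.add (continuousOn_const (c := c))) ψ) =
        inner ℂ (((l + c : ℝ) : ℂ) • volterra v) (testToL2 admissible_angle ψ))
    {g : ℝ → ℝ} (h1 : ContDiff ℝ (⊤ : ℕ∞) g) (h2 : HasCompactSupport g)
    (h3 : tsupport g ⊆ Ioo (-(Real.pi / 2)) (Real.pi / 2)) :
    ∫ x, deriv g x • v x = -∫ x, g x • (((q x - l : ℝ) : ℂ) * primitive v x) := by
  set ψ : 𝓓(angleInt, ℂ) := realTest g h1 h2 h3 with hψ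
  have hψ' : ∀ x, deriv ψ x = ((deriv g x : ℝ) : ℂ) := fun x =>
    ((h1.differentiable (by simp) x).hasDerivAt.ofReal_comp).deriv
  have e := hv ψ
  rw [inner_testToL2_mulL2, L2.inner_def, L2.inner_def, ← eq_sub_iff_add_eq, ← integral_sub
    (L2.integrable_inner _ _) (integrable_testFunction_mul (hq.add (continuousOn_const (c := c))) _ _)] at e
  have e1 : (starRingEnd ℂ) (∫ x, deriv g x • v x) =
      ∫ x, inner ℂ (v x) (derivL2 ψ x) ∂angleMeasure := by
    rw [← integral_angleMeasure_of_eq_zero (f := fun x => deriv g x • v x), ← integral_conj]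
    · refine integral_congr_ae ?_
      filter_upwards [coeFn_derivL2 ψ] with x hx
      rw [hx, RCLike.inner_apply, hψ', Complex.real_smul, map_mul, Complex.conj_ofReal]
    · intro x hx
      have : deriv g x = 0 := by
        by_contra h
        exact hx (h3 (support_deriv_subset h))
      rw [this, zero_smul]
  have e2 : (starRingEnd ℂ) (-∫ x, g x • (((q x - l : ℝ) : ℂ) * primitive v x)) =
      ∫ x, inner ℂ ((((l + c : ℝ) : ℂ) • volterra v : Lp ℂ 2 angleMeasure) x)
        (testToL2 admissible_angle ψ x) - ((q x + c : ℝ) : ℂ) * ψ x *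
          (starRingEnd ℂ) (volterra v x) ∂angleMeasure := by
    rw [← integral_neg, ← integral_angleMeasure_of_eq_zero
      (f := fun x => -(g x • (((q x - l : ℝ) : ℂ) * primitive v x))), ← integral_conj]
    · refine integral_congr_ae ?_
      filter_upwards [coeFn_testToL2 admissible_angle ψ, coeFn_volterra v,
        Lp.coeFn_smul ((l + c : ℝ) : ℂ) (volterra v)] with x hx hx' hx''
      rw [hx'', hx, Pi.smul_apply, hx', RCLike.inner_apply, show ψ x = (g x : ℂ) from rfl]
      simp only [map_neg, map_mul, smul_eq_mul, Complex.conj_ofReal,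
        Complex.real_smul]
      push_cast
      ring
    · intro x hx
      have : g x = 0 := image_eq_zero_of_notMem_tsupport fun h => hx (h3 h)
      rw [this, zero_smul, neg_zero]
  have h : (starRingEnd ℂ) (∫ x, deriv g x • v x) =
      (starRingEnd ℂ) (-∫ x, g x • (((q x - l : ℝ) : ℂ) * primitive v x)) := by
    rw [e1, e2, e]
    rfl
  exact (starRingEnd ℂ).injective h

/-- A function in the domain of the closed form that satisfies the weak eigenvalue equation is a
classical solution. -/
theorem exists_classical_solution (hq : ContinuousOn q angleInt) {l : ℝ}
    {v : Lp ℂ 2 angleMeasure}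
    (hv : ∀ g : ℝ → ℝ, ContDiff ℝ (⊤ : ℕ∞) g → HasCompactSupport g →
      tsupport g ⊆ Ioo (-(Real.pi / 2)) (Real.pi / 2) →
      ∫ x, deriv g x • v x = -∫ x, g x • (((q x - l : ℝ) : ℂ) * primitive v x)) :
    ∃ P : ℝ → ℂ, v =ᵐ[angleMeasure] P ∧
      (∀ x ∈ Ioo (-(Real.pi / 2)) (Real.pi / 2), HasDerivAt (primitive v) (P x) x) ∧
      ∀ x ∈ Ioo (-(Real.pi / 2)) (Real.pi / 2), HasDerivAt P (((q x - l : ℝ) : ℂ) * primitive v x) x := by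
  set h : ℝ → ℂ := fun x => ((q x - l : ℝ) : ℂ) * primitive v x with hh
  have hhc : ContinuousOn h (Ioo (-(Real.pi / 2)) (Real.pi / 2)) :=
    (Complex.continuous_ofReal.comp_continuousOn (hq.sub continuousOn_const)).mul
      (continuous_primitive v).continuousOn
  have hFTC : ∀ {k : ℝ → ℂ}, ContinuousOn k (Ioo (-(Real.pi / 2)) (Real.pi / 2)) →
      ∀ x ∈ Ioo (-(Real.pi / 2)) (Real.pi / 2),
      HasDerivAt (fun x => ∫ t in (0 : ℝ)..x, k t) (k x) x := by
    intro k hk x hx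
    refine intervalIntegral.integral_hasDerivAt_right ?_
      (hk.stronglyMeasurableAtFilter isOpen_Ioo x hx) (hk.continuousAt (isOpen_Ioo.mem_nhds hx))
    refine (hk.mono ?_).intervalIntegrable
    exact (ordConnected_Ioo).uIcc_subset zero_mem_angle hx
  -- `G` is a classical primitive of `(q - l) u`, so `v - G` has zero weak derivative and is almost
  -- everywhere a constant `k`. The continuous representative of `v` is `G + k`.
  set G : ℝ → ℂ := fun x => ∫ t in (0 : ℝ)..x, h t with hG
  have hGd : ∀ x ∈ Ioo (-(Real.pi / 2)) (Real.pi / 2), HasDerivAt G (h x) x := hFTC hhc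
  have hGc : ContinuousOn G (Ioo (-(Real.pi / 2)) (Real.pi / 2)) :=
    fun x hx => (hGd x hx).continuousAt.continuousWithinAt
  have hvi : IntegrableOn (v : ℝ → ℂ) (Ioo (-(Real.pi / 2)) (Real.pi / 2)) := integrable_angleMeasure v
  have hvl : LocallyIntegrableOn (v : ℝ → ℂ) (Ioo (-(Real.pi / 2)) (Real.pi / 2)) :=
    hvi.locallyIntegrableOn
  have hGl := hGc.locallyIntegrableOn (μ := volume) measurableSet_Ioo
  have hhl := hhc.locallyIntegrableOn (μ := volume) measurableSet_Ioo
  obtain ⟨k, hk⟩ := ae_eq_const_of_integral_deriv_smul_eq_zero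
    (by linarith [Real.pi_pos]) (hvl.sub hGl) (fun g h1 h2 h3 => by
      have hgd : Continuous (deriv g) := h1.continuous_deriv (by simp)
      have hsd : tsupport (deriv g) ⊆ Ioo (-(Real.pi / 2)) (Real.pi / 2) :=
        (tsupport_deriv_subset).trans h3
      have i1 := integrable_smul_of_tsupport_subset hvl hgd h2.deriv hsd
      have i2 := integrable_smul_of_tsupport_subset hGl hgd h2.deriv hsd
      have i3 := integrable_smul_of_tsupport_subset hhl h1.continuous h2 h3
      have i4 := integrable_smul_of_tsupport_subset hGl h1.continuous h2 h3
      have hparts := integral_mul_deriv_eq_deriv_mul_of_integrable (u := G) (u' := h)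
        (v := fun x => (g x : ℂ)) (v' := fun x => ((deriv g x : ℝ) : ℂ))
        (fun x hx => hGd x (h3 (tsupport_comp_subset (g := fun x : ℝ => (x : ℂ))
          Complex.ofReal_zero g hx)))
        (fun x _ => (h1.differentiable (by simp) x).hasDerivAt.ofReal_comp)
        (i2.congr (Eventually.of_forall fun x => by
          simp only [Pi.mul_apply, Complex.real_smul, mul_comm]))
        (i3.congr (Eventually.of_forall fun x => by
          simp only [Pi.mul_apply, Complex.real_smul, mul_comm]))
        (i4.congr (Eventually.of_forall fun x => by
          simp only [Pi.mul_apply, Complex.real_smul, mul_comm]))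
      simp only [Pi.sub_apply, smul_sub]
      rw [integral_sub i1 i2, hv g h1 h2 h3, sub_eq_zero]
      simp only [Complex.real_smul, mul_comm _ (G _)]
      rw [hparts]
      exact congrArg _ (integral_congr_ae (Eventually.of_forall fun x => mul_comm _ _)))
  have hvG : ∀ᵐ x ∂angleMeasure, v x = G x + k := by
    refine (ae_restrict_iff' measurableSet_Ioo).2 ?_
    filter_upwards [hk] with x hx hx'
    exact sub_eq_iff_eq_add'.1 (hx hx')
  refine ⟨fun x => G x + k, hvG, fun x hx => ?_, fun x hx => (hGd x hx).add_const k⟩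
  have hPc : ContinuousOn (fun x => G x + k) (Ioo (-(Real.pi / 2)) (Real.pi / 2)) :=
    hGc.add continuousOn_const
  have h1 : ∀ y ∈ Ioo (-(Real.pi / 2)) (Real.pi / 2),
      primitive v y = (∫ t in (0 : ℝ)..y, (G t + k)) + primitive v 0 := by
    intro y hy
    rw [← sub_eq_iff_eq_add, primitive_eq_intervalIntegral v zero_mem_angle hy]
    refine intervalIntegral.integral_congr_ae ?_
    have := (ae_restrict_iff' measurableSet_Ioo).1 hvG
    filter_upwards [this] with t ht ht'
    exact ht ((ordConnected_Ioo).uIcc_subset zero_mem_angle hy (uIoc_subset_uIcc ht'))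
  refine ((hFTC hPc x hx).add_const (primitive v 0)).congr_of_eventuallyEq ?_
  filter_upwards [isOpen_Ioo.mem_nhds hx] with y hy
  exact h1 y hy

end Eigenfunctions

/-! ### Uniqueness for the initial value problem and the Wronskian -/

section Wronskian

variable {a b : ℝ} {Q : ℝ → ℝ}

/-- A solution of `U' = P`, `P' = Q U` with zero initial data vanishes. -/
lemma eq_zero_of_initial_data {U P : ℝ → ℂ} (hQ : ContinuousOn Q (Ioo a b))
    (hU : ∀ x ∈ Ioo a b, HasDerivAt U (P x) x)
    (hP : ∀ x ∈ Ioo a b, HasDerivAt P ((Q x : ℂ) * U x) x) {x₀ : ℝ} (hx₀ : x₀ ∈ Ioo a b)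
    (hU0 : U x₀ = 0) (hP0 : P x₀ = 0) : ∀ x ∈ Ioo a b, U x = 0 := by
  intro x hx
  -- `Q` may blow up at the ends of `(a, b)`; a compact subinterval around both `x₀` and `x` makes
  -- it bounded and the first-order system uniformly Lipschitz.
  obtain ⟨c, d, hac, -, hdb, hcd⟩ : ∃ c d, a < c ∧ c ≤ d ∧ d < b ∧ (c < x₀ ∧ x₀ < d) ∧ c < x ∧ x < d := by
    obtain ⟨c, h1, h2⟩ := exists_between (lt_min hx₀.1 hx.1)
    obtain ⟨d, h3, h4⟩ := exists_between (max_lt hx₀.2 hx.2)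
    rw [lt_min_iff] at h2
    rw [max_lt_iff] at h3
    exact ⟨c, d, h1, (h2.1.trans h3.1).le, h4, ⟨h2.1, h3.1⟩, h2.2, h3.2⟩
  have hsub : Icc c d ⊆ Ioo a b := fun y hy => ⟨hac.trans_le hy.1, hy.2.trans_lt hdb⟩
  obtain ⟨C, hC⟩ := isCompact_Icc.exists_bound_of_continuousOn (hQ.mono hsub)
  have hlip : ∀ t ∈ Ioo c d, LipschitzOnWith (Real.toNNReal (max 1 C))
      (fun z : ℂ × ℂ => (z.2, (Q t : ℂ) * z.1)) univ := by
    intro t ht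
    refine LipschitzOnWith.of_dist_le_mul fun y _ z _ => ?_
    rw [Real.coe_toNNReal _ (le_max_of_le_left zero_le_one), Prod.dist_eq, Prod.dist_eq]
    refine max_le ?_ ?_
    · calc dist y.2 z.2 ≤ 1 * max (dist y.1 z.1) (dist y.2 z.2) := by
            rw [one_mul]; exact le_max_right _ _
        _ ≤ _ := by gcongr; exact le_max_left _ _
    · have h1 : dist ((Q t : ℂ) * y.1) ((Q t : ℂ) * z.1) = ‖Q t‖ * dist y.1 z.1 := by
        rw [dist_eq_norm, ← mul_sub, norm_mul, Complex.norm_real, dist_eq_norm]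
      simp only
      rw [h1]
      have h2 := hC t (Ioo_subset_Icc_self ht)
      exact mul_le_mul (h2.trans (le_max_right _ _)) (le_max_left _ _) dist_nonneg
        (le_max_of_le_left zero_le_one)
  have := ODE_solution_unique_of_mem_Ioo (v := fun t (z : ℂ × ℂ) => (z.2, (Q t : ℂ) * z.1))
    (s := fun _ => univ) (f := fun t => (U t, P t)) (g := fun _ => (0, 0)) hlip hcd.1
    (fun t ht => ⟨(hU t (hsub (Ioo_subset_Icc_self ht))).prodMk
      (hP t (hsub (Ioo_subset_Icc_self ht))), mem_univ _⟩)
    (fun t ht => ⟨by simpa using! hasDerivAt_const t ((0 : ℂ), (0 : ℂ)), mem_univ _⟩)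
    (by simp [hU0, hP0])
  exact congrArg Prod.fst (this hcd.2)

/-- Two solutions of `u'' = Q u` that vanish at `a` like a square root and have square integrable
derivatives have zero Wronskian. -/
lemma wronskian_eq_zero (hab : a < b) {U₁ P₁ U₂ P₂ : ℝ → ℂ}
    (hU₁ : ∀ x ∈ Ioo a b, HasDerivAt U₁ (P₁ x) x)
    (hP₁ : ∀ x ∈ Ioo a b, HasDerivAt P₁ ((Q x : ℂ) * U₁ x) x)
    (hU₂ : ∀ x ∈ Ioo a b, HasDerivAt U₂ (P₂ x) x)
    (hP₂ : ∀ x ∈ Ioo a b, HasDerivAt P₂ ((Q x : ℂ) * U₂ x) x) {C : ℝ}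
    (hC₁ : ∀ x ∈ Ioo a b, ‖U₁ x‖ ^ 2 ≤ C * (x - a)) (hC₂ : ∀ x ∈ Ioo a b, ‖U₂ x‖ ^ 2 ≤ C * (x - a))
    (hL₁ : IntegrableOn (fun x => ‖P₁ x‖ ^ 2) (Ioo a b))
    (hL₂ : IntegrableOn (fun x => ‖P₂ x‖ ^ 2) (Ioo a b)) :
    ∀ x ∈ Ioo a b, U₁ x * P₂ x - U₂ x * P₁ x = 0 := by
  have hW : ∀ x ∈ Ioo a b, HasDerivAt (fun x => U₁ x * P₂ x - U₂ x * P₁ x) 0 x := by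
    intro x hx
    convert! ((hU₁ x hx).mul (hP₂ x hx)).sub ((hU₂ x hx).mul (hP₁ x hx)) using 1
    ring
  have hconst : ∀ x ∈ Ioo a b, ∀ y ∈ Ioo a b,
      U₁ x * P₂ x - U₂ x * P₁ x = U₁ y * P₂ y - U₂ y * P₁ y := by
    intro x hx y hy
    refine isOpen_Ioo.is_const_of_deriv_eq_zero isPreconnected_Ioo
      (f := fun x => U₁ x * P₂ x - U₂ x * P₁ x)
      (fun z hz => (hW z hz).differentiableAt.differentiableWithinAt)
      (fun z hz => (hW z hz).deriv) hx hy
  intro y hy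
  by_contra hne
  set k := U₁ y * P₂ y - U₂ y * P₁ y with hk
  have hkpos : 0 < ‖k‖ ^ 2 := by positivity
  -- A nonzero constant Wronskian `k` satisfies `|k|² ≤ 2 C (x - a) (|P₁|² + |P₂|²)`. This would
  -- make `1 / (x - a)` integrable up to `a`, which is false.
  have hbound : ∀ x ∈ Ioo a b, ‖(x - a)⁻¹‖ ≤
      2 * C / ‖k‖ ^ 2 * (‖P₁ x‖ ^ 2 + ‖P₂ x‖ ^ 2) := by
    intro x hx
    have hxa : 0 < x - a := sub_pos.2 hx.1
    have h1 : ‖k‖ ≤ ‖U₁ x‖ * ‖P₂ x‖ + ‖U₂ x‖ * ‖P₁ x‖ := by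
      rw [hk, ← hconst x hx y hy, ← norm_mul, ← norm_mul]
      exact norm_sub_le _ _
    have h2 : ‖k‖ ^ 2 ≤ 2 * (‖U₁ x‖ ^ 2 * ‖P₂ x‖ ^ 2 + ‖U₂ x‖ ^ 2 * ‖P₁ x‖ ^ 2) := by
      calc ‖k‖ ^ 2 ≤ (‖U₁ x‖ * ‖P₂ x‖ + ‖U₂ x‖ * ‖P₁ x‖) ^ 2 := by gcongr
        _ ≤ _ := by nlinarith [sq_nonneg (‖U₁ x‖ * ‖P₂ x‖ - ‖U₂ x‖ * ‖P₁ x‖)]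
    have h3 : ‖k‖ ^ 2 ≤ 2 * C * (‖P₁ x‖ ^ 2 + ‖P₂ x‖ ^ 2) * (x - a) := by
      have e1 := mul_le_mul_of_nonneg_right (hC₁ x hx) (sq_nonneg ‖P₂ x‖)
      have e2 := mul_le_mul_of_nonneg_right (hC₂ x hx) (sq_nonneg ‖P₁ x‖)
      linarith
    rw [norm_inv, Real.norm_of_nonneg hxa.le, inv_le_iff_one_le_mul₀ hxa, div_mul_eq_mul_div,
      div_mul_eq_mul_div, one_le_div hkpos]
    exact h3
  have hint : IntegrableOn (fun x => (x - a)⁻¹) (Ioo a b) := by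
    refine Integrable.mono' ((hL₁.add hL₂).const_mul (2 * C / ‖k‖ ^ 2)) ?_ ?_
    · exact (by fun_prop : Measurable fun x : ℝ => (x - a)⁻¹).aestronglyMeasurable
    · exact (ae_restrict_iff' measurableSet_Ioo).2 (Eventually.of_forall hbound)
  have h4 : IntervalIntegrable (fun x => (x - a)⁻¹) volume a b := by
    rw [intervalIntegrable_iff_integrableOn_Ioo_of_le hab.le]
    exact hint
  rw [intervalIntegrable_sub_inv_iff] at h4
  rcases h4 with h | h
  · exact hab.ne h
  · exact h left_mem_uIcc

end Wronskian

/-! ### Simplicity of the eigenvalues -/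

section SimpleEigenvalues

variable {q r : ℝ → ℝ} {c : ℝ}

lemma norm_primitive_sq_le (v : Lp ℂ 2 angleMeasure) {C : ℝ} (hC : ‖v‖ ^ 2 ≤ C) :
    ∀ x ∈ Ioo (-(Real.pi / 2)) (Real.pi / 2), ‖primitive v x‖ ^ 2 ≤ C * (x - -(Real.pi / 2)) := by
  intro x hx
  have h1 := norm_primitive_le v hx.1.le
  have h2 : 0 ≤ x + Real.pi / 2 := by linarith [hx.1]
  calc ‖primitive v x‖ ^ 2 ≤ (√(x + Real.pi / 2) * ‖v‖) ^ 2 := by gcongr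
    _ = ‖v‖ ^ 2 * (x - -(Real.pi / 2)) := by rw [mul_pow, Real.sq_sqrt h2]; ring
    _ ≤ _ := by
      rw [sub_neg_eq_add]
      gcongr

lemma integrableOn_sq_of_ae_eq {v : Lp ℂ 2 angleMeasure} {P : ℝ → ℂ} (h : v =ᵐ[angleMeasure] P) :
    IntegrableOn (fun x => ‖P x‖ ^ 2) (Ioo (-(Real.pi / 2)) (Real.pi / 2)) := by
  have h1 : MemLp P 2 angleMeasure := (memLp_congr_ae h).1 (Lp.memLp v)
  exact (memLp_two_iff_integrable_sq_norm h1.1).1 h1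

/-- The eigenvalues of the Friedrichs extension are simple. -/
theorem exists_smul_eq_of_mem_opEigenspace (hq : ContinuousOn q angleInt)
    (hr : ContinuousOn r angleInt) (hrq : ∀ x ∈ (angleInt : Set ℝ), r x ^ 2 = q x + c) {l : ℝ}
    {u₁ u₂ : Lp ℂ 2 angleMeasure}
    (hu₁ : u₁ ∈ opEigenspace (shiftedInverse (schrodingerResolvent hq hr) c) (l : ℂ))
    (hu₂ : u₂ ∈ opEigenspace (shiftedInverse (schrodingerResolvent hq hr) c) (l : ℂ))
    (h0 : u₁ ≠ 0) : ∃ k : ℂ, k • u₁ = u₂ := by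
  obtain ⟨v₁, rfl, hv₁⟩ := exists_weak_eigenfunction hq hr hrq hu₁
  obtain ⟨v₂, rfl, hv₂⟩ := exists_weak_eigenfunction hq hr hrq hu₂
  obtain ⟨P₁, hP₁, hU₁, hP₁'⟩ := exists_classical_solution hq
    fun g h1 h2 h3 => integral_deriv_smul_weak hq hv₁ h1 h2 h3
  obtain ⟨P₂, hP₂, hU₂, hP₂'⟩ := exists_classical_solution hq
    fun g h1 h2 h3 => integral_deriv_smul_weak hq hv₂ h1 h2 h3
  have hW := wronskian_eq_zero (by linarith [Real.pi_pos]) hU₁ hP₁' hU₂ hP₂'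
    (norm_primitive_sq_le v₁ (le_max_left _ (‖v₂‖ ^ 2)))
    (norm_primitive_sq_le v₂ (le_max_right (‖v₁‖ ^ 2) _))
    (integrableOn_sq_of_ae_eq hP₁) (integrableOn_sq_of_ae_eq hP₂)
  obtain ⟨x₀, hx₀, hne⟩ : ∃ x ∈ Ioo (-(Real.pi / 2)) (Real.pi / 2), primitive v₁ x ≠ 0 := by
    by_contra! h
    apply h0
    rw [Lp.eq_zero_iff_ae_eq_zero]
    filter_upwards [coeFn_volterra v₁, ae_angleMeasure_mem] with x hx hx'
    rw [hx, h x hx', Pi.zero_apply]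
  -- With this `k` the difference `u₂ - k u₁` vanishes at `x₀`, and the vanishing Wronskian makes
  -- its derivative vanish there too, so uniqueness for the initial value problem applies.
  set k := primitive v₂ x₀ / primitive v₁ x₀ with hk
  refine ⟨k, ?_⟩
  have hz := eq_zero_of_initial_data (Q := fun x => q x - l)
    (U := fun x => primitive v₂ x - k * primitive v₁ x) (P := fun x => P₂ x - k * P₁ x)
    (hq.sub continuousOn_const) (fun x hx => (hU₂ x hx).sub ((hU₁ x hx).const_mul k))
    (fun x hx => by
      convert! (hP₂' x hx).sub ((hP₁' x hx).const_mul k) using 1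
      ring) hx₀ (by rw [hk]; field_simp; ring)
    (by
      have := hW x₀ hx₀
      rw [hk]
      field_simp
      linear_combination this)
  apply Lp.ext
  filter_upwards [coeFn_volterra v₁, coeFn_volterra v₂, ae_angleMeasure_mem,
    Lp.coeFn_smul k (volterra v₁)] with x h1 h2 h3 h4
  rw [h4, Pi.smul_apply, h1, h2, smul_eq_mul]
  exact (sub_eq_zero.1 (hz x h3)).symm

lemma not_finiteDimensional_angle : ¬ FiniteDimensional ℂ (Lp ℂ 2 angleMeasure) := by
  intro hfin
  -- The arctangents of the integers cut the interval into infinitely many disjoint pieces of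
  -- positive length, whose indicators are orthogonal.
  let s : ℕ → Set ℝ := fun n => Ioc (Real.arctan n) (Real.arctan (n + 1))
  have hs : ∀ n, MeasurableSet (s n) := fun n => measurableSet_Ioc
  have hsub : ∀ n, s n ⊆ Ioo (-(Real.pi / 2)) (Real.pi / 2) := fun n x hx =>
    ⟨(Real.neg_pi_div_two_lt_arctan _).trans hx.1, hx.2.trans_lt (Real.arctan_lt_pi_div_two _)⟩
  have hpos : ∀ n, angleMeasure.real (s n) ≠ 0 := fun n => by
    rw [Measure.real, angleMeasure, Measure.restrict_apply (hs n), inter_eq_left.2 (hsub n),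
      Real.volume_Ioc, ENNReal.toReal_ofReal (sub_nonneg.2 (Real.arctan_mono (by linarith)))]
    exact (sub_pos.2 (Real.arctan_strictMono (by linarith))).ne'
  have hdisj : ∀ n m, n ≠ m → s n ∩ s m = ∅ := by
    intro n m hnm
    wlog h : n < m generalizing n m
    · rw [inter_comm]
      exact this m n hnm.symm (lt_of_le_of_ne (not_lt.1 h) hnm.symm)
    ext x
    simp only [mem_inter_iff, mem_empty_iff_false, iff_false, not_and]
    intro h1 h2
    have h3 : Real.arctan (n + 1) ≤ Real.arctan m := Real.arctan_mono (by exact_mod_cast h)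
    linarith [h1.2, h2.1]
  have hli : LinearIndependent ℂ
      fun n => indicatorConstLp 2 (hs n) (measure_ne_top angleMeasure (s n)) (1 : ℂ) := by
    refine linearIndependent_of_ne_zero_of_inner_eq_zero (fun n h => ?_) fun n m hnm => ?_
    · have := L2.inner_indicatorConstLp_one_indicatorConstLp_one (𝕜 := ℂ) (μ := angleMeasure)
        (hs n) (hs n)
      rw [h, inner_zero_left, inter_self] at this
      exact hpos n (Complex.ofReal_eq_zero.1 this.symm)
    · have := L2.inner_indicatorConstLp_one_indicatorConstLp_one (𝕜 := ℂ) (μ := angleMeasure)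
        (hs n) (hs m)
      rw [hdisj n m hnm] at this
      simpa using! this
  exact not_finite_iff_infinite.2 inferInstance (hli.finite)

/-- The Friedrichs extension of a Schrödinger operator whose potential is bounded below. -/
theorem exists_friedrichs_simpleSpectrum (hq : ContinuousOn q angleInt)
    (hb : ∃ m, ∀ x ∈ (angleInt : Set ℝ), m ≤ q x) :
    ∃ (K : Lp ℂ 2 angleMeasure →L[ℂ] Lp ℂ 2 angleMeasure) (c : ℝ), Function.Injective K ∧
      K.IsSymmetric ∧ schrodinger hq ≤ shiftedInverse K c ∧
      IsFriedrichsExtension (schrodinger hq) (shiftedInverse K c) ∧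
      ∃ lam : ℕ → ℝ, StrictMono lam ∧ Tendsto lam atTop atTop ∧
        HasSimpleSpectrum (shiftedInverse K c) lam := by
  obtain ⟨m, hm⟩ := hb
  -- The shift is `c = -m`, so that `q + c` is nonnegative and has a real continuous square root.
  set r : ℝ → ℝ := fun x => √(q x + -m) with hrdef
  have hr : ContinuousOn r angleInt := (hq.add continuousOn_const).sqrt
  have hrq : ∀ x ∈ (angleInt : Set ℝ), r x ^ 2 = q x + -m := fun x hx =>
    Real.sq_sqrt (by linarith [hm x hx])
  have hd := dense_domain_schrodinger hq
  have hJB := formPrimitive_formMap hq hr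
  have hB := inner_formMap hq hr hrq
  have hK : Function.Injective (schrodingerResolvent hq hr) := formResolvent_injective hd hJB hB
  refine ⟨schrodingerResolvent hq hr, -m, hK, isSymmetric_formResolvent,
    le_shiftedInverse_formResolvent hd hJB hB, isFriedrichsExtension_formResolvent hd hJB hB, ?_⟩
  exact exists_simpleSpectrum hK (isCompactOperator_formResolvent isCompactOperator_formPrimitive)
    isSymmetric_formResolvent formResolvent_nonneg not_finiteDimensional_angle
    fun l u v hu hv h0 => exists_smul_eq_of_mem_opEigenspace hq hr hrq hu hv h0

end SimpleEigenvalues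

/-! ### Asymptotics of the potential and comparison of the weights -/

section Potential

variable {N : ℝ} {ℓ₁ L₀ : ℝ → ℝ}

lemma hasDerivAt_Mfun (h : AnalyticOnNhd ℝ ℓ₁ (Icc 0 1)) {x : ℝ} (hx : x ∈ Ioo (0 : ℝ) 1) :
    HasDerivAt (Mfun ℓ₁) (-ℓ₁ x * Mfun ℓ₁ x) x := by
  have hc : ContinuousOn ℓ₁ (Icc 0 1) := h.continuousOn
  have hd : HasDerivAt (fun u => ∫ t in (0 : ℝ)..u, ℓ₁ t) (ℓ₁ x) x := by
    refine intervalIntegral.integral_hasDerivAt_right ?_ ?_ ?_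
    · refine (hc.mono ?_).intervalIntegrable
      rw [uIcc_of_le hx.1.le]
      exact Icc_subset_Icc_right hx.2.le
    · exact (hc.mono Ioo_subset_Icc_self).stronglyMeasurableAtFilter isOpen_Ioo x hx
    · exact (h x (Ioo_subset_Icc_self hx)).continuousAt
  convert! hd.neg.exp using 1
  rw [Mfun]
  simp only [Pi.neg_apply]
  ring

lemma hasDerivAt_rpow_mul_rpow_mul_Mfun (h : AnalyticOnNhd ℝ ℓ₁ (Icc 0 1)) (r s : ℝ) {x : ℝ}
    (hx : x ∈ Ioo (0 : ℝ) 1) :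
    HasDerivAt (fun x => x ^ r * (1 - x) ^ s * Mfun ℓ₁ x)
      ((r / x - s / (1 - x) - ℓ₁ x) * (x ^ r * (1 - x) ^ s * Mfun ℓ₁ x)) x := by
  have h1 : 0 < 1 - x := sub_pos.2 hx.2
  have e1 := Real.hasDerivAt_rpow_const (x := x) (p := r) (Or.inl hx.1.ne')
  have e2 := ((hasDerivAt_id x).const_sub 1).rpow_const (p := s) (Or.inl h1.ne')
  convert! (e1.mul e2).mul (hasDerivAt_Mfun h hx) using 1
  simp only [Pi.mul_apply, id]
  rw [Real.rpow_sub_one hx.1.ne', Real.rpow_sub_one h1.ne']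
  have h2 := hx.1.ne'
  field_simp
  ring

lemma logDa_eq (h : AnalyticOnNhd ℝ ℓ₁ (Icc 0 1)) {x : ℝ} (hx : x ∈ Ioo (0 : ℝ) 1) :
    logDa N ℓ₁ x = 5 / 2 / x - N / 2 / (1 - x) - ℓ₁ x := by
  have hd : deriv (afun N ℓ₁) x = _ := (hasDerivAt_rpow_mul_rpow_mul_Mfun h (5 / 2) (N / 2) hx).deriv
  rw [logDa, hd]
  exact mul_div_cancel_right₀ _ (prod_pos _ _ hx).ne'

lemma logDb_eq (h : AnalyticOnNhd ℝ ℓ₁ (Icc 0 1)) {x : ℝ} (hx : x ∈ Ioo (0 : ℝ) 1) :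
    logDb N ℓ₁ x = 3 / 2 / x - (N / 2 - 1) / (1 - x) - ℓ₁ x := by
  have hd : deriv (bfun N ℓ₁) x = _ :=
    (hasDerivAt_rpow_mul_rpow_mul_Mfun h (3 / 2) (N / 2 - 1) hx).deriv
  rw [logDb, hd]
  exact mul_div_cancel_right₀ _ (prod_pos _ _ hx).ne'

lemma hasDerivAt_logDa_add_logDb (h : AnalyticOnNhd ℝ ℓ₁ (Icc 0 1)) {x : ℝ}
    (hx : x ∈ Ioo (0 : ℝ) 1) :
    HasDerivAt (fun t => logDa N ℓ₁ t + logDb N ℓ₁ t)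
      (-4 / x ^ 2 - (N - 1) / (1 - x) ^ 2 - 2 * deriv ℓ₁ x) x := by
  have h1 : 0 < 1 - x := sub_pos.2 hx.2
  have e1 : HasDerivAt (fun t : ℝ => 4 / t - (N - 1) / (1 - t) - 2 * ℓ₁ t)
      (-4 / x ^ 2 - (N - 1) / (1 - x) ^ 2 - 2 * deriv ℓ₁ x) x := by
    have d1 := (hasDerivAt_id x).fun_inv hx.1.ne'
    have d2 := ((hasDerivAt_id x).const_sub 1).fun_inv h1.ne'
    have d3 := (h x (Ioo_subset_Icc_self hx)).differentiableAt.hasDerivAt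
    convert! ((d1.const_mul 4).sub (d2.const_mul (N - 1))).sub (d3.const_mul 2) using 1
    simp only [id]
    ring
  refine e1.congr_of_eventuallyEq ?_
  filter_upwards [isOpen_Ioo.mem_nhds hx] with t ht
  rw [logDa_eq h ht, logDb_eq h ht]
  ring

lemma afun_eq {x : ℝ} (hx : x ∈ Ioo (0 : ℝ) 1) : afun N ℓ₁ x = x * (1 - x) * bfun N ℓ₁ x := by
  have h1 : 0 < 1 - x := sub_pos.2 hx.2
  rw [afun, bfun, show (5 / 2 : ℝ) = 3 / 2 + 1 by norm_num, Real.rpow_add_one hx.1.ne',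
    Real.rpow_sub_one h1.ne']
  field_simp

lemma bfun_pos {x : ℝ} (hx : x ∈ Ioo (0 : ℝ) 1) : 0 < bfun N ℓ₁ x := prod_pos _ _ hx

lemma afun_div_bfun {x : ℝ} (hx : x ∈ Ioo (0 : ℝ) 1) :
    afun N ℓ₁ x / bfun N ℓ₁ x = x * (1 - x) := by
  rw [afun_eq hx]
  exact mul_div_cancel_right₀ _ (bfun_pos hx).ne'

lemma tendsto_mul_potX_zero (h : AnalyticOnNhd ℝ ℓ₁ (Icc 0 1))
    (hL : AnalyticOnNhd ℝ L₀ (Icc 0 1)) :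
    Tendsto (fun x => x * potX N ℓ₁ L₀ x) (𝓝[>] 0) (𝓝 (1 / 2)) := by
  have h0 : (0 : ℝ) ∈ Icc (0 : ℝ) 1 := by simp
  have c1 : ContinuousAt ℓ₁ 0 := (h 0 h0).continuousAt
  have c2 : ContinuousAt (deriv ℓ₁) 0 := (h 0 h0).deriv.continuousAt
  have c3 : ContinuousAt L₀ 0 := (hL 0 h0).continuousAt
  have c4 : ContinuousAt (fun x : ℝ => (1 - x)⁻¹) 0 :=
    (continuousAt_const.sub continuousAt_id).inv₀ (by simp)
  -- `F` is `x * potX` with the poles at `0` cancelled, hence continuous there. Its value is `(-4 -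
  -- 4 + 10) / 4 = 1/2`, from the leading terms `5/(2x)` of `a'/a` and `4/x` of `a'/a + b'/b`.
  set F : ℝ → ℝ := fun x => x * L₀ x + (1 - x) / 4 *
    ((-4 - (N - 1) * (x * (1 - x)⁻¹) ^ 2 - 2 * x ^ 2 * deriv ℓ₁ x)
      - 1 / 4 * (4 - (N - 1) * (x * (1 - x)⁻¹) - 2 * x * ℓ₁ x) ^ 2
      + (5 / 2 - N / 2 * (x * (1 - x)⁻¹) - x * ℓ₁ x) *
        (4 - (N - 1) * (x * (1 - x)⁻¹) - 2 * x * ℓ₁ x)) with hF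
  have hFc : ContinuousAt F 0 := by fun_prop
  have hF0 : F 0 = 1 / 2 := by simp only [hF]; norm_num
  have ht := hFc.tendsto.mono_left (nhdsWithin_le_nhds (s := Ioi 0))
  rw [hF0] at ht
  refine ht.congr' ?_
  filter_upwards [Ioo_mem_nhdsGT (zero_lt_one (α := ℝ))] with x hx
  have h1 : 1 - x ≠ 0 := (sub_pos.2 hx.2).ne'
  have h2 : x ≠ 0 := hx.1.ne'
  rw [potX, (hasDerivAt_logDa_add_logDb h hx).deriv, afun_div_bfun hx, logDa_eq h hx,
    logDb_eq h hx, hF]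
  field_simp
  ring

lemma tendsto_mul_potX_one (h : AnalyticOnNhd ℝ ℓ₁ (Icc 0 1))
    (hL : AnalyticOnNhd ℝ L₀ (Icc 0 1)) :
    Tendsto (fun x => (1 - x) * potX N ℓ₁ L₀ x) (𝓝[<] 1) (𝓝 ((N - 1) * (N - 3) / 16)) := by
  have h0 : (1 : ℝ) ∈ Icc (0 : ℝ) 1 := by simp
  have c1 : ContinuousAt ℓ₁ 1 := (h 1 h0).continuousAt
  have c2 : ContinuousAt (deriv ℓ₁) 1 := (h 1 h0).deriv.continuousAt
  have c3 : ContinuousAt L₀ 1 := (hL 1 h0).continuousAt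
  have c4 : ContinuousAt (fun x : ℝ => x⁻¹) 1 := continuousAt_id.inv₀ (by simp)
  -- The factor `1 - x` cancels the poles at `1`; the value there is `(-(N-1) - (N-1)²/4 + N(N-1)/2)
  -- / 4`.
  set F : ℝ → ℝ := fun x => (1 - x) * L₀ x + x / 4 *
    ((-4 * ((1 - x) * x⁻¹) ^ 2 - (N - 1) - 2 * (1 - x) ^ 2 * deriv ℓ₁ x)
      - 1 / 4 * (4 * ((1 - x) * x⁻¹) - (N - 1) - 2 * (1 - x) * ℓ₁ x) ^ 2
      + (5 / 2 * ((1 - x) * x⁻¹) - N / 2 - (1 - x) * ℓ₁ x) *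
        (4 * ((1 - x) * x⁻¹) - (N - 1) - 2 * (1 - x) * ℓ₁ x)) with hF
  have hFc : ContinuousAt F 1 := by fun_prop
  have hF0 : F 1 = (N - 1) * (N - 3) / 16 := by simp only [hF]; norm_num; ring
  have ht := hFc.tendsto.mono_left (nhdsWithin_le_nhds (s := Iio 1))
  rw [hF0] at ht
  refine ht.congr' ?_
  filter_upwards [Ioo_mem_nhdsLT (zero_lt_one (α := ℝ))] with x hx
  have h1 : 1 - x ≠ 0 := (sub_pos.2 hx.2).ne'
  have h2 : x ≠ 0 := hx.1.ne'
  rw [potX, (hasDerivAt_logDa_add_logDb h hx).deriv, afun_div_bfun hx, logDa_eq h hx,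
    logDb_eq h hx, hF]
  field_simp
  ring

/-- The substitution `x = (1 + sin ξ) / 2`. -/
noncomputable def angleToUnit (ξ : ℝ) : ℝ := (1 + Real.sin ξ) / 2

/-- Here `x = sin² ((ξ + π/2)/2)`. Writing the sine as `t * sinc t` exhibits the quadratic vanishing
at `-π/2` with a factor continuous up to that point. -/
lemma angleToUnit_eq (ξ : ℝ) :
    angleToUnit ξ = ((ξ + Real.pi / 2) / 2 * Real.sinc ((ξ + Real.pi / 2) / 2)) ^ 2 := by
  have h1 : ∀ t, t * Real.sinc t = Real.sin t := fun t => by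
    by_cases ht : t = 0
    · simp [ht]
    · rw [Real.sinc_of_ne_zero ht]; field_simp
  rw [h1, Real.sin_sq_eq_half_sub, mul_div_cancel₀ _ two_ne_zero, Real.cos_add_pi_div_two,
    angleToUnit]
  ring

lemma one_sub_angleToUnit_eq (ξ : ℝ) :
    1 - angleToUnit ξ = ((Real.pi / 2 - ξ) / 2 * Real.sinc ((Real.pi / 2 - ξ) / 2)) ^ 2 := by
  have := angleToUnit_eq (-ξ)
  rw [neg_add_eq_sub] at this
  rw [← this, angleToUnit, angleToUnit, Real.sin_neg]
  ring

lemma angleToUnit_mem {ξ : ℝ} (hξ : ξ ∈ Ioo (-(Real.pi / 2)) (Real.pi / 2)) :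
    angleToUnit ξ ∈ Ioo (0 : ℝ) 1 := by
  have h1 : -1 < Real.sin ξ := by
    rw [← Real.sin_pi_div_two, ← Real.sin_neg]
    exact Real.sin_lt_sin_of_lt_of_le_pi_div_two (by linarith) hξ.2.le (by linarith [hξ.1])
  have h2 : Real.sin ξ < 1 := by
    rw [← Real.sin_pi_div_two]
    exact Real.sin_lt_sin_of_lt_of_le_pi_div_two hξ.1.le le_rfl hξ.2
  unfold angleToUnit
  constructor <;> linarith

lemma continuous_angleToUnit : Continuous angleToUnit := by
  unfold angleToUnit
  fun_prop

lemma tendsto_angleToUnit_left :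
    Tendsto angleToUnit (𝓝[>] (-(Real.pi / 2))) (𝓝[>] 0) := by
  refine tendsto_nhdsWithin_iff.2 ⟨?_, ?_⟩
  · have := (continuous_angleToUnit.tendsto (-(Real.pi / 2))).mono_left
      (nhdsWithin_le_nhds (s := Ioi (-(Real.pi / 2))))
    simpa [angleToUnit] using this
  · filter_upwards [Ioo_mem_nhdsGT (show -(Real.pi / 2) < Real.pi / 2 by linarith [Real.pi_pos])]
      with ξ hξ using (angleToUnit_mem hξ).1

lemma tendsto_angleToUnit_right :
    Tendsto angleToUnit (𝓝[<] (Real.pi / 2)) (𝓝[<] 1) := by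
  refine tendsto_nhdsWithin_iff.2 ⟨?_, ?_⟩
  · have := (continuous_angleToUnit.tendsto (Real.pi / 2)).mono_left
      (nhdsWithin_le_nhds (s := Iio (Real.pi / 2)))
    simpa [angleToUnit] using this
  · filter_upwards [Ioo_mem_nhdsLT (show -(Real.pi / 2) < Real.pi / 2 by linarith [Real.pi_pos])]
      with ξ hξ using (angleToUnit_mem hξ).2

/-- The product is `x * potX x` times `4 / sinc²`, and the two factors tend to `1/2` and `4`. -/
lemma tendsto_potential_mul_left (h : AnalyticOnNhd ℝ ℓ₁ (Icc 0 1))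
    (hL : AnalyticOnNhd ℝ L₀ (Icc 0 1)) :
    Tendsto (fun ξ => potential N ℓ₁ L₀ ξ * (ξ + Real.pi / 2) ^ 2) (𝓝[>] (-(Real.pi / 2)))
      (𝓝 2) := by
  have h1 := (tendsto_mul_potX_zero (N := N) h hL).comp tendsto_angleToUnit_left
  have h2 : Tendsto (fun ξ => 4 / Real.sinc ((ξ + Real.pi / 2) / 2) ^ 2) (𝓝[>] (-(Real.pi / 2)))
      (𝓝 4) := by
    have hc : Continuous fun ξ : ℝ => Real.sinc ((ξ + Real.pi / 2) / 2) := by fun_prop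
    have := (hc.tendsto (-(Real.pi / 2))).mono_left
      (nhdsWithin_le_nhds (s := Ioi (-(Real.pi / 2))))
    rw [neg_add_cancel, zero_div, Real.sinc_zero] at this
    have := (tendsto_const_nhds (x := (4 : ℝ))).div (this.pow 2) (by norm_num)
    rwa [one_pow, div_one] at this
  have h3 := h1.mul h2
  rw [show (1 / 2 : ℝ) * 4 = 2 by norm_num] at h3
  refine h3.congr' ?_
  filter_upwards [Ioo_mem_nhdsGT (show -(Real.pi / 2) < Real.pi / 2 by linarith [Real.pi_pos])]
    with ξ hξ
  have hX := (angleToUnit_mem hξ).1.ne'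
  have hne : Real.sinc ((ξ + Real.pi / 2) / 2) ≠ 0 := by
    intro h0
    rw [angleToUnit_eq, h0] at hX
    simp at hX
  simp only [Function.comp_apply]
  change _ = potX N ℓ₁ L₀ (angleToUnit ξ) * _
  nth_rewrite 1 [angleToUnit_eq]
  generalize Real.sinc ((ξ + Real.pi / 2) / 2) = s at hne
  field_simp
  norm_num
  ring

lemma tendsto_potential_mul_right (h : AnalyticOnNhd ℝ ℓ₁ (Icc 0 1))
    (hL : AnalyticOnNhd ℝ L₀ (Icc 0 1)) :
    Tendsto (fun ξ => potential N ℓ₁ L₀ ξ * (Real.pi / 2 - ξ) ^ 2) (𝓝[<] (Real.pi / 2))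
      (𝓝 ((N - 1) * (N - 3) / 4)) := by
  have h1 := (tendsto_mul_potX_one (N := N) h hL).comp tendsto_angleToUnit_right
  have h2 : Tendsto (fun ξ => 4 / Real.sinc ((Real.pi / 2 - ξ) / 2) ^ 2) (𝓝[<] (Real.pi / 2))
      (𝓝 4) := by
    have hc : Continuous fun ξ : ℝ => Real.sinc ((Real.pi / 2 - ξ) / 2) := by fun_prop
    have := (hc.tendsto (Real.pi / 2)).mono_left
      (nhdsWithin_le_nhds (s := Iio (Real.pi / 2)))
    rw [sub_self, zero_div, Real.sinc_zero] at this
    have := (tendsto_const_nhds (x := (4 : ℝ))).div (this.pow 2) (by norm_num)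
    rwa [one_pow, div_one] at this
  have h3 := h1.mul h2
  rw [show (N - 1) * (N - 3) / 16 * 4 = (N - 1) * (N - 3) / 4 by ring] at h3
  refine h3.congr' ?_
  filter_upwards [Ioo_mem_nhdsLT (show -(Real.pi / 2) < Real.pi / 2 by linarith [Real.pi_pos])]
    with ξ hξ
  have hX := (sub_pos.2 (angleToUnit_mem hξ).2).ne'
  have hne : Real.sinc ((Real.pi / 2 - ξ) / 2) ≠ 0 := by
    intro h0
    rw [one_sub_angleToUnit_eq, h0] at hX
    simp at hX
  simp only [Function.comp_apply]
  change _ = potX N ℓ₁ L₀ (angleToUnit ξ) * _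
  nth_rewrite 1 [one_sub_angleToUnit_eq]
  generalize Real.sinc ((Real.pi / 2 - ξ) / 2) = s at hne
  field_simp
  norm_num
  ring

theorem potential_isEquivalent_left (h : AnalyticOnNhd ℝ ℓ₁ (Icc 0 1))
    (hL : AnalyticOnNhd ℝ L₀ (Icc 0 1)) :
    potential N ℓ₁ L₀ ~[𝓝[>] (-(Real.pi / 2))] fun ξ => 2 / (ξ + Real.pi / 2) ^ 2 := by
  have hpos : ∀ᶠ ξ in 𝓝[>] (-(Real.pi / 2)), 0 < ξ + Real.pi / 2 := by
    filter_upwards [self_mem_nhdsWithin] with ξ (hξ : -(Real.pi / 2) < ξ)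
    linarith
  rw [isEquivalent_iff_tendsto_one (hpos.mono fun ξ hξ => by positivity)]
  have := (tendsto_potential_mul_left (N := N) h hL).div_const 2
  rw [div_self two_ne_zero] at this
  refine this.congr fun ξ => ?_
  simp only [Pi.div_apply]
  exact (div_div_eq_mul_div _ _ _).symm

theorem potential_isEquivalent_right (hN : 4 < N) (h : AnalyticOnNhd ℝ ℓ₁ (Icc 0 1))
    (hL : AnalyticOnNhd ℝ L₀ (Icc 0 1)) :
    potential N ℓ₁ L₀ ~[𝓝[<] (Real.pi / 2)]
      fun ξ => (N - 1) * (N - 3) / 4 / (Real.pi / 2 - ξ) ^ 2 := by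
  have hC : 0 < (N - 1) * (N - 3) / 4 :=
    div_pos (mul_pos (by linarith) (by linarith)) (by norm_num)
  have hpos : ∀ᶠ ξ in 𝓝[<] (Real.pi / 2), 0 < Real.pi / 2 - ξ := by
    filter_upwards [self_mem_nhdsWithin] with ξ (hξ : ξ < Real.pi / 2)
    linarith
  rw [isEquivalent_iff_tendsto_one (hpos.mono fun ξ hξ => by positivity)]
  have := (tendsto_potential_mul_right (N := N) h hL).div_const ((N - 1) * (N - 3) / 4)
  rw [div_self hC.ne'] at this
  refine this.congr fun ξ => ?_
  simp only [Pi.div_apply]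
  exact (div_div_eq_mul_div _ _ _).symm

/-- Both endpoint limits are positive, the right one because `N > 4`. So `q` is positive near the
ends, and it is continuous on the compact interval left between them. -/
lemma potential_bounded_below (hN : 4 < N) (h : AnalyticOnNhd ℝ ℓ₁ (Icc 0 1))
    (hL : AnalyticOnNhd ℝ L₀ (Icc 0 1)) :
    ∃ m, ∀ ξ ∈ (angleInt : Set ℝ), m ≤ potential N ℓ₁ L₀ ξ := by
  have hC : 0 < (N - 1) * (N - 3) / 4 :=
    div_pos (mul_pos (by linarith) (by linarith)) (by norm_num)
  have e1 := (tendsto_potential_mul_left (N := N) h hL).eventually_const_lt (show (0 : ℝ) < 2 by norm_num)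
  have e2 := (tendsto_potential_mul_right (N := N) h hL).eventually_const_lt hC
  obtain ⟨a', ha, ha'⟩ := (mem_nhdsGT_iff_exists_Ioo_subset).1 e1
  obtain ⟨b', hb, hb'⟩ := (mem_nhdsLT_iff_exists_Ioo_subset).1 e2
  have hsub : Icc a' b' ⊆ (angleInt : Set ℝ) := fun x hx =>
    ⟨lt_of_lt_of_le ha hx.1, lt_of_le_of_lt hx.2 hb⟩
  obtain ⟨C, hC'⟩ := isCompact_Icc.exists_bound_of_continuousOn
    ((continuousOn_potential N h hL).mono hsub)
  refine ⟨min 0 (-C), fun ξ hξ => ?_⟩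
  have hξ' : ξ ∈ Ioo (-(Real.pi / 2)) (Real.pi / 2) := hξ
  by_cases h1 : ξ < a'
  · have h2 : 0 < potential N ℓ₁ L₀ ξ * (ξ + Real.pi / 2) ^ 2 := ha' ⟨hξ'.1, h1⟩
    exact (min_le_left _ _).trans (pos_of_mul_pos_left h2 (sq_nonneg _)).le
  by_cases h3 : b' < ξ
  · have h2 : 0 < potential N ℓ₁ L₀ ξ * (Real.pi / 2 - ξ) ^ 2 := hb' ⟨h3, hξ'.2⟩
    exact (min_le_left _ _).trans (pos_of_mul_pos_left h2 (sq_nonneg _)).le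
  · exact (min_le_right _ _).trans (neg_le_of_abs_le (hC' ξ ⟨not_lt.1 h1, not_lt.1 h3⟩))

/-- If `D` bounds `|ℓ₁|` on `[0, 1]`, then `exp (-D) ≤ M ≤ exp D`, so `C = exp D` serves for both
inequalities. Domination of each measure by a multiple of the other gives the same `L²` with
equivalent norms. -/
theorem weightMeasure_equivalent (N : ℝ) (h : AnalyticOnNhd ℝ ℓ₁ (Icc 0 1)) :
    ∃ C : ℝ, weightMeasure N ℓ₁ ≤ ENNReal.ofReal C • plainMeasure N ∧
      plainMeasure N ≤ ENNReal.ofReal C • weightMeasure N ℓ₁ := by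
  have hc : ContinuousOn ℓ₁ (Icc 0 1) := h.continuousOn
  obtain ⟨D, hD⟩ := isCompact_Icc.exists_bound_of_continuousOn hc
  have hint : ∀ x ∈ Ioo (0 : ℝ) 1, |∫ t in (0 : ℝ)..x, ℓ₁ t| ≤ D := by
    intro x hx
    have := intervalIntegral.norm_integral_le_of_norm_le_const (a := 0) (b := x) (f := ℓ₁) (C := D)
      fun t ht => hD t (by
        rw [uIoc_of_le hx.1.le] at ht
        exact ⟨ht.1.le, ht.2.trans hx.2.le⟩)
    rw [Real.norm_eq_abs, sub_zero, abs_of_pos hx.1] at this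
    have hD0 : 0 ≤ D := (norm_nonneg _).trans (hD 0 (by simp))
    exact this.trans (mul_le_of_le_one_right hD0 hx.2.le)
  have hρ : ∀ x ∈ Ioo (0 : ℝ) 1, 0 ≤ x ^ (3 / 2 : ℝ) * (1 - x) ^ (N / 2 - 1) := fun x hx =>
    mul_nonneg (Real.rpow_nonneg hx.1.le _) (Real.rpow_nonneg (sub_pos.2 hx.2).le _)
  refine ⟨Real.exp D, ?_, ?_⟩
  · rw [plainMeasure, ← withDensity_smul' _ _ ENNReal.ofReal_ne_top, weightMeasure]
    refine withDensity_mono ((ae_restrict_iff' measurableSet_Ioo).2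
      (Eventually.of_forall fun x hx => ?_))
    rw [Pi.smul_apply, smul_eq_mul, ← ENNReal.ofReal_mul (Real.exp_pos _).le]
    refine ENNReal.ofReal_le_ofReal ?_
    rw [bfun, mul_comm]
    refine mul_le_mul_of_nonneg_right (Real.exp_le_exp.2 ?_) (hρ x hx)
    exact (neg_le_abs _).trans (hint x hx)
  · rw [weightMeasure, ← withDensity_smul' _ _ ENNReal.ofReal_ne_top, plainMeasure]
    refine withDensity_mono ((ae_restrict_iff' measurableSet_Ioo).2
      (Eventually.of_forall fun x hx => ?_))
    rw [Pi.smul_apply, smul_eq_mul, ← ENNReal.ofReal_mul (Real.exp_pos _).le]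
    refine ENNReal.ofReal_le_ofReal ?_
    rw [bfun, mul_left_comm]
    refine le_mul_of_one_le_right (hρ x hx) ?_
    rw [Mfun, ← Real.exp_add]
    refine Real.one_le_exp ?_
    linarith [le_abs_self (∫ t in (0 : ℝ)..x, ℓ₁ t), hint x hx]

end Potential

/-! ### Change of variables in spaces of test functions -/

section TestFunctions

variable {Ω Ω' : TopologicalSpace.Opens ℝ}

/-- A function that is smooth on `Ω` and vanishes off a compact subset of `Ω` is a test function. -/
noncomputable def testOfContDiffOn (f : ℝ → ℂ) (hf : ContDiffOn ℝ (⊤ : ℕ∞) f Ω) {K : Set ℝ}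
    (hK : IsCompact K) (hKΩ : K ⊆ Ω) (h0 : ∀ x, x ∉ K → f x = 0) : 𝓓(Ω, ℂ) where
  toFun := f
  contDiff' := by
    refine contDiff_iff_contDiffAt.2 fun x => ?_
    by_cases hx : x ∈ K
    · exact hf.contDiffAt (Ω.isOpen.mem_nhds (hKΩ hx))
    · refine (contDiffAt_const (c := (0 : ℂ))).congr_of_eventuallyEq ?_
      filter_upwards [hK.isClosed.isOpen_compl.mem_nhds hx] with y hy using h0 y hy
  hasCompactSupport' := HasCompactSupport.intro hK h0
  tsupport_subset' := (closure_minimal (fun x hx => by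
    by_contra h
    exact hx (h0 x h)) hK.isClosed).trans hKΩ

lemma testOfContDiffOn_apply (f : ℝ → ℂ) (hf : ContDiffOn ℝ (⊤ : ℕ∞) f Ω) {K : Set ℝ}
    (hK : IsCompact K) (hKΩ : K ⊆ Ω) (h0 : ∀ x, x ∉ K → f x = 0) (x : ℝ) :
    testOfContDiffOn f hf hK hKΩ h0 x = f x := rfl

/-- The test function `w · (φ ∘ X)` obtained from `φ` by a smooth substitution `X : Ω' → Ω` with
continuous left inverse `Y` and a smooth factor `w`. -/
noncomputable def weightedPullback {w X Y : ℝ → ℝ} (hw : ContDiffOn ℝ (⊤ : ℕ∞) w Ω')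
    (hX : ContDiffOn ℝ (⊤ : ℕ∞) X Ω') (hY : ContinuousOn Y Ω)
    (hYm : MapsTo Y Ω Ω') (hYX : ∀ t ∈ Ω', Y (X t) = t) (φ : 𝓓(Ω, ℂ)) : 𝓓(Ω', ℂ) :=
  -- `X` is controlled only on `Ω'` (the sine substitution, for instance, is periodic), so the
  -- pullback is cut off outside it. Inside, its support is in the compact image of `tsupport φ`
  -- under `Y`.
  testOfContDiffOn ((Ω' : Set ℝ).indicator fun t => (w t : ℂ) * φ (X t))
    (ContDiffOn.congr (f := fun t => (w t : ℂ) * φ (X t))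
      ((Complex.ofRealCLM.contDiff.comp_contDiffOn hw).mul (φ.contDiff.comp_contDiffOn hX))
      fun _ ht => indicator_of_mem ht _)
    (K := Y '' tsupport φ)
    (φ.hasCompactSupport.isCompact.image_of_continuousOn (hY.mono φ.tsupport_subset))
    ((image_mono φ.tsupport_subset).trans hYm.image_subset)
    (fun t ht => by
      by_cases htΩ : t ∈ (Ω' : Set ℝ)
      · have : X t ∉ tsupport φ := fun h => ht ⟨X t, h, hYX t htΩ⟩
        rw [indicator_of_mem htΩ, image_eq_zero_of_notMem_tsupport this, mul_zero]
      · exact indicator_of_notMem htΩ _)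

lemma weightedPullback_apply {w X Y : ℝ → ℝ} (hw : ContDiffOn ℝ (⊤ : ℕ∞) w Ω')
    (hX : ContDiffOn ℝ (⊤ : ℕ∞) X Ω') (hY : ContinuousOn Y Ω)
    (hYm : MapsTo Y Ω Ω') (hYX : ∀ t ∈ Ω', Y (X t) = t) (φ : 𝓓(Ω, ℂ)) {t : ℝ} (ht : t ∈ Ω') :
    weightedPullback hw hX hY hYm hYX φ t = (w t : ℂ) * φ (X t) := by
  rw [weightedPullback, testOfContDiffOn_apply]
  exact indicator_of_mem ht _

lemma testFunction_ext {φ ψ : 𝓓(Ω, ℂ)} (h : ∀ x ∈ Ω, φ x = ψ x) : φ = ψ := by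
  ext x
  by_cases hx : x ∈ Ω
  · exact h x hx
  · rw [testFunction_eq_zero φ hx, testFunction_eq_zero ψ hx]

/-- The linear equivalence of spaces of test functions given by a change of variables and
multiplication by a nonvanishing factor. -/
noncomputable def weightedPullbackEquiv {w X Y : ℝ → ℝ} (hw : ContDiffOn ℝ (⊤ : ℕ∞) w Ω)
    (hw0 : ∀ x ∈ Ω, w x ≠ 0)
    (hX : ContDiffOn ℝ (⊤ : ℕ∞) X Ω') (hXm : MapsTo X Ω' Ω) (hY : ContDiffOn ℝ (⊤ : ℕ∞) Y Ω)
    (hYm : MapsTo Y Ω Ω') (hYX : ∀ t ∈ Ω', Y (X t) = t) (hXY : ∀ x ∈ Ω, X (Y x) = x) :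
    𝓓(Ω, ℂ) ≃ₗ[ℂ] 𝓓(Ω', ℂ) where
  toFun := weightedPullback (hw.comp hX hXm) hX hY.continuousOn hYm hYX
  invFun := weightedPullback (hw.inv hw0) hY hX.continuousOn hXm hXY
  map_add' φ ψ := testFunction_ext fun t ht => by
    change _ = weightedPullback _ _ _ _ _ φ t + weightedPullback _ _ _ _ _ ψ t
    rw [weightedPullback_apply _ _ _ _ _ _ ht, weightedPullback_apply _ _ _ _ _ _ ht,
      weightedPullback_apply _ _ _ _ _ _ ht, ← mul_add]
    rfl
  map_smul' c φ := testFunction_ext fun t ht => by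
    change _ = c • weightedPullback _ _ _ _ _ φ t
    rw [weightedPullback_apply _ _ _ _ _ _ ht, weightedPullback_apply _ _ _ _ _ _ ht,
      ← mul_smul_comm]
    rfl
  left_inv φ := testFunction_ext fun x hx => by
    rw [weightedPullback_apply _ _ _ _ _ _ hx, weightedPullback_apply _ _ _ _ _ _ (hYm hx),
      Function.comp_apply, hXY x hx, ← mul_assoc, Pi.inv_apply, ← Complex.ofReal_mul,
      inv_mul_cancel₀ (hw0 x hx), Complex.ofReal_one, one_mul]
  right_inv φ := testFunction_ext fun t ht => by
    rw [weightedPullback_apply _ _ _ _ _ _ ht, weightedPullback_apply _ _ _ _ _ _ (hXm ht),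
      Function.comp_apply, hYX t ht, ← mul_assoc, Pi.inv_apply, ← Complex.ofReal_mul,
      mul_inv_cancel₀ (hw0 _ (hXm ht)), Complex.ofReal_one, one_mul]

lemma weightedPullbackEquiv_apply {w X Y : ℝ → ℝ} (hw : ContDiffOn ℝ (⊤ : ℕ∞) w Ω)
    (hw0 : ∀ x ∈ Ω, w x ≠ 0)
    (hX : ContDiffOn ℝ (⊤ : ℕ∞) X Ω') (hXm : MapsTo X Ω' Ω) (hY : ContDiffOn ℝ (⊤ : ℕ∞) Y Ω)
    (hYm : MapsTo Y Ω Ω') (hYX : ∀ t ∈ Ω', Y (X t) = t) (hXY : ∀ x ∈ Ω, X (Y x) = x)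
    (φ : 𝓓(Ω, ℂ)) {t : ℝ} (ht : t ∈ Ω') :
    weightedPullbackEquiv hw hw0 hX hXm hY hYm hYX hXY φ t = (w (X t) : ℂ) * φ (X t) :=
  weightedPullback_apply (hw.comp hX hXm) hX hY.continuousOn hYm hYX φ ht

/-- A differential expression with smooth coefficients maps test functions to test functions. -/
noncomputable def diffTest {p₂ p₁ p₀ : ℝ → ℝ} (h₂ : ContDiffOn ℝ (⊤ : ℕ∞) p₂ Ω)
    (h₁ : ContDiffOn ℝ (⊤ : ℕ∞) p₁ Ω) (h₀ : ContDiffOn ℝ (⊤ : ℕ∞) p₀ Ω) (φ : 𝓓(Ω, ℂ)) :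
    𝓓(Ω, ℂ) :=
  testOfContDiffOn (diffExpr p₂ p₁ p₀ φ)
    (by
      have e : ∀ {p : ℝ → ℝ}, ContDiffOn ℝ (⊤ : ℕ∞) p Ω →
          ContDiffOn ℝ (⊤ : ℕ∞) (fun x => (p x : ℂ)) Ω :=
        fun hp => Complex.ofRealCLM.contDiff.comp_contDiffOn hp
      have d0 : ContDiff ℝ (⊤ : ℕ∞) φ := φ.contDiff
      have d1 : ContDiff ℝ (⊤ : ℕ∞) (deriv φ) := (contDiff_infty_iff_deriv.1 d0).2
      have d2 : ContDiff ℝ (⊤ : ℕ∞) (deriv (deriv φ)) := (contDiff_infty_iff_deriv.1 d1).2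
      exact (((e h₂).mul d2.contDiffOn).add ((e h₁).mul d1.contDiffOn)).add
        ((e h₀).mul d0.contDiffOn))
    φ.hasCompactSupport.isCompact φ.tsupport_subset (fun _ hx => diffExpr_eq_zero _ _ _ _ hx)

lemma norm_testToL2 {μ : Measure ℝ} (hμ : AdmissibleMeasure Ω μ) (φ : 𝓓(Ω, ℂ)) :
    ‖testToL2 hμ φ‖ = ((∫⁻ x, ‖φ x‖ₑ ^ (2 : ℝ) ∂μ) ^ (1 / (2 : ℝ))).toReal := by
  change ‖(memLp_testFunction hμ φ).toLp φ‖ = _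
  rw [Lp.norm_toLp, eLpNorm_eq_lintegral_rpow_enorm_toReal two_ne_zero ENNReal.ofNat_ne_top]
  rfl

end TestFunctions

/-! ### The substitution `x = (1 + sin ξ) / 2` -/

section Substitution

lemma contDiff_angleToUnit {n : WithTop ℕ∞} : ContDiff ℝ n angleToUnit := by
  unfold angleToUnit
  exact (contDiff_const.add Real.contDiff_sin).div_const _

lemma hasDerivAt_angleToUnit (ξ : ℝ) : HasDerivAt angleToUnit (Real.cos ξ / 2) ξ :=
  ((Real.hasDerivAt_sin ξ).const_add 1).div_const 2

/-- The substitution `ξ = arcsin (2 x - 1)`. -/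
noncomputable def unitToAngle (x : ℝ) : ℝ := Real.arcsin (2 * x - 1)

lemma contDiffOn_unitToAngle : ContDiffOn ℝ (⊤ : ℕ∞) unitToAngle (Ioo 0 1) := by
  intro x hx
  refine ContDiffAt.contDiffWithinAt ?_
  refine (Real.contDiffAt_arcsin (x := 2 * x - 1) ?_ ?_).comp x
    (((contDiff_const.mul contDiff_id).sub contDiff_const).contDiffAt)
  · linarith [hx.1]
  · linarith [hx.2]

lemma unitToAngle_mem {x : ℝ} (hx : x ∈ Ioo (0 : ℝ) 1) :
    unitToAngle x ∈ Ioo (-(Real.pi / 2)) (Real.pi / 2) :=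
  ⟨Real.neg_pi_div_two_lt_arcsin.2 (by linarith [hx.1]),
    Real.arcsin_lt_pi_div_two.2 (by linarith [hx.2])⟩

lemma unitToAngle_angleToUnit {ξ : ℝ} (hξ : ξ ∈ Ioo (-(Real.pi / 2)) (Real.pi / 2)) :
    unitToAngle (angleToUnit ξ) = ξ := by
  rw [unitToAngle, angleToUnit, mul_div_cancel₀ _ two_ne_zero, add_sub_cancel_left,
    Real.arcsin_sin hξ.1.le hξ.2.le]

lemma angleToUnit_unitToAngle {x : ℝ} (hx : x ∈ Ioo (0 : ℝ) 1) :
    angleToUnit (unitToAngle x) = x := by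
  rw [unitToAngle, angleToUnit, Real.sin_arcsin (by linarith [hx.1]) (by linarith [hx.2])]
  ring

lemma image_angleToUnit :
    angleToUnit '' Ioo (-(Real.pi / 2)) (Real.pi / 2) = Ioo (0 : ℝ) 1 :=
  Subset.antisymm (image_subset_iff.2 fun _ h => angleToUnit_mem h)
    fun x hx => ⟨unitToAngle x, unitToAngle_mem hx, angleToUnit_unitToAngle hx⟩

lemma injOn_angleToUnit : InjOn angleToUnit (Ioo (-(Real.pi / 2)) (Real.pi / 2)) :=
  LeftInvOn.injOn (f₁' := unitToAngle) fun _ h => unitToAngle_angleToUnit h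

/-- This says `(dx/dξ)² = a / b`, which is why the substitution normalizes the leading coefficient
to `-1`. -/
lemma cos_div_two_sq (ξ : ℝ) :
    (Real.cos ξ / 2) ^ 2 = angleToUnit ξ * (1 - angleToUnit ξ) := by
  rw [angleToUnit, div_pow, Real.cos_sq']
  ring

lemma lintegral_weightMeasure {N : ℝ} {ℓ₁ : ℝ → ℝ} (h : AnalyticOnNhd ℝ ℓ₁ (Icc 0 1))
    (f : ℝ → ℝ≥0∞) : ∫⁻ x, f x ∂weightMeasure N ℓ₁ =
      ∫⁻ ξ in Ioo (-(Real.pi / 2)) (Real.pi / 2),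
        ENNReal.ofReal (Real.cos ξ / 2 * bfun N ℓ₁ (angleToUnit ξ)) * f (angleToUnit ξ) := by
  have hb : ContinuousOn (bfun N ℓ₁) (Ioo 0 1) := (contDiffOn_rpow _ _ h).continuousOn
  rw [weightMeasure, lintegral_withDensity_eq_lintegral_mul_non_measurable₀ _
    (f := fun x => ENNReal.ofReal (bfun N ℓ₁ x))
    (ENNReal.measurable_ofReal.comp_aemeasurable (hb.aemeasurable measurableSet_Ioo))
    (by simp), ← image_angleToUnit,
    lintegral_image_eq_lintegral_abs_deriv_mul measurableSet_Ioo
      (fun ξ _ => (hasDerivAt_angleToUnit ξ).hasDerivWithinAt) injOn_angleToUnit]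
  refine setLIntegral_congr_fun measurableSet_Ioo fun ξ hξ => ?_
  have hc : 0 < Real.cos ξ / 2 := half_pos (Real.cos_pos_of_mem_Ioo hξ)
  simp only [Pi.mul_apply]
  rw [abs_of_pos hc, ENNReal.ofReal_mul hc.le, mul_assoc]

end Substitution

/-! ### The Liouville transformation as a unitary map -/

section Liouville

variable {N : ℝ} {ℓ₁ L₀ : ℝ → ℝ}

/-- The factor `(a b)^{1/4}` of the Liouville transformation. -/
noncomputable def liouvilleFactor (N : ℝ) (ℓ₁ : ℝ → ℝ) (x : ℝ) : ℝ :=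
  (afun N ℓ₁ x * bfun N ℓ₁ x) ^ (1 / 4 : ℝ)

lemma afun_pos {x : ℝ} (hx : x ∈ Ioo (0 : ℝ) 1) : 0 < afun N ℓ₁ x := prod_pos _ _ hx

lemma liouvilleFactor_pos {x : ℝ} (hx : x ∈ Ioo (0 : ℝ) 1) : 0 < liouvilleFactor N ℓ₁ x :=
  Real.rpow_pos_of_pos (mul_pos (afun_pos hx) (bfun_pos hx)) _

lemma contDiffOn_liouvilleFactor (h : AnalyticOnNhd ℝ ℓ₁ (Icc 0 1)) :
    ContDiffOn ℝ (⊤ : ℕ∞) (liouvilleFactor N ℓ₁) (Ioo 0 1) :=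
  ((contDiffOn_rpow _ _ h).mul (contDiffOn_rpow _ _ h)).rpow_const_of_ne
    fun _ hx => (mul_pos (afun_pos hx) (bfun_pos hx)).ne'

lemma hasDerivAt_liouvilleFactor (h : AnalyticOnNhd ℝ ℓ₁ (Icc 0 1)) {x : ℝ}
    (hx : x ∈ Ioo (0 : ℝ) 1) :
    HasDerivAt (liouvilleFactor N ℓ₁)
      (liouvilleFactor N ℓ₁ x * ((logDa N ℓ₁ x + logDb N ℓ₁ x) / 4)) x := by
  have ha : HasDerivAt (afun N ℓ₁) (deriv (afun N ℓ₁) x) x :=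
    ((hasDerivAt_rpow_mul_rpow_mul_Mfun h (5 / 2) (N / 2) hx).differentiableAt).hasDerivAt
  have hb : HasDerivAt (bfun N ℓ₁) (deriv (bfun N ℓ₁) x) x :=
    ((hasDerivAt_rpow_mul_rpow_mul_Mfun h (3 / 2) (N / 2 - 1) hx).differentiableAt).hasDerivAt
  have ha0 := afun_pos (N := N) (ℓ₁ := ℓ₁) hx
  have hb0 := bfun_pos (N := N) (ℓ₁ := ℓ₁) hx
  have hab := mul_pos ha0 hb0
  have := (ha.mul hb).rpow_const (p := 1 / 4) (Or.inl hab.ne')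
  refine this.congr_deriv ?_
  rw [Pi.mul_apply, Real.rpow_sub_one hab.ne', liouvilleFactor, logDa, logDb]
  field_simp

/-- As `a = (dx/dξ)² b`, the square root of `a b` is `b dx/dξ`, exactly the density of `b dx` in the
variable `ξ`. Hence the transformation is isometric. -/
lemma liouvilleFactor_sq {ξ : ℝ} (hξ : ξ ∈ Ioo (-(Real.pi / 2)) (Real.pi / 2)) :
    liouvilleFactor N ℓ₁ (angleToUnit ξ) ^ 2 = Real.cos ξ / 2 * bfun N ℓ₁ (angleToUnit ξ) := by
  have hx := angleToUnit_mem hξ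
  have hc : 0 < Real.cos ξ / 2 := half_pos (Real.cos_pos_of_mem_Ioo hξ)
  have hb0 := bfun_pos (N := N) (ℓ₁ := ℓ₁) hx
  rw [liouvilleFactor, afun_eq hx, ← cos_div_two_sq, ← Real.rpow_natCast, ← Real.rpow_mul
    (by positivity)]
  norm_num
  rw [← Real.sqrt_eq_rpow, Real.sqrt_eq_iff_mul_self_eq (by positivity) (by positivity)]
  ring

/-- The Liouville transformation `φ ↦ ((a b)^{1/4} φ)(x(ξ))` of test functions. -/
noncomputable def liouvilleTest (N : ℝ) (h : AnalyticOnNhd ℝ ℓ₁ (Icc 0 1)) :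
    𝓓(unitInt, ℂ) ≃ₗ[ℂ] 𝓓(angleInt, ℂ) :=
  weightedPullbackEquiv (Ω := unitInt) (Ω' := angleInt) (X := angleToUnit) (Y := unitToAngle)
    (contDiffOn_liouvilleFactor (N := N) h) (fun _ hx => (liouvilleFactor_pos hx).ne')
    contDiff_angleToUnit.contDiffOn (fun _ hξ => angleToUnit_mem hξ) contDiffOn_unitToAngle
    (fun _ hx => unitToAngle_mem hx) (fun _ hξ => unitToAngle_angleToUnit hξ)
    (fun _ hx => angleToUnit_unitToAngle hx)

lemma liouvilleTest_apply (h : AnalyticOnNhd ℝ ℓ₁ (Icc 0 1)) (φ : 𝓓(unitInt, ℂ)) {ξ : ℝ}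
    (hξ : ξ ∈ Ioo (-(Real.pi / 2)) (Real.pi / 2)) :
    liouvilleTest N h φ ξ = (liouvilleFactor N ℓ₁ (angleToUnit ξ) : ℂ) * φ (angleToUnit ξ) :=
  weightedPullbackEquiv_apply _ _ _ _ _ _ _ _ φ hξ

lemma norm_liouvilleTest (h : AnalyticOnNhd ℝ ℓ₁ (Icc 0 1)) (φ : 𝓓(unitInt, ℂ)) :
    ‖testToL2 admissible_angle (liouvilleTest N h φ)‖ = ‖testToL2 (admissible_weight N h) φ‖ := by
  rw [norm_testToL2, norm_testToL2, lintegral_weightMeasure h, angleMeasure]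
  congr 2
  refine setLIntegral_congr_fun measurableSet_Ioo fun ξ hξ => ?_
  rw [liouvilleTest_apply h φ hξ, enorm_mul, ENNReal.mul_rpow_of_nonneg _ _ zero_le_two,
    ← liouvilleFactor_sq hξ]
  congr 1
  rw [ENNReal.rpow_two, ← ofReal_norm, Complex.norm_real,
    ← ENNReal.ofReal_pow (norm_nonneg _), Real.norm_eq_abs, sq_abs]

lemma weightMeasure_compl : weightMeasure N ℓ₁ (unitInt : Set ℝ)ᶜ = 0 := by
  refine withDensity_absolutelyContinuous _ _ ?_
  rw [Measure.restrict_apply unitInt.isOpen.measurableSet.compl]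
  change volume ((Ioo (0 : ℝ) 1)ᶜ ∩ Ioo 0 1) = 0
  simp

/-- The Liouville transformation as a unitary map from `L²(b dx)` onto `L²(-π/2, π/2)`. -/
noncomputable def liouvilleUnitary (N : ℝ) (h : AnalyticOnNhd ℝ ℓ₁ (Icc 0 1)) :
    Lp ℂ 2 (weightMeasure N ℓ₁) ≃ₗᵢ[ℂ] Lp ℂ 2 angleMeasure :=
  (liouvilleTest N h).extendOfIsometry (testToL2 (admissible_weight N h))
    (testToL2 admissible_angle) (denseRange_testToL2 _ weightMeasure_compl)
    (denseRange_testToL2 _ angleMeasure_compl) (norm_liouvilleTest h)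

lemma liouvilleUnitary_testToL2 (h : AnalyticOnNhd ℝ ℓ₁ (Icc 0 1)) (φ : 𝓓(unitInt, ℂ)) :
    liouvilleUnitary N h (testToL2 (admissible_weight N h) φ) =
      testToL2 admissible_angle (liouvilleTest N h φ) :=
  LinearEquiv.extendOfIsometry_eq _ _ _ _ _ _ _

end Liouville

/-! ### Intertwining of the two differential expressions -/

section LiouvilleIdentity

variable {N : ℝ} {ℓ₁ L₀ : ℝ → ℝ}

lemma coeffOne_eq (h : AnalyticOnNhd ℝ ℓ₁ (Icc 0 1)) {x : ℝ} (hx : x ∈ Ioo (0 : ℝ) 1) :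
    coeffOne N ℓ₁ x = -(x * (1 - x) * logDa N ℓ₁ x) := by
  have h0 := hx.1.ne'
  have h1 := (sub_pos.2 hx.2).ne'
  rw [coeffOne, logDa_eq h hx]
  field_simp
  ring

/-- A form of `(a/b)' = (a/b)(a'/a - b'/b)` with `a/b = x(1 - x)`. It is what removes the
first-order term in the normal form. -/
lemma mul_logDa_add_logDb (h : AnalyticOnNhd ℝ ℓ₁ (Icc 0 1)) {x : ℝ}
    (hx : x ∈ Ioo (0 : ℝ) 1) :
    x * (1 - x) * (logDa N ℓ₁ x + logDb N ℓ₁ x) =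
      2 * (x * (1 - x)) * logDa N ℓ₁ x - (1 - 2 * x) := by
  have h0 := hx.1.ne'
  have h1 := (sub_pos.2 hx.2).ne'
  rw [logDb_eq h hx, logDa_eq h hx]
  field_simp
  ring

lemma hasDerivAt_liouvilleFactor_mul (h : AnalyticOnNhd ℝ ℓ₁ (Icc 0 1)) {f : ℝ → ℂ} {f' : ℂ}
    {ξ : ℝ} (hξ : ξ ∈ Ioo (-(Real.pi / 2)) (Real.pi / 2))
    (hf : HasDerivAt f f' (angleToUnit ξ)) :
    HasDerivAt (fun t => (liouvilleFactor N ℓ₁ (angleToUnit t) : ℂ) * f (angleToUnit t))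
      ((Real.cos ξ / 2 : ℝ) * (liouvilleFactor N ℓ₁ (angleToUnit ξ) *
        (((logDa N ℓ₁ (angleToUnit ξ) + logDb N ℓ₁ (angleToUnit ξ)) / 4 : ℝ) *
          f (angleToUnit ξ) + f'))) ξ := by
  have h1 := ((hasDerivAt_liouvilleFactor (N := N) h (angleToUnit_mem hξ)).ofReal_comp).mul hf
  refine (h1.scomp ξ (hasDerivAt_angleToUnit ξ)).congr_deriv ?_
  rw [Complex.real_smul]
  push_cast
  ring

/-- After two applications of the chain rule with `m' = m (a'/a + b'/b) / 4` for the factor `m`, the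
terms in `φ''` agree because `(dx/dξ)² = x(1 - x)`. Those in `φ'` agree by `mul_logDa_add_logDb`,
and what multiplies `φ` is the definition of `q`. -/
lemma diffExpr_liouvilleTest (h : AnalyticOnNhd ℝ ℓ₁ (Icc 0 1)) (φ : 𝓓(unitInt, ℂ)) {ξ : ℝ}
    (hξ : ξ ∈ Ioo (-(Real.pi / 2)) (Real.pi / 2)) :
    diffExpr (fun _ => -1) (fun _ => 0) (potential N ℓ₁ L₀) (liouvilleTest N h φ) ξ =
      (liouvilleFactor N ℓ₁ (angleToUnit ξ) : ℂ) *
        diffExpr (fun x => -(x * (1 - x))) (coeffOne N ℓ₁) L₀ φ (angleToUnit ξ) := by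
  obtain ⟨d0, d1, -⟩ := testFunction_deriv φ
  have hI : Ioo (-(Real.pi / 2)) (Real.pi / 2) ∈ 𝓝 ξ := isOpen_Ioo.mem_nhds hξ
  have hD1 : deriv (liouvilleTest N h φ) =ᶠ[𝓝 ξ] fun t => ((Real.cos t / 2 : ℝ) : ℂ) *
      ((liouvilleFactor N ℓ₁ (angleToUnit t) : ℂ) *
        (fun x => (((logDa N ℓ₁ x + logDb N ℓ₁ x) / 4 : ℝ) : ℂ) * φ x + deriv φ x)
          (angleToUnit t)) := by
    filter_upwards [hI] with t ht
    have e : (liouvilleTest N h φ : ℝ → ℂ) =ᶠ[𝓝 t]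
        fun t => (liouvilleFactor N ℓ₁ (angleToUnit t) : ℂ) * φ (angleToUnit t) := by
      filter_upwards [isOpen_Ioo.mem_nhds ht] with s hs using liouvilleTest_apply h φ hs
    rw [e.deriv_eq]
    exact (hasDerivAt_liouvilleFactor_mul h ht (d0 _).hasDerivAt).deriv
  have hx := angleToUnit_mem hξ
  set x := angleToUnit ξ with hxdef
  have hP : HasDerivAt (fun t => logDa N ℓ₁ t + logDb N ℓ₁ t)
      (deriv (fun t => logDa N ℓ₁ t + logDb N ℓ₁ t) x) x :=
    (hasDerivAt_logDa_add_logDb h hx).differentiableAt.hasDerivAt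
  have hG := (((hP.div_const 4).ofReal_comp).mul (d0 x).hasDerivAt).add (d1 x).hasDerivAt
  have hC : HasDerivAt (fun t => ((Real.cos t / 2 : ℝ) : ℂ)) ((-Real.sin ξ / 2 : ℝ) : ℂ) ξ :=
    ((Real.hasDerivAt_cos ξ).div_const 2).ofReal_comp
  have hD2 := (hC.mul (hasDerivAt_liouvilleFactor_mul (N := N) h hξ hG)).deriv
  have hs : Real.sin ξ = 2 * x - 1 := by rw [hxdef, angleToUnit]; ring
  have hpot : potential N ℓ₁ L₀ ξ = potX N ℓ₁ L₀ x := rfl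
  have hrel := congrArg (fun r : ℝ => (r : ℂ)) (mul_logDa_add_logDb (N := N) h hx)
  have hsq := congrArg (fun r : ℝ => (r : ℂ)) (cos_div_two_sq ξ)
  simp only [← hxdef] at hsq
  simp only [diffExpr]
  rw [hD1.deriv_eq]
  erw [hD2]
  rw [liouvilleTest_apply h φ hξ, hpot, potX, afun_div_bfun hx, coeffOne_eq h hx, hs]
  simp only [Pi.add_apply, Pi.mul_apply, ← hxdef]
  generalize deriv (fun t => logDa N ℓ₁ t + logDb N ℓ₁ t) x = P' at *
  generalize logDa N ℓ₁ x = A at *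
  generalize logDb N ℓ₁ x = B at *
  generalize liouvilleFactor N ℓ₁ x = m at *
  generalize deriv (deriv φ) x = φ2 at *
  generalize deriv φ x = φ1 at *
  push_cast at *
  -- The multiplier of `hsq` is the part of the second derivative carrying `(cos ξ / 2)²`; that of
  -- `hrel` corrects the terms containing `1 - 2x = -sin ξ`.
  linear_combination (-((m : ℂ) * ((A + B) / 4 * ((A + B) / 4 * φ x + φ1) +
    (P' / 4 * φ x + (A + B) / 4 * φ1 + φ2)))) * hsq -
    (m : ℂ) * (φ1 / 2 + (A + B) / 8 * φ x) * hrel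

/-- Since the coefficients of `𝓛` are smooth on `(0, 1)`, `𝓛 φ` is again a test function. The
explicit formula for the unitary map on test functions therefore applies to it. -/
lemma liouvilleUnitary_diffToL2 (h : AnalyticOnNhd ℝ ℓ₁ (Icc 0 1))
    (hL : AnalyticOnNhd ℝ L₀ (Icc 0 1)) (φ : 𝓓(unitInt, ℂ)) :
    liouvilleUnitary N h (diffToL2 (admissible_weight N h)
        (p₂ := fun x => -(x * (1 - x))) (by fun_prop) (continuousOn_coeffOne N h)
        (hL.continuousOn.mono Ioo_subset_Icc_self) φ) =
      diffToL2 admissible_angle (p₂ := fun _ => -1) (p₁ := fun _ => 0) continuousOn_const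
        continuousOn_const (continuousOn_potential N h hL) (liouvilleTest N h φ) := by
  have hs : ∀ {f : ℝ → ℝ}, AnalyticOnNhd ℝ f (Icc 0 1) → ContDiffOn ℝ (⊤ : ℕ∞) f (Ioo 0 1) :=
    fun hf x hx => (hf x (Ioo_subset_Icc_self hx)).contDiffAt.contDiffWithinAt
  have h₂ : ContDiffOn ℝ (⊤ : ℕ∞) (fun x : ℝ => -(x * (1 - x))) unitInt := by fun_prop
  have h₁ : ContDiffOn ℝ (⊤ : ℕ∞) (coeffOne N ℓ₁) unitInt :=
    ContDiffOn.add (by fun_prop)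
      (((hs h).mul contDiffOn_id).mul (contDiffOn_const.sub contDiffOn_id))
  refine (liouvilleUnitary_testToL2 h (diffTest h₂ h₁ (hs hL) φ)).trans (Lp.ext ?_)
  filter_upwards [coeFn_testToL2 admissible_angle (liouvilleTest N h (diffTest h₂ h₁ (hs hL) φ)),
    coeFn_diffToL2 admissible_angle (p₂ := fun _ => -1) (p₁ := fun _ => 0) continuousOn_const
      continuousOn_const (continuousOn_potential N h hL) (liouvilleTest N h φ),
    ae_angleMeasure_mem] with ξ e1 e2 hξ
  rw [e1, e2, diffExpr_liouvilleTest h φ hξ, liouvilleTest_apply h _ hξ]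
  rfl

lemma liouvilleUnitary_mem_graph (h : AnalyticOnNhd ℝ ℓ₁ (Icc 0 1))
    (hL : AnalyticOnNhd ℝ L₀ (Icc 0 1)) (u : (ellOp N h hL).domain) :
    (liouvilleUnitary N h u, liouvilleUnitary N h (ellOp N h hL u)) ∈
      (schrodingerOp N h hL).graph := by
  obtain ⟨_, φ, rfl⟩ := u
  refine (LinearPMap.mem_graph_iff _).2
    ⟨⟨testToL2 admissible_angle (liouvilleTest N h φ), ⟨_, rfl⟩⟩,
      (liouvilleUnitary_testToL2 h φ).symm, ?_⟩
  exact (diffOp_apply admissible_angle _ _ _ _).trans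
    ((liouvilleUnitary_diffToL2 h hL φ).symm.trans
      (congrArg _ (diffOp_apply (admissible_weight N h) _ _ _ φ).symm))

end LiouvilleIdentity


theorem proposition7 (N : ℝ) (hN : 4 < N) (ℓ₁ L₀ : ℝ → ℝ)
    (hℓ : AnalyticOnNhd ℝ ℓ₁ (Icc 0 1)) (hL : AnalyticOnNhd ℝ L₀ (Icc 0 1)) :
    -- inverse-square behaviour of `q` at the two ends
    (potential N ℓ₁ L₀ ~[𝓝[>] (-(Real.pi / 2))] fun ξ => 2 / (ξ + Real.pi / 2) ^ 2) ∧
    (potential N ℓ₁ L₀ ~[𝓝[<] (Real.pi / 2)]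
      fun ξ => (N - 1) * (N - 3) / 4 / (Real.pi / 2 - ξ) ^ 2) ∧
    -- `L²(b dx)` is `L²(x^{3/2} (1-x)^{N/2-1} dx)` with an equivalent norm
    (∃ C : ℝ, weightMeasure N ℓ₁ ≤ ENNReal.ofReal C • plainMeasure N ∧
      plainMeasure N ≤ ENNReal.ofReal C • weightMeasure N ℓ₁) ∧
    ∃ S : Lp ℂ 2 angleMeasure →ₗ.[ℂ] Lp ℂ 2 angleMeasure,
      schrodingerOp N hℓ hL ≤ S ∧ IsFriedrichsExtension (schrodingerOp N hℓ hL) S ∧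
      IsSelfAdjoint S ∧
      ∃ lam : ℕ → ℝ, StrictMono lam ∧ Tendsto lam atTop atTop ∧ HasSimpleSpectrum S lam ∧
        ∃ T : Lp ℂ 2 (weightMeasure N ℓ₁) →ₗ.[ℂ] Lp ℂ 2 (weightMeasure N ℓ₁),
          ellOp N hℓ hL ≤ T ∧ IsSelfAdjoint T ∧ HasSimpleSpectrum T lam := by
  refine ⟨potential_isEquivalent_left hℓ hL, potential_isEquivalent_right hN hℓ hL,
    weightMeasure_equivalent N hℓ, ?_⟩
  obtain ⟨K, c, hK, hs, hle, hF, lam, hmono, hlim, hspec⟩ :=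
    exists_friedrichs_simpleSpectrum (continuousOn_potential N hℓ hL)
      (potential_bounded_below hN hℓ hL)
  -- The extension of `𝓛` is `(U⁻¹ K U)⁻¹ - c`, where `U` is the Liouville unitary map. It contains
  -- `𝓛` on test functions because `U` maps the graph of the minimal operator into that of the
  -- Schrödinger operator.
  refine ⟨shiftedInverse K c, hle, hF, isSelfAdjoint_shiftedInverse hK hs c, lam, hmono, hlim,
    hspec, shiftedInverse (conjOperator (liouvilleUnitary N hℓ) K) c, ?_,
    isSelfAdjoint_shiftedInverse (conjOperator_injective _ hK) (conjOperator_isSymmetric _ hs) c,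
    hspec.of_unitary (liouvilleUnitary N hℓ) fun _ _ => mem_graph_shiftedInverse_conj _ hK⟩
  exact le_of_forall_mem_graph fun u => (mem_graph_shiftedInverse_conj _ hK).2
    (LinearPMap.le_graph_of_le hle (liouvilleUnitary_mem_graph hℓ hL u))
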